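/- **Theorem (action of the extended operad on the completion).** *Setting.* Let $\mathbf{Spc}$ be a complete and cocomplete convenient category of topological spaces: a full subcategory of the category of topological spaces that is complete, cocomplete and cartesian closed and contains all CW-complexes. Let $(\mathcal E,\diamond,I)$ be a complete and cocomplete monoidal category that is enriched, tensored and cotensored over $\mathbf{Spc}$ and whose product $\diamond$ is an enriched functor with enriched associativity and unit isomorphisms. Let $A$ be a non-symmetric operad in $\mathbf{Spc}$ that is $A_\infty$, that is, every $A(n)$, $n\ge 0$, is a contractible CW-complex. Let $K\in\mathcal E$ be an $A$-algebra, that is, an object with a morphism of operads from $A$ to the endomorphism operad $\operatorname{End}(K)(n)=\operatorname{map}(K^{\diamond n},K)$. *Notation.* - $D_+$ is the category of operators of $A$: its objects are the finite ordered sets, $D_+(S,T)=\coprod_{\varphi}\prod_{t\in T}A(\varphi^{-1}t)$ with $\varphi$ ranging over the monotone maps $S\to T$, and composition comes from the operad. Let $D\subset D_+$ be the full subcategory of the nonempty sets. - $R=R_K\colon D_+\to\mathcal E$ is the functor $S\mapsto K^{\diamond S}$, on which the component of $\varphi$ of $D_+(S,T)$ acts by the $\diamond$-product over $t\in T$ of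 the actions $A(\varphi^{-1}t)\to\operatorname{map}(K^{\diamond\varphi^{-1}t},K)$. - $\tilde ED\colon D_+\to\mathbf{Spc}$ is the functor whose value at $T$ is the realization of the bar construction $[p]\mapsto\coprod_{c_0,\dots,c_p\in D}D(c_p,c_{p-1})\times\cdots\times D(c_1,c_0)\times D_+(c_0,T)$; it is empty at $T=\emptyset$. - For a functor $W\colon D_+\to\mathbf{Spc}$, $[W,R]=\int_{T\in D_+}R(T)^{W(T)}\in\mathcal E$. - $\varepsilon(n)\colon D_+\to\mathbf{Spc}$ is the left Kan extension of $(V_1,\dots,V_n)\mapsto\tilde ED(V_1)\times\cdots\times\tilde ED(V_n)$ along the ordinal sum $u\colon D_+^n\to D_+$, $(V_1,\dots,V_n)\mapsto V_1\sqcup\cdots\sqcup V_n$. Elements of $\varepsilon(n)(T)$ are classes $[e_1,\dots,e_n;\theta]$ with $e_i\in\tilde ED(V_i)$ and $\theta\in D_+(V_1\sqcup\cdots\sqcup V_n,T)$; in particular $\varepsilon(1)\cong\tilde ED$. - The extended operad is $\tilde A(n)=\operatorname{map}_{D_+^*}(\tilde ED,\varepsilon(n))$, the space of natural transformations. Its unit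 is $\tilde ED\cong\varepsilon(1)$, and its composition is $f\bullet(g_1,\dots,g_n)=\operatorname{LKan}_u(g_1\tilde\times\cdots\tilde\times g_n)\circ f$, where $g_i\in\tilde A(k_i)$ and $\operatorname{LKan}_u(g_1\tilde\times\cdots\tilde\times g_n)\colon\varepsilon(n)\to\varepsilon(k_1+\cdots+k_n)$ is the transformation induced by the $g_i$. - $\hat K=[\tilde ED,R]$ is the completion of $K$, and $R^{(n)}=[\varepsilon(n),R]$. A map $f\in\tilde A(n)$ induces $f^*\colon R^{(n)}\to\hat K$. *Claim.* There are unique maps $\beta_n\colon\hat K^{\diamond n}\to R^{(n)}$, $n\ge0$, such that for all $e_i\in\tilde ED(V_i)$ the component of $\beta_n$ at $[e_1,\dots,e_n;\mathrm{id}]$ is $\pi_{e_1}\diamond\cdots\diamond\pi_{e_n}\colon\hat K^{\diamond n}\to K^{\diamond V_1}\diamond\cdots\diamond K^{\diamond V_n}=R(V_1\sqcup\cdots\sqcup V_n)$, where $\pi_e\colon\hat K\to R(V)$ is the projection of the end at $e\in\tilde ED(V)$. The completion $\hat K$ is an algebra over the extended operad $\tilde A$: the maps $$\tilde A(n)=\operatorname{map}_{D_+^*}(\tilde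 ED,\varepsilon(n))\xrightarrow{\ f\mapsto f^*\ }\operatorname{map}(R^{(n)},\hat K)\xrightarrow{\ \beta_n^*\ }\operatorname{map}(\hat K^{\diamond n},\hat K)$$ form a morphism of operads $\tilde A\to\operatorname{End}(\hat K)$, that is, they respect the units and the compositions. -/

import Mathlib

open CategoryTheory Limits MonoidalCategory CartesianMonoidalCategory MonoidalClosed

universe u v w

set_option linter.unusedSectionVars false

noncomputable section

namespace OperadCompletion

section Basics

variable {V : Type v} [Category.{u} V] [CartesianMonoidalCategory V]

/-! ### Finite products indexed by lists -/

/-- The product `X i₁ × ⋯ × X iₙ` for a list `[i₁, …, iₙ]` of indices. -/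
def listProd {ι : Type} (X : ι → V) : List ι → V
  | [] => 𝟙_ V
  | i :: L => X i ⊗ listProd X L

/-- An element at stage `Z` of some member of the family `X`: an index `i` and a map `Z ⟶ X i`. -/
abbrev Elt {ι : Type} (Z : V) (X : ι → V) := Σ i, (Z ⟶ X i)

/-- Restriction of elements along a map of stages. -/
def pull {ι : Type} {X : ι → V} {Z Z' : V} (h : Z' ⟶ Z) (x : Elt Z X) : Elt Z' X :=
  ⟨x.1, h ≫ x.2⟩

/-- The tuple of elements with the given components. -/
def listMk {ι : Type} {X : ι → V} {Z : V} :
    (l : List (Elt Z X)) → (Z ⟶ listProd X (l.map Sigma.fst))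
  | [] => toUnit Z
  | x :: l => lift x.2 (listMk l)

/-- The components of an element of a product indexed by a list. -/
def listElts {ι : Type} {X : ι → V} {Z : V} :
    (L : List ι) → (Z ⟶ listProd X L) → List (Elt Z X)
  | [], _ => []
  | i :: L, p => ⟨i, p ≫ fst _ _⟩ :: listElts L (p ≫ snd _ _)

/-- A family of maps induces a map of products indexed by a list. -/
def listMap {ι : Type} {X Y : ι → V} (f : ∀ i, X i ⟶ Y i) :
    (L : List ι) → (listProd X L ⟶ listProd Y L)
  | [] => 𝟙 _
  | i :: L => f i ⊗ₘ listMap f L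

variable {ι : Type} {X : ι → V} {Z Z' : V}

@[simp] lemma pull_fst (h : Z' ⟶ Z) (x : Elt Z X) : (pull h x).1 = x.1 := rfl

@[simp] lemma map_fst_listElts (L : List ι) (p : Z ⟶ listProd X L) :
    (listElts L p).map Sigma.fst = L := by
  induction L with
  | nil => rfl
  | cons i L ih => simp [listElts, ih]

@[simp] lemma map_fst_pull (h : Z' ⟶ Z) (l : List (Elt Z X)) :
    (l.map (pull h)).map Sigma.fst = l.map Sigma.fst := by
  simp [Function.comp_def]

lemma pull_listElts (h : Z' ⟶ Z) (L : List ι) (p : Z ⟶ listProd X L) :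
    (listElts L p).map (pull h) = listElts L (h ≫ p) := by
  induction L with
  | nil => rfl
  | cons i L ih =>
    refine congrArg₂ List.cons ?_ ?_
    · exact Sigma.ext rfl (heq_of_eq (Category.assoc _ _ _).symm)
    · exact (ih _).trans (congrArg _ (Category.assoc _ _ _).symm)

@[simp] lemma listElts_listMk (l : List (Elt Z X)) :
    listElts (l.map Sigma.fst) (listMk l) = l := by
  induction l with
  | nil => rfl
  | cons x l ih =>
    refine congrArg₂ List.cons ?_ ?_
    · exact Sigma.ext rfl (heq_of_eq (lift_fst _ _))
    · exact (congrArg _ (lift_snd _ _)).trans ih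

lemma listElts_injective (L : List ι) {p q : Z ⟶ listProd X L}
    (h : listElts L p = listElts L q) : p = q := by
  induction L with
  | nil => exact toUnit_unique _ _
  | cons i L ih =>
    simp only [listElts, List.cons.injEq, Sigma.mk.injEq, heq_eq_eq, true_and] at h
    exact CartesianMonoidalCategory.hom_ext _ _ h.1 (ih h.2)

lemma listElts_eqToHom {L L' : List ι} (e : L = L') (p : Z ⟶ listProd X L) :
    listElts L' (p ≫ eqToHom (congrArg (listProd X) e)) = listElts L p := by
  subst e; simp

lemma listMk_listElts (L : List ι) (p : Z ⟶ listProd X L) :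
    listMk (listElts L p) =
      p ≫ eqToHom (congrArg (listProd X) (map_fst_listElts L p).symm) := by
  apply listElts_injective
  rw [listElts_listMk, listElts_eqToHom]
  exact (map_fst_listElts L p).symm

lemma comp_listMk (h : Z' ⟶ Z) (l : List (Elt Z X)) :
    h ≫ listMk l = listMk (l.map (pull h)) ≫
      eqToHom (congrArg (listProd X) (map_fst_pull h l)) := by
  apply listElts_injective
  rw [listElts_eqToHom, listElts_listMk, ← pull_listElts, listElts_listMk]
  exact map_fst_pull h l

end Basics

section Closed

variable {V : Type v} [Category.{u} V] [CartesianMonoidalCategory V] [MonoidalClosed V]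

/-- The interchange of the two factors of a product. -/
def swap (X Y : V) : X ⊗ Y ⟶ Y ⊗ X := lift (snd _ _) (fst _ _)

@[simp] lemma swap_swap (X Y : V) : swap X Y ≫ swap Y X = 𝟙 _ := by
  ext <;> simp [swap]

@[simp] lemma swap_swap_assoc (X Y : V) {T : V} (t : X ⊗ Y ⟶ T) : swap X Y ≫ swap Y X ≫ t = t := by
  rw [← Category.assoc, swap_swap, Category.id_comp]

lemma whiskerRight_swap {X X' : V} (f : X ⟶ X') (Y : V) :
    f ▷ Y ≫ swap X' Y = swap X Y ≫ Y ◁ f := by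
  ext <;> simp [swap]

lemma whiskerRight_swap_assoc {X X' : V} (f : X ⟶ X') (Y : V) {T : V} (t : Y ⊗ X' ⟶ T) :
    f ▷ Y ≫ swap X' Y ≫ t = swap X Y ≫ Y ◁ f ≫ t := by
  rw [← Category.assoc, whiskerRight_swap, Category.assoc]

lemma whiskerLeft_swap {X X' : V} (f : X ⟶ X') (Y : V) :
    Y ◁ f ≫ swap Y X' = swap Y X ≫ f ▷ Y := by
  ext <;> simp [swap]

lemma whiskerLeft_swap_assoc {X X' : V} (f : X ⟶ X') (Y : V) {T : V} (t : X' ⊗ Y ⟶ T) :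
    Y ◁ f ≫ swap Y X' ≫ t = swap Y X ≫ f ▷ Y ≫ t := by
  rw [← Category.assoc, whiskerLeft_swap, Category.assoc]

variable {J : MultispanShape.{0, 0}} (I : MultispanIndex J V) [HasMulticoequalizer I]

/-- Maps out of `colim × W`, for a colimit presented by generators and relations. -/
def mcDesc {W T : V} (k : ∀ b, I.right b ⊗ W ⟶ T)
    (hk : ∀ a, I.fst a ▷ W ≫ k _ = I.snd a ▷ W ≫ k _) : multicoequalizer I ⊗ W ⟶ T :=
  swap _ _ ≫ uncurry (Multicoequalizer.desc I _ (fun b => curry (swap _ _ ≫ k b)) (by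
    intro a
    rw [← curry_natural_left, ← curry_natural_left, whiskerLeft_swap_assoc,
      whiskerLeft_swap_assoc, hk]))

@[simp] lemma π_mcDesc {W T : V} (k : ∀ b, I.right b ⊗ W ⟶ T)
    (hk : ∀ a, I.fst a ▷ W ≫ k _ = I.snd a ▷ W ≫ k _) (b : J.R) :
    Multicoequalizer.π I b ▷ W ≫ mcDesc I k hk = k b := by
  rw [mcDesc, whiskerRight_swap_assoc, ← uncurry_natural_left, Multicoequalizer.π_desc,
    uncurry_curry, swap_swap_assoc]

lemma lift_π_mcDesc {Z W T : V} (k : ∀ b, I.right b ⊗ W ⟶ T)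
    (hk : ∀ a, I.fst a ▷ W ≫ k _ = I.snd a ▷ W ≫ k _) (b : J.R) (p : Z ⟶ I.right b) (w : Z ⟶ W) :
    lift (p ≫ Multicoequalizer.π I b) w ≫ mcDesc I k hk = lift p w ≫ k b := by
  rw [← π_mcDesc I k hk, lift_whiskerRight_assoc]

lemma mc_ext {W T : V} {f g : multicoequalizer I ⊗ W ⟶ T}
    (h : ∀ b, Multicoequalizer.π I b ▷ W ≫ f = Multicoequalizer.π I b ▷ W ≫ g) : f = g := by
  have key : swap _ _ ≫ f = swap _ _ ≫ g := by
    apply curry_injective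
    apply Multicoequalizer.hom_ext
    intro b
    rw [← curry_natural_left, ← curry_natural_left, whiskerLeft_swap_assoc,
      whiskerLeft_swap_assoc, h]
  simpa using congrArg (fun t => swap _ _ ≫ t) key

variable {ι : Type} (X : ι → V) [HasCoproduct X]

/-- Maps out of `(∐ X) × W`. -/
def sigmaDesc {W T : V} (k : ∀ b, X b ⊗ W ⟶ T) : (∐ X) ⊗ W ⟶ T :=
  swap _ _ ≫ uncurry (Sigma.desc (fun b => curry (swap _ _ ≫ k b)))

@[simp] lemma ι_sigmaDesc {W T : V} (k : ∀ b, X b ⊗ W ⟶ T) (b : ι) :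
    Sigma.ι X b ▷ W ≫ sigmaDesc X k = k b := by
  rw [sigmaDesc, whiskerRight_swap_assoc, ← uncurry_natural_left, Sigma.ι_desc,
    uncurry_curry, swap_swap_assoc]

lemma lift_ι_sigmaDesc {Z W T : V} (k : ∀ b, X b ⊗ W ⟶ T) (b : ι) (p : Z ⟶ X b)
    (w : Z ⟶ W) : lift (p ≫ Sigma.ι X b) w ≫ sigmaDesc X k = lift p w ≫ k b := by
  rw [← ι_sigmaDesc X k, lift_whiskerRight_assoc]

lemma sigma_ext {W T : V} {f g : (∐ X) ⊗ W ⟶ T}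
    (h : ∀ b, Sigma.ι X b ▷ W ≫ f = Sigma.ι X b ▷ W ≫ g) : f = g := by
  have key : swap _ _ ≫ f = swap _ _ ≫ g := by
    apply curry_injective
    apply Sigma.hom_ext
    intro b
    rw [← curry_natural_left, ← curry_natural_left, whiskerLeft_swap_assoc,
      whiskerLeft_swap_assoc, h]
  simpa using congrArg (fun t => swap _ _ ≫ t) key

end Closed

section Operads

variable (V : Type v) [Category.{u} V] [CartesianMonoidalCategory V]

/-! ### Non-symmetric operads -/

/-- The data of a non-symmetric operad in `V`: objects `A(n)`, a unit in `A(1)` and compositions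
`A(n) × A(k₁) × ⋯ × A(kₙ) ⟶ A(k₁ + ⋯ + kₙ)`. -/
structure OperadData where
  /-- The object of `n`-ary operations. -/
  obj : ℕ → V
  /-- The unit. -/
  one : 𝟙_ V ⟶ obj 1
  /-- The composition `A(n) × A(k₁) × ⋯ × A(kₙ) ⟶ A(k₁ + ⋯ + kₙ)`. -/
  comp (ks : List ℕ) : obj ks.length ⊗ listProd obj ks ⟶ obj ks.sum

variable {V}

namespace OperadData

variable (A : OperadData V)

/-- Operations of the operad at stage `Z`: an arity `n` and a map `Z ⟶ A(n)`. -/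
abbrev Op (Z : V) := Elt Z A.obj

variable {A} {Z Z' : V}

/-- The total arity of a list of operations. -/
abbrev arity (l : List (A.Op Z)) : ℕ := (l.map Sigma.fst).sum

/-- The composite `f(g₁, …, gₙ)` of an `n`-ary operation with `n` operations. (If `n` is not the
arity of `f`, the value is `f`; this case never matters.) -/
def gamma (f : A.Op Z) (gs : List (A.Op Z)) : A.Op Z :=
  if h : f.1 = gs.length then
    ⟨arity gs, lift (f.2 ≫ eqToHom (by rw [h, List.length_map])) (listMk gs) ≫
      A.comp (gs.map Sigma.fst)⟩
  else f

/-- The simultaneous composite of a list of operations `b₁, …, bₚ` with a list of operations `as`: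
the list `as` is cut into consecutive blocks whose lengths are the arities of the `bⱼ`, and `bⱼ` is
composed with the `j`-th block. -/
def blocks : List (A.Op Z) → List (A.Op Z) → List (A.Op Z)
  | [], _ => []
  | b :: bs, as => gamma b (as.take b.1) :: blocks bs (as.drop b.1)

variable (A Z) in
/-- The unit as an operation at stage `Z`. -/
def unit : A.Op Z := ⟨1, toUnit Z ≫ A.one⟩

end OperadData

open OperadData in
/-- The axioms of a non-symmetric operad, on elements at an arbitrary stage: composition is unital
and associative. -/
class OperadData.IsOperad (A : OperadData V) : Prop where
  unit_comp {Z : V} (f : A.Op Z) : gamma (unit A Z) [f] = f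
  comp_unit {Z : V} (f : A.Op Z) : gamma f (List.replicate f.1 (unit A Z)) = f
  assoc {Z : V} (f : A.Op Z) (gs hs : List (A.Op Z)) (_ : f.1 = gs.length)
    (_ : arity gs = hs.length) : gamma (gamma f gs) hs = gamma f (blocks gs hs)

/-- A morphism of operads: maps that respect the unit and the compositions. -/
structure OperadHom (A B : OperadData V) where
  /-- The map of objects of `n`-ary operations. -/
  map (n : ℕ) : A.obj n ⟶ B.obj n
  map_one : A.one ≫ map 1 = B.one
  map_comp (ks : List ℕ) :
    A.comp ks ≫ map ks.sum = (map ks.length ⊗ₘ listMap map ks) ≫ B.comp ks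

namespace OperadData

variable {A : OperadData V} {Z Z' : V}

@[simp] lemma arity_nil : arity ([] : List (A.Op Z)) = 0 := rfl

@[simp] lemma arity_cons (x : A.Op Z) (l : List (A.Op Z)) : arity (x :: l) = x.1 + arity l := rfl

@[simp] lemma arity_append (l l' : List (A.Op Z)) : arity (l ++ l') = arity l + arity l' := by
  simp [arity]

@[simp] lemma arity_pull (h : Z' ⟶ Z) (l : List (A.Op Z)) :
    arity (l.map (pull h)) = arity l := congrArg List.sum (map_fst_pull h l)

@[simp] lemma arity_listElts (L : List ℕ) (p : Z ⟶ listProd A.obj L) :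
    arity (listElts L p) = L.sum := by simp [arity]

@[simp] lemma length_listElts (L : List ℕ) (p : Z ⟶ listProd A.obj L) :
    (listElts L p).length = L.length := by
  rw [← List.length_map (f := Sigma.fst), map_fst_listElts]

lemma arity_replicate (n : ℕ) : arity (List.replicate n (unit A Z)) = n := by
  simp [arity, unit]

lemma gamma_fst {f : A.Op Z} {gs : List (A.Op Z)} (h : f.1 = gs.length) :
    (gamma f gs).1 = arity gs := by simp [gamma, h]

lemma comp_congr {ks ks' : List ℕ} (e : ks = ks') {x : Z ⟶ A.obj ks.length}
    {x' : Z ⟶ A.obj ks'.length} {p : Z ⟶ listProd A.obj ks} {p' : Z ⟶ listProd A.obj ks'}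
    (hx : x ≫ eqToHom (by rw [e]) = x') (hp : p ≫ eqToHom (by rw [e]) = p') :
    (⟨_, lift x p ≫ A.comp ks⟩ : A.Op Z) = ⟨_, lift x' p' ≫ A.comp ks'⟩ := by
  subst e; simp at hx hp; rw [hx, hp]

lemma pull_gamma (h : Z' ⟶ Z) (f : A.Op Z) (gs : List (A.Op Z)) :
    pull h (gamma f gs) = gamma (pull h f) (gs.map (pull h)) := by
  by_cases e : f.1 = gs.length
  · rw [gamma, gamma, dif_pos e, dif_pos (by simpa using e)]
    simp only [pull, CartesianMonoidalCategory.comp_lift_assoc]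
    refine comp_congr (A := A) (map_fst_pull h gs).symm ?_ ?_
    · simp
    · rw [comp_listMk]; simp
  · rw [gamma, gamma, dif_neg e, dif_neg (by simpa using e)]

lemma pull_blocks (h : Z' ⟶ Z) (bs as : List (A.Op Z)) :
    (blocks bs as).map (pull h) = blocks (bs.map (pull h)) (as.map (pull h)) := by
  induction bs generalizing as with
  | nil => rfl
  | cons b bs ih => simp [blocks, ih, pull_gamma, List.map_take, List.map_drop]

@[simp] lemma length_blocks (bs as : List (A.Op Z)) : (blocks bs as).length = bs.length := by
  induction bs generalizing as with
  | nil => rfl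
  | cons b bs ih => simp [blocks, ih]

lemma arity_blocks (bs as : List (A.Op Z)) (h : arity bs = as.length) :
    arity (blocks bs as) = arity as := by
  induction bs generalizing as with
  | nil =>
    have : as = [] := List.eq_nil_of_length_eq_zero (by simpa using h.symm)
    simp [this, blocks]
  | cons b bs ih =>
    rw [arity_cons] at h
    rw [blocks, arity_cons, gamma_fst (by simp; omega), ih _ (by simp; omega), ← arity_append,
      List.take_append_drop]

lemma blocks_append (bs bs' as as' : List (A.Op Z)) (h : arity bs = as.length) :
    blocks (bs ++ bs') (as ++ as') = blocks bs as ++ blocks bs' as' := by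
  induction bs generalizing as with
  | nil =>
    have : as = [] := List.eq_nil_of_length_eq_zero (by simpa using h.symm)
    simp [this, blocks]
  | cons b bs ih =>
    rw [arity_cons] at h
    rw [List.cons_append, blocks, blocks, List.cons_append,
      List.take_append_of_le_length (by omega), List.drop_append_of_le_length (by omega),
      ih _ (by simp; omega)]

variable [A.IsOperad]

lemma blocks_assoc (cs bs as : List (A.Op Z)) (h : arity cs = bs.length)
    (h' : arity bs = as.length) :
    blocks (blocks cs bs) as = blocks cs (blocks bs as) := by
  induction cs generalizing bs as with
  | nil => rfl
  | cons c cs ih =>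
    rw [arity_cons] at h
    obtain ⟨b₁, b₂, rfl, hb⟩ : ∃ b₁ b₂, bs = b₁ ++ b₂ ∧ b₁.length = c.1 :=
      ⟨bs.take c.1, bs.drop c.1, by simp, by simp; omega⟩
    rw [arity_append] at h'
    obtain ⟨a₁, a₂, rfl, ha⟩ : ∃ a₁ a₂, as = a₁ ++ a₂ ∧ a₁.length = arity b₁ :=
      ⟨as.take (arity b₁), as.drop (arity b₁), by simp, by simp; omega⟩
    rw [List.length_append] at h h'
    rw [blocks, ← hb, List.take_left, List.drop_left, blocks, gamma_fst hb.symm, ← ha,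
      List.take_left, List.drop_left, ih _ _ (by omega) (by omega),
      IsOperad.assoc _ _ _ hb.symm ha.symm, blocks_append _ _ _ _ ha.symm, blocks, ← hb,
      ← length_blocks b₁ a₁, List.take_left, List.drop_left]

lemma blocks_unit (bs : List (A.Op Z)) :
    blocks bs (List.replicate (arity bs) (unit A Z)) = bs := by
  induction bs with
  | nil => rfl
  | cons b bs ih => simp [blocks, List.take_replicate, List.drop_replicate, ih, IsOperad.comp_unit]

lemma unit_blocks (as : List (A.Op Z)) :
    blocks (List.replicate as.length (unit A Z)) as = as := by
  induction as with
  | nil => rfl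
  | cons a as ih =>
    rw [List.length_cons, List.replicate_succ, blocks]
    have : (unit A Z).1 = 1 := rfl
    rw [this]
    simp [ih, IsOperad.unit_comp]

end OperadData

end Operads

section Generators

variable {V : Type v} [Category.{u} V] [CartesianMonoidalCategory V] [MonoidalClosed V]

/-- A class of generalized elements of `X`, stable under restriction, generates `X` if maps out of
`X × W` are determined by their values on it. -/
structure Gen (X : V) (S : ∀ ⦃Z : V⦄, (Z ⟶ X) → Prop) : Prop where
  stable {Z Z' : V} (h : Z' ⟶ Z) (x : Z ⟶ X) : S x → S (h ≫ x)
  ext' {W T : V} (f g : X ⊗ W ⟶ T) :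
    (∀ (Z : V) (x : Z ⟶ X), S x → ∀ w : Z ⟶ W, lift x w ≫ f = lift x w ≫ g) → f = g

lemma Gen.ext {X T : V} {S : ∀ ⦃Z : V⦄, (Z ⟶ X) → Prop} (hX : Gen X S) {f g : X ⟶ T}
    (h : ∀ (Z : V) (x : Z ⟶ X), S x → x ≫ f = x ≫ g) : f = g := by
  have : fst X (𝟙_ V) ≫ f = fst X (𝟙_ V) ≫ g :=
    hX.ext' _ _ fun Z x hx w => by simpa using h Z x hx
  simpa using congrArg (fun t => lift (𝟙 X) (toUnit X) ≫ t) this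

lemma Gen.top (X : V) : Gen X (fun _ _ => True) where
  stable _ _ _ := trivial
  ext' f g h := by simpa using h _ (fst _ _) trivial (snd _ _)

lemma Gen.prod {X Y : V} {S : ∀ ⦃Z : V⦄, (Z ⟶ X) → Prop} {S' : ∀ ⦃Z : V⦄, (Z ⟶ Y) → Prop}
    (hX : Gen X S) (hY : Gen Y S') :
    Gen (X ⊗ Y) (fun _ z => S (z ≫ fst _ _) ∧ S' (z ≫ snd _ _)) where
  stable h x hx := by
    simpa only [Category.assoc] using And.intro (hX.stable h _ hx.1) (hY.stable h _ hx.2)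
  ext' {W T} f g h := by
    have key : (α_ X Y W).inv ≫ f = (α_ X Y W).inv ≫ g := by
      refine hX.ext' _ _ fun Z x hx w => ?_
      have : lift (lift (snd Y (W ⊗ Z) ≫ snd _ _ ≫ x) (fst _ _)) (snd _ _ ≫ fst _ _) ≫ f =
          lift (lift (snd Y (W ⊗ Z) ≫ snd _ _ ≫ x) (fst _ _)) (snd _ _ ≫ fst _ _) ≫ g := by
        refine hY.ext' _ _ fun Z' y hy w' => ?_
        have := h Z' (lift ((w' ≫ snd _ _) ≫ x) y) ⟨by simpa using hX.stable (w' ≫ snd _ _) x hx,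
          by simpa using hy⟩ (w' ≫ fst _ _)
        simpa [comp_lift_assoc] using this
      have := congrArg (fun t => lift (w ≫ fst _ _) (lift (w ≫ snd _ _) (𝟙 Z)) ≫ t) this
      have e : lift x w ≫ (α_ X Y W).inv = lift (lift x (w ≫ fst _ _)) (w ≫ snd _ _) := by
        conv_lhs => rw [← lift_comp_fst_snd w]
        exact lift_lift_associator_inv _ _ _
      rw [reassoc_of% e, reassoc_of% e]
      simpa [comp_lift_assoc] using this
    simpa using congrArg (fun t => (α_ X Y W).hom ≫ t) key

lemma Gen.sigma {ι : Type} (X : ι → V) [HasCoproduct X] :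
    Gen (∐ X) (fun Z x => ∃ (b : ι) (y : Z ⟶ X b), x = y ≫ Sigma.ι X b) where
  stable h x := by rintro ⟨b, y, rfl⟩; exact ⟨b, h ≫ y, by simp⟩
  ext' {W T} f g h := by
    refine sigma_ext X fun b => ?_
    have e : Sigma.ι X b ▷ W = lift (fst _ _ ≫ Sigma.ι X b) (snd _ _) := by ext <;> simp
    rw [e]
    exact h _ _ ⟨b, _, rfl⟩ _

lemma Gen.mc {J : MultispanShape.{0, 0}} (I : MultispanIndex J V) [HasMulticoequalizer I] :
    Gen (multicoequalizer I)
      (fun Z x => ∃ (b : J.R) (y : Z ⟶ I.right b), x = y ≫ Multicoequalizer.π I b) where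
  stable h x := by rintro ⟨b, y, rfl⟩; exact ⟨b, h ≫ y, by simp⟩
  ext' {W T} f g h := by
    refine mc_ext I fun b => ?_
    have e : Multicoequalizer.π I b ▷ W = lift (fst _ _ ≫ Multicoequalizer.π I b) (snd _ _) := by
      ext <;> simp
    rw [e]
    exact h _ _ ⟨b, _, rfl⟩ _

end Generators

section DeltaPlus

variable {V : Type v} [Category.{u} V] [CartesianMonoidalCategory V] [MonoidalClosed V]
  [HasColimits V]

open OperadData

/-! ### The category of operators of an operad -/

/-- Monotone maps `φ : [m] → [n]` between finite ordered sets with `m` and `n` elements, each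
encoded by the list of the cardinalities of its `n` fibres, whose sum is `m`. -/
abbrev MonoMap (m n : ℕ) := {ks : List ℕ // ks.sum = m ∧ ks.length = n}

variable (A : OperadData V)

/-- The object of morphisms `m ⟶ n` in the category of operators: the coproduct over all monotone
`φ : [m] → [n]` of the products of the `A(φ⁻¹t)`, for `t` in `[n]`. -/
def dHom (m n : ℕ) : V := ∐ fun φ : MonoMap m n => listProd A.obj φ.1

variable {A} {Z Z' T : V} {m n p m' n' p' : ℕ}

/-- The inclusion of the summand of a monotone map. -/
def dι (φ : MonoMap m n) : listProd A.obj φ.1 ⟶ dHom A m n :=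
  Sigma.ι (fun φ : MonoMap m n => listProd A.obj φ.1) φ

/-- The morphism given by a list of operations. -/
def dIn (l : List (A.Op Z)) (hm : arity l = m) (hn : l.length = n) : Z ⟶ dHom A m n :=
  listMk l ≫ dι ⟨l.map Sigma.fst, hm, by simpa using hn⟩

lemma listMk_dι (l : List (A.Op Z)) {ks : List ℕ} (hks : ks.sum = m ∧ ks.length = n)
    (e : l.map Sigma.fst = ks) :
    listMk l ≫ eqToHom (by rw [e]) ≫ dι ⟨ks, hks⟩ =
      dIn l (by rw [arity, e, hks.1]) (by rw [← hks.2, ← e, List.length_map]) := by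
  subst e
  simp [dIn]

lemma dIn_listElts (φ : MonoMap m n) (p : Z ⟶ listProd A.obj φ.1) :
    dIn (listElts φ.1 p) (by simpa using φ.2.1) (by simpa using φ.2.2) = p ≫ dι φ := by
  rw [← listMk_dι _ φ.2 (map_fst_listElts _ _), listMk_listElts]
  simp

lemma comp_dIn (h : Z' ⟶ Z) (l : List (A.Op Z)) (hm : arity l = m) (hn : l.length = n) :
    h ≫ dIn l hm hn = dIn (l.map (pull h)) (by simpa using hm) (by simpa using hn) := by
  rw [← listMk_dι (l.map (pull h)) ⟨hm, by simpa using hn⟩ (map_fst_pull h l), dIn,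
    ← Category.assoc, comp_listMk, Category.assoc]

lemma dIn_congr {l l' : List (A.Op Z)} (e : l = l') (hm : arity l = m) (hn : l.length = n) :
    dIn l hm hn = dIn l' (by rw [← e, hm]) (by rw [← e, hn]) := by subst e; rfl

variable (A m n) in
lemma dHom_gen : Gen (dHom A m n)
    (fun Z x => ∃ (l : List (A.Op Z)) (hm : arity l = m) (hn : l.length = n), x = dIn l hm hn) where
  stable h x := by rintro ⟨l, hm, hn, rfl⟩; exact ⟨_, _, _, comp_dIn h l hm hn⟩
  ext' f g h := (Gen.sigma _).ext' _ _ fun Z x hx w => by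
    obtain ⟨φ, y, rfl⟩ := hx
    exact h Z _ ⟨_, _, _, (dIn_listElts φ y).symm⟩ w

/-- Maps out of a product with a morphism object. -/
def dDesc {W : V} (k : ∀ φ : MonoMap m n, listProd A.obj φ.1 ⊗ W ⟶ T) : dHom A m n ⊗ W ⟶ T :=
  sigmaDesc _ k

lemma lift_dι_dDesc {W : V} (k : ∀ φ : MonoMap m n, listProd A.obj φ.1 ⊗ W ⟶ T)
    (φ : MonoMap m n) (p : Z ⟶ listProd A.obj φ.1) (w : Z ⟶ W) :
    lift (p ≫ dι φ) w ≫ dDesc k = lift p w ≫ k φ := lift_ι_sigmaDesc _ k φ p w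

/-- Define a map out of a product of two morphism objects by its values on lists of operations. -/
def dDesc₂ (k : ∀ {Z : V} (a b : List (A.Op Z)), arity a = m → a.length = n → arity b = m' →
    b.length = n' → (Z ⟶ T)) : dHom A m n ⊗ dHom A m' n' ⟶ T :=
  dDesc fun φ => swap _ _ ≫ dDesc fun ψ =>
    k (listElts φ.1 (snd _ _)) (listElts ψ.1 (fst _ _)) (by simpa using φ.2.1)
      (by simpa using φ.2.2) (by simpa using ψ.2.1) (by simpa using ψ.2.2)

lemma lift_dIn_dDesc₂ {k : ∀ {Z : V} (a b : List (A.Op Z)), arity a = m → a.length = n →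
      arity b = m' → b.length = n' → (Z ⟶ T)}
    (hk : ∀ {Z Z' : V} (h : Z' ⟶ Z) (a b : List (A.Op Z)) (h₁ : arity a = m) (h₂ : a.length = n)
      (h₃ : arity b = m') (h₄ : b.length = n'), h ≫ k a b h₁ h₂ h₃ h₄ =
        k (a.map (pull h)) (b.map (pull h)) (by simpa using h₁) (by simpa using h₂)
          (by simpa using h₃) (by simpa using h₄))
    (a b : List (A.Op Z)) (h₁ : arity a = m) (h₂ : a.length = n)
    (h₃ : arity b = m') (h₄ : b.length = n') :
    lift (dIn a h₁ h₂) (dIn b h₃ h₄) ≫ dDesc₂ k = k a b h₁ h₂ h₃ h₄ := by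
  have e : lift (listMk a) (dIn b h₃ h₄) ≫ swap _ _ = lift (dIn b h₃ h₄) (listMk a) := by
    ext <;> simp [swap]
  refine (lift_dι_dDesc _ ⟨a.map Sigma.fst, h₁, by simpa using h₂⟩ (listMk a) _).trans ?_
  rw [reassoc_of% e]
  refine (lift_dι_dDesc _ ⟨b.map Sigma.fst, h₃, by simpa using h₄⟩ (listMk b) _).trans ?_
  rw [hk]
  congr 1 <;> simp [pull_listElts]

/-- Composition in the category of operators. -/
def dComp (m n p : ℕ) : dHom A m n ⊗ dHom A n p ⟶ dHom A m p :=
  dDesc₂ fun a b h₁ h₂ h₃ h₄ =>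
    dIn (blocks b a) ((arity_blocks b a (h₃.trans h₂.symm)).trans h₁) (by simpa using h₄)

lemma lift_dIn_dComp (a b : List (A.Op Z)) (h₁ : arity a = m) (h₂ : a.length = n)
    (h₃ : arity b = n) (h₄ : b.length = p) :
    lift (dIn a h₁ h₂) (dIn b h₃ h₄) ≫ dComp m n p = dIn (blocks b a)
      ((arity_blocks b a (h₃.trans h₂.symm)).trans h₁) (by simpa using h₄) :=
  lift_dIn_dDesc₂ (fun h a b h₁ h₂ h₃ h₄ => by
    rw [comp_dIn]; exact dIn_congr (pull_blocks h b a) _ _) a b h₁ h₂ h₃ h₄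

/-- The ordinal sum of morphisms in the category of operators. -/
def dSum (m n m' n' : ℕ) : dHom A m n ⊗ dHom A m' n' ⟶ dHom A (m + m') (n + n') :=
  dDesc₂ fun a b h₁ h₂ h₃ h₄ =>
    dIn (a ++ b) (by rw [arity_append, h₁, h₃]) (by rw [List.length_append, h₂, h₄])

lemma lift_dIn_dSum (a b : List (A.Op Z)) (h₁ : arity a = m) (h₂ : a.length = n)
    (h₃ : arity b = m') (h₄ : b.length = n') :
    lift (dIn a h₁ h₂) (dIn b h₃ h₄) ≫ dSum m n m' n' =
      dIn (a ++ b) (by rw [arity_append, h₁, h₃]) (by rw [List.length_append, h₂, h₄]) :=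
  lift_dIn_dDesc₂ (fun h a b h₁ h₂ h₃ h₄ => by
    rw [comp_dIn]; exact dIn_congr (by simp) _ _) a b h₁ h₂ h₃ h₄

lemma lift_dIn_dSum_assoc (a b : List (A.Op Z)) (h₁ : arity a = m) (h₂ : a.length = n)
    (h₃ : arity b = m') (h₄ : b.length = n') (t : dHom A (m + m') (n + n') ⟶ T) :
    lift (dIn a h₁ h₂) (dIn b h₃ h₄) ≫ dSum m n m' n' ≫ t =
      dIn (a ++ b) (by rw [arity_append, h₁, h₃]) (by rw [List.length_append, h₂, h₄]) ≫ t := by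
  rw [← Category.assoc, lift_dIn_dSum]

variable (A) in
/-- The identity morphisms in the category of operators. -/
def dId (n : ℕ) : 𝟙_ V ⟶ dHom A n n :=
  dIn (List.replicate n (unit A (𝟙_ V))) (arity_replicate n) (by simp)

lemma pull_unit (h : Z' ⟶ Z) : pull h (unit A Z) = unit A Z' := by simp [pull, unit]

lemma comp_dId (h : Z ⟶ 𝟙_ V) : h ≫ dId A n =
    dIn (List.replicate n (unit A Z)) (arity_replicate n) (by simp) := by
  rw [dId, comp_dIn]; exact dIn_congr (by simp [pull_unit]) _ _

variable [A.IsOperad]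

variable (A) in
lemma d_id_comp (m n : ℕ) : (λ_ (dHom A m n)).inv ≫ dId A m ▷ _ ≫ dComp m m n = 𝟙 _ :=
  (dHom_gen A m n).ext fun Z x hx => by
    obtain ⟨l, hm, hn, rfl⟩ := hx
    have e : dIn l hm hn ≫ (λ_ _).inv ≫ dId A m ▷ _ =
        lift (toUnit _ ≫ dId A m) (dIn l hm hn) := by ext <;> simp
    rw [reassoc_of% e, comp_dId, lift_dIn_dComp, Category.comp_id]
    exact dIn_congr (by subst hm; exact blocks_unit l) _ _

variable (A) in
lemma d_comp_id (m n : ℕ) : (ρ_ (dHom A m n)).inv ≫ _ ◁ dId A n ≫ dComp m n n = 𝟙 _ :=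
  (dHom_gen A m n).ext fun Z x hx => by
    obtain ⟨l, hm, hn, rfl⟩ := hx
    have e : dIn l hm hn ≫ (ρ_ _).inv ≫ _ ◁ dId A n =
        lift (dIn l hm hn) (toUnit _ ≫ dId A n) := by ext <;> simp
    rw [reassoc_of% e, comp_dId, lift_dIn_dComp, Category.comp_id]
    exact dIn_congr (by subst hn; exact unit_blocks l) _ _

variable (A) in
lemma d_assoc (m n p q : ℕ) : (α_ (dHom A m n) (dHom A n p) (dHom A p q)).inv ≫
    dComp m n p ▷ _ ≫ dComp m p q = _ ◁ dComp n p q ≫ dComp m n q :=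
  ((dHom_gen A m n).prod ((dHom_gen A n p).prod (dHom_gen A p q))).ext
    fun Z x hx => by
      obtain ⟨⟨a, ha, ha', ea⟩, ⟨b, hb, hb', eb⟩, ⟨c, hc, hc', ec⟩⟩ := hx
      have ex : x = lift (dIn a ha ha') (lift (dIn b hb hb') (dIn c hc hc')) := by
        rw [← ea, ← eb, ← ec]; ext <;> simp
      have e₁ : x ≫ (α_ _ _ _).inv ≫ dComp m n p ▷ _ =
          lift (lift (dIn a ha ha') (dIn b hb hb') ≫ dComp m n p) (dIn c hc hc') := by
        rw [ex]; ext <;> simp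
      have e₂ : x ≫ _ ◁ dComp n p q =
          lift (dIn a ha ha') (lift (dIn b hb hb') (dIn c hc hc') ≫ dComp n p q) := by
        rw [ex]; ext <;> simp
      rw [reassoc_of% e₁, reassoc_of% e₂, lift_dIn_dComp,
        lift_dIn_dComp, lift_dIn_dComp, lift_dIn_dComp]
      exact dIn_congr (blocks_assoc c b a (hc.trans hb'.symm) (hb.trans ha'.symm)).symm _ _

end DeltaPlus

section Copresheaves

variable {V : Type v} [Category.{u} V] [CartesianMonoidalCategory V] [MonoidalClosed V]
  [HasColimits V]

/-! ### Functors on the category of operators -/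

/-- An enriched functor from the category of operators of `A` to `V`, with its action maps
`F(m) × Hom(m, n) ⟶ F(n)`. -/
structure Copresheaf (A : OperadData V) where
  /-- The value at the ordered set with `n` elements. -/
  obj : ℕ → V
  /-- The action of morphisms. -/
  act (m n : ℕ) : obj m ⊗ dHom A m n ⟶ obj n
  act_id (n : ℕ) : (ρ_ (obj n)).inv ≫ obj n ◁ dId A n ≫ act n n = 𝟙 _
  act_comp (m n p : ℕ) : act m n ▷ dHom A n p ≫ act n p =
    (α_ _ _ _).hom ≫ obj m ◁ dComp m n p ≫ act m p

variable {A : OperadData V} [HasLimits V]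

variable (F G : Copresheaf A)

lemma whiskerLeft_curry_uncurry {X Y Z : V} (k : X ⊗ Z ⟶ Y) : X ◁ curry k ≫ uncurry (𝟙 _) = k := by
  rw [← uncurry_natural_left, Category.comp_id, uncurry_curry]

/-- Postcomposition of maps `F(m) ⟶ G(m)` with the action on `G`. -/
def natPost (m n : ℕ) :
    (ihom (F.obj m)).obj (G.obj m) ⟶ (ihom (F.obj m ⊗ dHom A m n)).obj (G.obj n) :=
  curry (lift (lift (fst _ _ ≫ fst _ _) (snd _ _) ≫ uncurry (𝟙 _)) (fst _ _ ≫ snd _ _) ≫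
    G.act m n)

/-- Precomposition of maps `F(n) ⟶ G(n)` with the action on `F`. -/
def natPre (m n : ℕ) :
    (ihom (F.obj n)).obj (G.obj n) ⟶ (ihom (F.obj m ⊗ dHom A m n)).obj (G.obj n) :=
  curry (F.act m n ▷ _ ≫ uncurry (𝟙 _))

/-- The object `map(F, G) = ∫ₙ map(F(n), G(n))` of natural transformations. -/
def natObj : V :=
  equalizer
    (Pi.lift fun a : ℕ × ℕ =>
      Pi.π (fun n => (ihom (F.obj n)).obj (G.obj n)) a.1 ≫ natPost F G a.1 a.2)
    (Pi.lift fun a : ℕ × ℕ =>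
      Pi.π (fun n => (ihom (F.obj n)).obj (G.obj n)) a.2 ≫ natPre F G a.1 a.2)

/-- The projection `map(F, G) ⟶ map(F(n), G(n))`. -/
def natπ (n : ℕ) : natObj F G ⟶ (ihom (F.obj n)).obj (G.obj n) :=
  equalizer.ι _ _ ≫ Pi.π _ n

lemma natπ_condition (m n : ℕ) : natπ F G m ≫ natPost F G m n = natπ F G n ≫ natPre F G m n := by
  have h := congrArg (fun t => t ≫ Pi.π _ (m, n)) (equalizer.condition
    (Pi.lift fun a : ℕ × ℕ =>
      Pi.π (fun n => (ihom (F.obj n)).obj (G.obj n)) a.1 ≫ natPost F G a.1 a.2)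
    (Pi.lift fun a : ℕ × ℕ =>
      Pi.π (fun n => (ihom (F.obj n)).obj (G.obj n)) a.2 ≫ natPre F G a.1 a.2))
  simp only [Category.assoc, Pi.lift_π] at h
  exact (Category.assoc _ _ _).trans (h.trans (Category.assoc _ _ _).symm)

variable {F G} {Z : V}

variable (F G) in
/-- Naturality for families of maps `F(n) ⟶ G(n)` with parameters in `Z`. -/
def IsNatural (k : ∀ n, F.obj n ⊗ Z ⟶ G.obj n) : Prop :=
  ∀ m n, lift (lift (fst _ _ ≫ fst _ _) (snd _ _) ≫ k m) (fst _ _ ≫ snd _ _) ≫ G.act m n =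
    F.act m n ▷ Z ≫ k n

lemma comp_natPost (m n : ℕ) (k : F.obj m ⊗ Z ⟶ G.obj m) : curry k ≫ natPost F G m n =
    curry (lift (lift (fst _ _ ≫ fst _ _) (snd _ _) ≫ k) (fst _ _ ≫ snd _ _) ≫ G.act m n) := by
  rw [natPost, ← curry_natural_left, comp_lift_assoc, comp_lift_assoc]
  congr 3
  · conv_rhs => rw [← whiskerLeft_curry_uncurry k, ← Category.assoc]
    rw [← Category.assoc]
    congr 1
    ext <;> simp
  · simp

lemma comp_natPre (m n : ℕ) (k : F.obj n ⊗ Z ⟶ G.obj n) : curry k ≫ natPre F G m n =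
    curry (F.act m n ▷ Z ≫ k) := by
  rw [natPre, ← curry_natural_left, whisker_exchange_assoc, ← uncurry_natural_left,
    Category.comp_id, uncurry_curry]

variable (F G) in
/-- The evaluation of natural transformations. -/
def natEv (n : ℕ) : F.obj n ⊗ natObj F G ⟶ G.obj n := uncurry (natπ F G n)

variable (F G) in
lemma natEv_isNatural : IsNatural F G (natEv F G) := fun m n => curry_injective <| by
  rw [← comp_natPost, ← comp_natPre, natEv, natEv, curry_uncurry, curry_uncurry, natπ_condition]

/-- A natural family with parameters in `Z` is a map from `Z` to the object of natural
transformations. -/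
def natLift (k : ∀ n, F.obj n ⊗ Z ⟶ G.obj n) (hk : IsNatural F G k) : Z ⟶ natObj F G :=
  equalizer.lift (Pi.lift fun n => curry (k n)) (by
    refine Pi.hom_ext _ _ fun a => ?_
    simp only [Category.assoc, Pi.lift_π, Pi.lift_π_assoc]
    rw [comp_natPost, comp_natPre, hk])

lemma natLift_natEv (k : ∀ n, F.obj n ⊗ Z ⟶ G.obj n) (hk : IsNatural F G k) (n : ℕ) :
    F.obj n ◁ natLift k hk ≫ natEv F G n = k n := by
  have : natLift k hk ≫ natπ F G n = curry (k n) :=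
    (equalizer.lift_ι_assoc _ _ _).trans (Pi.lift_π _ _)
  rw [natEv, ← uncurry_natural_left, this, uncurry_curry]

end Copresheaves

section Bar

variable {V : Type v} [Category.{u} V] [CartesianMonoidalCategory V] [MonoidalClosed V]
  [HasColimits V] (A : OperadData V)

/-! ### The bar construction -/

/-- The bar construction on the full subcategory of the nonempty ordered sets: its value at `T` in
degree `p` is the coproduct over all nonempty `c₀, …, c_p` of the products
`D(c_p, c_{p-1}) × ⋯ × D(c₁, c₀) × D(c₀, T)`. This is `bar (p + 1) T`; moreover `bar 0 T` is a
point. -/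
def bar : ℕ → ℕ → V
  | 0, _ => 𝟙_ V
  | p + 1, T => ∐ fun c : ℕ => bar p (c + 1) ⊗ dHom A (c + 1) T

/-- The inclusion of a summand of the bar construction. -/
def barι (p c T : ℕ) : bar A p (c + 1) ⊗ dHom A (c + 1) T ⟶ bar A (p + 1) T :=
  Sigma.ι (fun c : ℕ => bar A p (c + 1) ⊗ dHom A (c + 1) T) c

variable {A} in
/-- Maps out of the bar construction. -/
def barDesc {p T : ℕ} {X : V} (k : ∀ c, bar A p (c + 1) ⊗ dHom A (c + 1) T ⟶ X) :
    bar A (p + 1) T ⟶ X := Sigma.desc k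

variable {A} in
@[simp] lemma barι_barDesc {p T : ℕ} {X : V}
    (k : ∀ c, bar A p (c + 1) ⊗ dHom A (c + 1) T ⟶ X) (c : ℕ) :
    barι A p c T ≫ barDesc k = k c := Sigma.ι_desc _ _

variable {A} in
lemma bar_gen (p T : ℕ) : Gen (bar A (p + 1) T) (fun Z x =>
    ∃ (c : ℕ) (y : Z ⟶ bar A p (c + 1) ⊗ dHom A (c + 1) T), x = y ≫ barι A p c T) :=
  Gen.sigma _

/-- The action of the category of operators on the bar construction. -/
def barAct (p m n : ℕ) : bar A (p + 1) m ⊗ dHom A m n ⟶ bar A (p + 1) n :=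
  sigmaDesc _ fun c => (α_ _ _ _).hom ≫ _ ◁ dComp (c + 1) m n ≫ barι A p c n

@[simp] lemma barι_barAct (p c m n : ℕ) :
    barι A p c m ▷ dHom A m n ≫ barAct A p m n =
      (α_ _ _ _).hom ≫ _ ◁ dComp (c + 1) m n ≫ barι A p c n := ι_sigmaDesc _ _ _

/-- The faces of the bar construction: the face with number `0` composes the last two morphisms;
the last face omits the first morphism. -/
def barFace : (p : ℕ) → Fin (p + 1) → (T : ℕ) → (bar A (p + 1) T ⟶ bar A p T)
  | 0, _, _ => toUnit _
  | p + 1, i, T => Fin.cases (barDesc fun c => barAct A p (c + 1) T)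
      (fun i => barDesc fun c => barFace p i (c + 1) ▷ _ ≫ barι A p c T) i

/-- The degeneracies of the bar construction: the degeneracy with number `i` inserts the identity
of `cᵢ`. -/
def barDegen : (p : ℕ) → Fin (p + 1) → (T : ℕ) → (bar A (p + 1) T ⟶ bar A (p + 2) T)
  | 0, _, T => barDesc fun c => ((ρ_ _).inv ≫ _ ◁ dId A (c + 1) ≫ barι A 0 c (c + 1)) ▷ _ ≫
      barι A 1 c T
  | p + 1, i, T => Fin.cases
      (barDesc fun c => ((ρ_ _).inv ≫ _ ◁ dId A (c + 1) ≫ barι A (p + 1) c (c + 1)) ▷ _ ≫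
        barι A (p + 2) c T)
      (fun i => barDesc fun c => barDegen p i (c + 1) ▷ _ ≫ barι A (p + 2) c T) i

end Bar

section Realization

variable {V : Type v} [Category.{u} V] [CartesianMonoidalCategory V] [MonoidalClosed V]
  [HasColimits V] (A : OperadData V) (Δ : SimplexCategory ⥤ V)

/-- The relations in the geometric realization of the bar construction: one for each face and one
for each degeneracy. -/
inductive BarRel : Type
  | face (p : ℕ) (i : Fin (p + 2)) : BarRel
  | degen (p : ℕ) (i : Fin (p + 1)) : BarRel

/-- The product of the bar construction in degree `p` with the standard simplex of dimension
`q`. -/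
abbrev barSimplex (p q T : ℕ) : V := bar A (p + 1) T ⊗ Δ.obj (SimplexCategory.mk q)

/-- The presentation of the geometric realization of the bar construction: `(dᵢ x, t) ∼ (x, δᵢ t)`
and `(sᵢ x, t) ∼ (x, σᵢ t)`. -/
def barIndex (T : ℕ) : MultispanIndex ⟨BarRel, ℕ,
    fun | .face p _ => p | .degen p _ => p + 1, fun | .face p _ => p + 1 | .degen p _ => p⟩ V where
  right p := barSimplex A Δ p p T
  left
    | .face p _ => barSimplex A Δ (p + 1) p T
    | .degen p _ => barSimplex A Δ p (p + 1) T
  fst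
    | .face p i => barFace A (p + 1) i T ▷ _
    | .degen p i => barDegen A p i T ▷ _
  snd
    | .face _ i => _ ◁ Δ.map (SimplexCategory.δ i)
    | .degen _ i => _ ◁ Δ.map (SimplexCategory.σ i)

/-- The geometric realization of the bar construction, with values on all ordered sets. -/
def barReal (T : ℕ) : V := multicoequalizer (barIndex A Δ T)

/-- The inclusion of the simplices of dimension `p`. -/
def barRealι (p T : ℕ) : barSimplex A Δ p p T ⟶ barReal A Δ T :=
  Multicoequalizer.π (barIndex A Δ T) p

variable {A} in
lemma barReal_gen (T : ℕ) : Gen (barReal A Δ T) (fun Z x =>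
    ∃ (p : ℕ) (y : Z ⟶ barSimplex A Δ p p T), x = y ≫ barRealι A Δ p T) :=
  Gen.mc _

lemma barFace_barRealι (p : ℕ) (i : Fin (p + 2)) (T : ℕ) :
    barFace A (p + 1) i T ▷ _ ≫ barRealι A Δ p T =
      _ ◁ Δ.map (SimplexCategory.δ i) ≫ barRealι A Δ (p + 1) T :=
  Multicoequalizer.condition (barIndex A Δ T) (.face p i)

lemma barDegen_barRealι (p : ℕ) (i : Fin (p + 1)) (T : ℕ) :
    barDegen A p i T ▷ _ ≫ barRealι A Δ (p + 1) T =
      _ ◁ Δ.map (SimplexCategory.σ i) ≫ barRealι A Δ p T :=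
  Multicoequalizer.condition (barIndex A Δ T) (.degen p i)

variable [A.IsOperad]

variable {A} in
lemma lift_dComp_assoc {Z : V} {m n p q : ℕ} (f : Z ⟶ dHom A m n) (g : Z ⟶ dHom A n p)
    (h : Z ⟶ dHom A p q) : lift (lift f g ≫ dComp m n p) h ≫ dComp m p q =
      lift f (lift g h ≫ dComp n p q) ≫ dComp m n q := by
  have := congrArg (fun t => lift f (lift g h) ≫ t) (d_assoc A m n p q)
  simpa using this

variable {A} in
lemma lift_dId_dComp {Z : V} {m n : ℕ} (u : Z ⟶ 𝟙_ V) (f : Z ⟶ dHom A m n) :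
    lift (u ≫ dId A m) f ≫ dComp m m n = f := by
  have h := congrArg (fun t => f ≫ t) (d_id_comp A m n)
  have e : f ≫ (λ_ _).inv ≫ dId A m ▷ _ = lift (u ≫ dId A m) f := by
    ext <;> simp [toUnit_unique u (f ≫ toUnit _)]
  simpa [reassoc_of% e] using h

variable {A} in
lemma lift_dComp_dId {Z : V} {m n : ℕ} (u : Z ⟶ 𝟙_ V) (f : Z ⟶ dHom A m n) :
    lift f (u ≫ dId A n) ≫ dComp m n n = f := by
  have h := congrArg (fun t => f ≫ t) (d_comp_id A m n)
  have e : f ≫ (ρ_ _).inv ≫ _ ◁ dId A n = lift f (u ≫ dId A n) := by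
    ext <;> simp [toUnit_unique u (f ≫ toUnit _)]
  simpa [reassoc_of% e] using h

variable {A} in
lemma lift_barι_barAct {Z : V} {p c m n : ℕ} (y : Z ⟶ bar A p (c + 1) ⊗ dHom A (c + 1) m)
    (g : Z ⟶ dHom A m n) : lift (y ≫ barι A p c m) g ≫ barAct A p m n =
      lift (y ≫ fst _ _) (lift (y ≫ snd _ _) g ≫ dComp (c + 1) m n) ≫ barι A p c n := by
  have h := congrArg (fun t => lift y g ≫ t) (barι_barAct A p c m n)
  have e : lift y g ≫ (α_ _ _ _).hom ≫ _ ◁ dComp (c + 1) m n =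
      lift (y ≫ fst _ _) (lift (y ≫ snd _ _) g ≫ dComp (c + 1) m n) := by
    ext
    · simp
    · simp only [Category.assoc, whiskerLeft_snd, lift_snd]
      rw [← Category.assoc, ← Category.assoc]
      congr 1
      ext <;> simp
  rw [reassoc_of% e] at h
  rw [← lift_whiskerRight_assoc]
  exact h

variable {A} in
lemma lift_barι_barAct_assoc {Z : V} {p c m n : ℕ}
    (y : Z ⟶ bar A p (c + 1) ⊗ dHom A (c + 1) m) (g : Z ⟶ dHom A m n) {T : V}
    (t : bar A (p + 1) n ⟶ T) : lift (y ≫ barι A p c m) g ≫ barAct A p m n ≫ t =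
      lift (y ≫ fst _ _) (lift (y ≫ snd _ _) g ≫ dComp (c + 1) m n) ≫ barι A p c n ≫ t := by
  rw [← Category.assoc, lift_barι_barAct, Category.assoc]

lemma barAct_barAct (p m n q : ℕ) : barAct A p m n ▷ dHom A n q ≫ barAct A p n q =
    (α_ _ _ _).hom ≫ _ ◁ dComp m n q ≫ barAct A p m q := by
  refine (((bar_gen p m).prod (.top _)).prod (.top _)).ext fun Z x hx => ?_
  obtain ⟨⟨⟨c, y, hy⟩, -⟩, -⟩ := hx
  obtain ⟨f, g, rfl⟩ : ∃ f g, x = lift (lift (y ≫ barι A p c m) f) g :=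
    ⟨x ≫ fst _ _ ≫ snd _ _, x ≫ snd _ _, by ext <;> simp [← hy]⟩
  simp [lift_barι_barAct, lift_dComp_assoc, lift_lift_associator_hom_assoc]

lemma barAct_id (p n : ℕ) : (ρ_ _).inv ≫ _ ◁ dId A n ≫ barAct A p n n = 𝟙 _ := by
  refine (bar_gen p n).ext fun Z x hx => ?_
  obtain ⟨c, y, rfl⟩ := hx
  have e : (y ≫ barι A p c n) ≫ (ρ_ _).inv ≫ _ ◁ dId A n =
      lift (y ≫ barι A p c n) (toUnit _ ≫ dId A n) := by ext <;> simp
  rw [Category.assoc, reassoc_of% e, lift_barι_barAct, lift_dComp_dId]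
  simp

lemma barι_barFace_zero (p c T : ℕ) :
    barι A (p + 1) c T ≫ barFace A (p + 1) 0 T = barAct A p (c + 1) T := barι_barDesc _ _

lemma barι_barFace_succ (p c T : ℕ) (i : Fin (p + 1)) :
    barι A (p + 1) c T ≫ barFace A (p + 1) i.succ T =
      barFace A p i (c + 1) ▷ _ ≫ barι A p c T := barι_barDesc _ _

lemma barι_barDegen (p : ℕ) (i : Fin (p + 1)) (c : ℕ) : ∃ h, ∀ T,
    barι A p c T ≫ barDegen A p i T = h ▷ _ ≫ barι A (p + 1) c T := by
  cases p with
  | zero => exact ⟨_, fun T => barι_barDesc _ _⟩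
  | succ p =>
    refine Fin.cases ?_ (fun i => ?_) i
    · exact ⟨_, fun T => barι_barDesc _ _⟩
    · exact ⟨_, fun T => barι_barDesc _ _⟩

lemma barFace_barAct (p : ℕ) (i : Fin (p + 2)) (m n : ℕ) :
    barFace A (p + 1) i m ▷ _ ≫ barAct A p m n = barAct A (p + 1) m n ≫ barFace A (p + 1) i n := by
  refine ((bar_gen (p + 1) m).prod (.top _)).ext fun Z x hx => ?_
  obtain ⟨⟨c, y, hy⟩, -⟩ := hx
  obtain ⟨g, rfl⟩ : ∃ g, x = lift (y ≫ barι A (p + 1) c m) g :=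
    ⟨x ≫ snd _ _, by ext <;> simp [← hy]⟩
  obtain ⟨x, f, rfl⟩ : ∃ x f, y = lift x f := ⟨y ≫ fst _ _, y ≫ snd _ _, by simp⟩
  rw [lift_barι_barAct_assoc, lift_whiskerRight_assoc, Category.assoc]
  refine Fin.cases ?_ (fun i => ?_) i
  · rw [barι_barFace_zero, barι_barFace_zero]
    have h := congrArg (fun t => lift (lift x f) g ≫ t) (barAct_barAct A p (c + 1) m n)
    simpa using h
  · rw [barι_barFace_succ, barι_barFace_succ]
    simp [lift_barι_barAct, lift_whiskerRight_assoc, ← Category.assoc (lift x f)]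

lemma barDegen_barAct (p : ℕ) (i : Fin (p + 1)) (m n : ℕ) :
    barDegen A p i m ▷ _ ≫ barAct A (p + 1) m n = barAct A p m n ≫ barDegen A p i n := by
  refine ((bar_gen p m).prod (.top _)).ext fun Z x hx => ?_
  obtain ⟨⟨c, y, hy⟩, -⟩ := hx
  obtain ⟨g, rfl⟩ : ∃ g, x = lift (y ≫ barι A p c m) g :=
    ⟨x ≫ snd _ _, by ext <;> simp [← hy]⟩
  obtain ⟨x, f, rfl⟩ : ∃ x f, y = lift x f := ⟨y ≫ fst _ _, y ≫ snd _ _, by simp⟩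
  rw [lift_barι_barAct_assoc, lift_whiskerRight_assoc, Category.assoc]
  obtain ⟨h, hh⟩ := barι_barDegen A p i c
  rw [hh, hh]
  simp [lift_barι_barAct, lift_whiskerRight_assoc, ← Category.assoc (lift x f)]

/-- Let `D` act on the first factor of `X × S`. -/
def actFst {X Y D : V} (a : X ⊗ D ⟶ Y) (S : V) : (X ⊗ S) ⊗ D ⟶ Y ⊗ S :=
  lift (lift (fst _ _ ≫ fst _ _) (snd _ _) ≫ a) (fst _ _ ≫ snd _ _)

lemma lift_actFst {Z X Y D S : V} (a : X ⊗ D ⟶ Y) (y : Z ⟶ X ⊗ S) (d : Z ⟶ D) :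
    lift y d ≫ actFst a S = lift (lift (y ≫ fst _ _) d ≫ a) (y ≫ snd _ _) := by
  ext <;> simp [actFst, comp_lift_assoc]

lemma lift_actFst_assoc {Z X Y D S : V} (a : X ⊗ D ⟶ Y) (y : Z ⟶ X ⊗ S) (d : Z ⟶ D) {T : V}
    (t : Y ⊗ S ⟶ T) : lift y d ≫ actFst a S ≫ t =
      lift (lift (y ≫ fst _ _) d ≫ a) (y ≫ snd _ _) ≫ t := by
  rw [← Category.assoc, lift_actFst]

lemma actFst_whiskerRight {X X' Y Y' D S : V} (a : X ⊗ D ⟶ Y) (a' : X' ⊗ D ⟶ Y')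
    (f : X ⟶ X') (g : Y ⟶ Y') (h : f ▷ D ≫ a' = a ≫ g) :
    (f ▷ S) ▷ D ≫ actFst a' S = actFst a S ≫ g ▷ S := by
  have h' : lift (fst (X ⊗ S) D ≫ fst X S) (snd _ _) ≫ f ▷ D ≫ a' =
    lift (fst (X ⊗ S) D ≫ fst X S) (snd _ _) ≫ a ≫ g := by rw [h]
  ext
  · simpa [actFst, comp_lift_assoc] using h'
  · simp [actFst]

lemma actFst_whiskerRight_assoc {X X' Y Y' D S : V} (a : X ⊗ D ⟶ Y) (a' : X' ⊗ D ⟶ Y')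
    (f : X ⟶ X') (g : Y ⟶ Y') (h : f ▷ D ≫ a' = a ≫ g) {T : V} (t : Y' ⊗ S ⟶ T) :
    (f ▷ S) ▷ D ≫ actFst a' S ≫ t = actFst a S ≫ g ▷ S ≫ t := by
  rw [← Category.assoc, actFst_whiskerRight a a' f g h, Category.assoc]

lemma actFst_whiskerLeft {X Y D S S' : V} (a : X ⊗ D ⟶ Y) (f : S ⟶ S') :
    (X ◁ f) ▷ D ≫ actFst a S' = actFst a S ≫ Y ◁ f := by
  ext <;> simp [actFst, comp_lift_assoc]

lemma actFst_whiskerLeft_assoc {X Y D S S' : V} (a : X ⊗ D ⟶ Y) (f : S ⟶ S') {T : V}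
    (t : Y ⊗ S' ⟶ T) : (X ◁ f) ▷ D ≫ actFst a S' ≫ t = actFst a S ≫ Y ◁ f ≫ t := by
  rw [← Category.assoc, actFst_whiskerLeft, Category.assoc]

/-- The action of the category of operators on the realization of the bar construction. -/
def barRealAct (m n : ℕ) : barReal A Δ m ⊗ dHom A m n ⟶ barReal A Δ n :=
  mcDesc (barIndex A Δ m) (fun p => actFst (barAct A p m n) _ ≫ barRealι A Δ p n) (by
    rintro (⟨p, i⟩ | ⟨p, i⟩)
    · refine (actFst_whiskerRight_assoc _ _ _ _ (barFace_barAct A p i m n) _).trans ?_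
      rw [barFace_barRealι]
      exact (actFst_whiskerLeft_assoc _ _ _).symm
    · refine (actFst_whiskerRight_assoc _ _ _ _ (barDegen_barAct A p i m n) _).trans ?_
      rw [barDegen_barRealι]
      exact (actFst_whiskerLeft_assoc _ _ _).symm)

lemma lift_barRealι_barRealAct {Z : V} (p m n : ℕ) (y : Z ⟶ barSimplex A Δ p p m)
    (d : Z ⟶ dHom A m n) : lift (y ≫ barRealι A Δ p m) d ≫ barRealAct A Δ m n =
      lift (lift (y ≫ fst _ _) d ≫ barAct A p m n) (y ≫ snd _ _) ≫ barRealι A Δ p n :=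
  (lift_π_mcDesc (barIndex A Δ m) _ _ p y d).trans (lift_actFst_assoc _ _ _ _)

/-- The functor obtained from the realization of the bar construction by extending it to all ordered
sets; its value at the empty set is empty. -/
def tildeE : Copresheaf A where
  obj := barReal A Δ
  act := barRealAct A Δ
  act_id n := (barReal_gen Δ n).ext fun Z x hx => by
    obtain ⟨p, y, rfl⟩ := hx
    have e : (y ≫ barRealι A Δ p n) ≫ (ρ_ _).inv ≫ _ ◁ dId A n =
        lift (y ≫ barRealι A Δ p n) (toUnit _ ≫ dId A n) := by ext <;> simp
    have e' : lift (y ≫ fst _ _) (toUnit _ ≫ dId A n) =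
        (y ≫ fst _ _) ≫ (ρ_ _).inv ≫ _ ◁ dId A n := by ext <;> simp
    rw [Category.assoc, reassoc_of% e, lift_barRealι_barRealAct, e', Category.assoc,
      Category.assoc, Category.assoc, Category.assoc, barAct_id]
    simp
  act_comp m n q := by
    refine (((barReal_gen Δ m).prod (.top _)).prod (.top _)).ext fun Z x hx => ?_
    obtain ⟨⟨⟨p, y, hy⟩, -⟩, -⟩ := hx
    obtain ⟨f, g, rfl⟩ : ∃ f g, x = lift (lift (y ≫ barRealι A Δ p m) f) g :=
      ⟨x ≫ fst _ _ ≫ snd _ _, x ≫ snd _ _, by ext <;> simp [← hy]⟩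
    have h := congrArg (fun t => lift (lift (y ≫ fst _ _) f) g ≫ t) (barAct_barAct A p m n q)
    simp [lift_lift_associator_hom_assoc] at h
    simp [lift_barRealι_barRealAct, h, lift_lift_associator_hom_assoc]

end Realization

section Sums

variable {V : Type v} [Category.{u} V] [CartesianMonoidalCategory V] [MonoidalClosed V]
  [HasColimits V] {A : OperadData V} {Z Z' : V}

open OperadData

/-! ### Ordinal sums of morphisms -/

variable (A) in
/-- Transport of morphism objects along equalities. -/
def dCast {m m' n n' : ℕ} (hm : m = m') (hn : n = n') : dHom A m n ⟶ dHom A m' n' :=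
  eqToHom (by rw [hm, hn])

lemma dIn_dCast {m m' n n' : ℕ} (hm : m = m') (hn : n = n') (l : List (A.Op Z))
    (h : arity l = m) (h' : l.length = n) :
    dIn l h h' ≫ dCast A hm hn = dIn l (h.trans hm) (h'.trans hn) := by
  subst hm hn; simp [dCast]

@[simp] lemma dCast_rfl {m n : ℕ} (hm : m = m) (hn : n = n) : dCast A hm hn = 𝟙 _ := rfl

@[simp] lemma dCast_dCast {m m' m'' n n' n'' : ℕ} (hm : m = m') (hn : n = n')
    (hm' : m' = m'') (hn' : n' = n'') :
    dCast A hm hn ≫ dCast A hm' hn' = dCast A (hm.trans hm') (hn.trans hn') := by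
  subst hm hn hm' hn'; simp

lemma dGen₂ {m n m' n' : ℕ} {T : V} {f g : dHom A m n ⊗ dHom A m' n' ⟶ T}
    (h : ∀ (Z : V) (a b : List (A.Op Z)) (h₁ : arity a = m) (h₂ : a.length = n) (h₃ : arity b = m')
      (h₄ : b.length = n'), lift (dIn a h₁ h₂) (dIn b h₃ h₄) ≫ f =
        lift (dIn a h₁ h₂) (dIn b h₃ h₄) ≫ g) : f = g :=
  ((dHom_gen A m n).prod (dHom_gen A m' n')).ext fun Z x hx => by
    obtain ⟨⟨a, ha, ha', ea⟩, ⟨b, hb, hb', eb⟩⟩ := hx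
    have ex : x = lift (dIn a ha ha') (dIn b hb hb') := by rw [← ea, ← eb]; ext <;> simp
    rw [ex]
    exact h _ _ _ _ _ _ _

lemma dSum_assoc {m n m' n' m'' n'' : ℕ} (a : Z ⟶ dHom A m n) (b : Z ⟶ dHom A m' n')
    (c : Z ⟶ dHom A m'' n'') :
    lift (lift a b ≫ dSum m n m' n') c ≫ dSum _ _ m'' n'' ≫
        dCast A (Nat.add_assoc _ _ _) (Nat.add_assoc _ _ _) =
      lift a (lift b c ≫ dSum m' n' m'' n'') ≫ dSum _ _ _ _ := by
  have : dSum m n m' n' ▷ _ ≫ dSum _ _ m'' n'' ≫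
        dCast A (Nat.add_assoc _ _ _) (Nat.add_assoc _ _ _) =
      (α_ _ _ _).hom ≫ _ ◁ dSum m' n' m'' n'' ≫ dSum _ _ _ _ :=
    (((dHom_gen A m n).prod (dHom_gen A m' n')).prod (dHom_gen A m'' n'')).ext fun Z x hx => by
      obtain ⟨⟨⟨a, ha, ha', ea⟩, ⟨b, hb, hb', eb⟩⟩, ⟨c, hc, hc', ec⟩⟩ := hx
      have ex : x = lift (lift (dIn a ha ha') (dIn b hb hb')) (dIn c hc hc') := by
        rw [← ea, ← eb, ← ec]; ext <;> simp
      rw [ex, lift_whiskerRight_assoc, lift_lift_associator_hom_assoc, lift_whiskerLeft_assoc,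
        lift_dIn_dSum, lift_dIn_dSum_assoc, lift_dIn_dSum, lift_dIn_dSum, dIn_dCast]
      exact dIn_congr (List.append_assoc _ _ _) _ _
  simpa [lift_lift_associator_hom_assoc] using congrArg (fun t => lift (lift a b) c ≫ t) this

lemma dSum_dComp {m n p m' n' p' : ℕ} (a : Z ⟶ dHom A m n) (b : Z ⟶ dHom A n p)
    (a' : Z ⟶ dHom A m' n') (b' : Z ⟶ dHom A n' p') :
    lift (lift a a' ≫ dSum m n m' n') (lift b b' ≫ dSum n p n' p') ≫ dComp _ _ _ =
      lift (lift a b ≫ dComp _ _ _) (lift a' b' ≫ dComp _ _ _) ≫ dSum m p m' p' := by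
  have : (dSum m n m' n' ⊗ₘ dSum n p n' p') ≫ dComp _ _ _ =
      lift ((fst _ _ ⊗ₘ fst _ _) ≫ dComp _ _ _) ((snd _ _ ⊗ₘ snd _ _) ≫ dComp _ _ _) ≫
        dSum m p m' p' :=
    (((dHom_gen A m n).prod (dHom_gen A m' n')).prod ((dHom_gen A n p).prod
      (dHom_gen A n' p'))).ext fun Z x hx => by
      obtain ⟨⟨⟨a, ha, ha', ea⟩, ⟨b, hb, hb', eb⟩⟩, ⟨⟨c, hc, hc', ec⟩, ⟨d, hd, hd', ed⟩⟩⟩ := hx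
      have ex : x = lift (lift (dIn a ha ha') (dIn b hb hb'))
          (lift (dIn c hc hc') (dIn d hd hd')) := by
        rw [← ea, ← eb, ← ec, ← ed]; ext <;> simp
      rw [ex, lift_map_assoc, lift_dIn_dSum, lift_dIn_dSum, lift_dIn_dComp, comp_lift_assoc,
        lift_map_assoc, lift_map_assoc, lift_fst, lift_fst, lift_snd, lift_snd, lift_dIn_dComp,
        lift_dIn_dComp, lift_dIn_dSum]
      exact dIn_congr (blocks_append c d a b (hc.trans ha'.symm)) _ _
  simpa [comp_lift_assoc] using congrArg (fun t => lift (lift a a') (lift b b') ≫ t) this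

lemma dSum_dId (u : Z ⟶ 𝟙_ V) (m n : ℕ) :
    lift (u ≫ dId A m) (u ≫ dId A n) ≫ dSum m m n n = u ≫ dId A (m + n) := by
  rw [comp_dId, comp_dId, comp_dId, lift_dIn_dSum]
  exact dIn_congr (by simp) _ _

end Sums

section Epsilon

variable {V : Type v} [Category.{u} V] [CartesianMonoidalCategory V] [MonoidalClosed V]
  [HasColimits V] {A : OperadData V} [A.IsOperad] (F : Copresheaf A)

/-! ### The functors `ε(n)` -/

/-- Pairs of an element of `F(m)` and a morphism `m ⟶ n`. -/
abbrev pairObj (a : ℕ × ℕ) : V := F.obj a.1 ⊗ dHom A a.1 a.2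

/-- A list of pairs `(eᵢ, fᵢ)` gives the list of the elements `eᵢ`. -/
def pairSrc : (L : List (ℕ × ℕ)) → (listProd (pairObj F) L ⟶ listProd F.obj (L.map Prod.fst))
  | [] => 𝟙 _
  | _ :: L => fst _ _ ⊗ₘ pairSrc L

/-- A list of pairs `(eᵢ, fᵢ)` gives the list of the elements `(fᵢ)_* eᵢ`. -/
def pairAct : (L : List (ℕ × ℕ)) → (listProd (pairObj F) L ⟶ listProd F.obj (L.map Prod.snd))
  | [] => 𝟙 _
  | a :: L => F.act a.1 a.2 ⊗ₘ pairAct L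

/-- A list of pairs `(eᵢ, fᵢ)` gives the ordinal sum `f₁ ⊔ ⋯ ⊔ fₙ`. -/
def pairSum : (L : List (ℕ × ℕ)) →
    (listProd (pairObj F) L ⟶ dHom A (L.map Prod.fst).sum (L.map Prod.snd).sum)
  | [] => dId A 0
  | _ :: L => (snd _ _ ⊗ₘ pairSum L) ≫ dSum _ _ _ _

/-- The presentation of the value at `T` of the left Kan extension of `F × ⋯ × F` along the ordinal
sum `(V₁, …, Vₙ) ↦ V₁ ⊔ ⋯ ⊔ Vₙ`, that is, of the coend of
`F(V₁) × ⋯ × F(Vₙ) × Hom(V₁ ⊔ ⋯ ⊔ Vₙ, T)` over all `(V₁, …, Vₙ)`. -/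
def epsIndex (n T : ℕ) : MultispanIndex ⟨{L : List (ℕ × ℕ) // L.length = n},
    {L : List ℕ // L.length = n}, fun L => ⟨L.1.map Prod.snd, by simpa using L.2⟩,
    fun L => ⟨L.1.map Prod.fst, by simpa using L.2⟩⟩ V where
  right L := listProd F.obj L.1 ⊗ dHom A L.1.sum T
  left L := listProd (pairObj F) L.1 ⊗ dHom A (L.1.map Prod.snd).sum T
  fst L := pairAct F L.1 ▷ _
  snd L := lift (fst _ _ ≫ pairSrc F L.1) (pairSum F L.1 ▷ _ ≫ dComp _ _ _)

/-- The value at `T` of the left Kan extension of `F × ⋯ × F` along the ordinal sum. -/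
def epsObj (n T : ℕ) : V := multicoequalizer (epsIndex F n T)

/-- The map sending `e₁, …, eₙ` and `θ : V₁ ⊔ ⋯ ⊔ Vₙ ⟶ T` to the class `[e₁, …, eₙ; θ]`. -/
def epsι (n T : ℕ) (L : {L : List ℕ // L.length = n}) :
    listProd F.obj L.1 ⊗ dHom A L.1.sum T ⟶ epsObj F n T :=
  Multicoequalizer.π (epsIndex F n T) L

variable {F} in
lemma eps_gen (n T : ℕ) : Gen (epsObj F n T) (fun Z x =>
    ∃ (L : {L : List ℕ // L.length = n}) (y : Z ⟶ listProd F.obj L.1 ⊗ dHom A L.1.sum T),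
      x = y ≫ epsι F n T L) := Gen.mc _

/-- Maps out of `ε(n)(T) × W`. -/
def epsDesc {n T : ℕ} {W X : V}
    (k : ∀ L : {L : List ℕ // L.length = n}, (listProd F.obj L.1 ⊗ dHom A L.1.sum T) ⊗ W ⟶ X)
    (hk : ∀ (L : {L : List (ℕ × ℕ) // L.length = n}) {Z : V} (q : Z ⟶ listProd (pairObj F) L.1)
      (θ : Z ⟶ dHom A (L.1.map Prod.snd).sum T) (w : Z ⟶ W),
      lift (lift (q ≫ pairAct F L.1) θ) w ≫ k ⟨L.1.map Prod.snd, by simpa using L.2⟩ =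
      lift (lift (q ≫ pairSrc F L.1) (lift (q ≫ pairSum F L.1) θ ≫ dComp _ _ _)) w ≫
        k ⟨L.1.map Prod.fst, by simpa using L.2⟩) : epsObj F n T ⊗ W ⟶ X :=
  mcDesc (epsIndex F n T) k (fun L => by
    have e₁ : (pairAct F L.1 ▷ dHom A (L.1.map Prod.snd).sum T) ▷ W =
        lift (lift ((fst _ _ ≫ fst _ _) ≫ pairAct F L.1) (fst _ _ ≫ snd _ _)) (snd _ W) := by
      ext : 1
      · rw [lift_fst]
        ext <;> simp
      · simp
    have e₂ : lift (fst _ _ ≫ pairSrc F L.1) (pairSum F L.1 ▷ dHom A _ T ≫ dComp _ _ _) ▷ W =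
        lift (lift ((fst _ _ ≫ fst _ _) ≫ pairSrc F L.1)
          (lift ((fst _ _ ≫ fst _ _) ≫ pairSum F L.1) (fst _ _ ≫ snd _ _) ≫ dComp _ _ _))
          (snd _ W) := by
      ext : 1
      · rw [lift_fst, whiskerRight_fst, comp_lift, Category.assoc, ← Category.assoc _ _ (dComp _ _ _)]
        congr 2
        ext <;> simp
      · simp
    exact (congrArg (fun t => t ≫ _) e₁).trans ((hk L _ _ _).trans
      (congrArg (fun t => t ≫ _) e₂).symm))

lemma lift_epsι_epsDesc {Z : V} {n T : ℕ} {W X : V}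
    (k : ∀ L : {L : List ℕ // L.length = n}, (listProd F.obj L.1 ⊗ dHom A L.1.sum T) ⊗ W ⟶ X) (hk)
    (L : {L : List ℕ // L.length = n}) (y : Z ⟶ listProd F.obj L.1 ⊗ dHom A L.1.sum T)
    (w : Z ⟶ W) : lift (y ≫ epsι F n T L) w ≫ epsDesc F k hk = lift y w ≫ k L :=
  lift_π_mcDesc (epsIndex F n T) _ _ L y w

end Epsilon

section Epsilon

variable {V : Type v} [Category.{u} V] [CartesianMonoidalCategory V] [MonoidalClosed V]
  [HasColimits V] {A : OperadData V} [A.IsOperad] (F : Copresheaf A)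

lemma epsι_rel {Z : V} {n T : ℕ} (L : {L : List (ℕ × ℕ) // L.length = n})
    (q : Z ⟶ listProd (pairObj F) L.1) (θ : Z ⟶ dHom A (L.1.map Prod.snd).sum T) :
    lift (q ≫ pairAct F L.1) θ ≫ epsι F n T ⟨L.1.map Prod.snd, by simpa using L.2⟩ =
      lift (q ≫ pairSrc F L.1) (lift (q ≫ pairSum F L.1) θ ≫ dComp _ _ _) ≫
        epsι F n T ⟨L.1.map Prod.fst, by simpa using L.2⟩ := by
  have h : lift q θ ≫ pairAct F L.1 ▷ dHom A _ T ≫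
      epsι F n T ⟨L.1.map Prod.snd, by simpa using L.2⟩ =
    lift q θ ≫ lift (fst _ _ ≫ pairSrc F L.1) (pairSum F L.1 ▷ dHom A _ T ≫ dComp _ _ _) ≫
      epsι F n T ⟨L.1.map Prod.fst, by simpa using L.2⟩ :=
    congrArg (fun t => lift q θ ≫ t) (Multicoequalizer.condition (epsIndex F n T) L)
  simpa [comp_lift_assoc] using h

/-- The action of the category of operators on `ε(n)`. -/
def epsAct (n T T' : ℕ) : epsObj F n T ⊗ dHom A T T' ⟶ epsObj F n T' :=
  epsDesc F (fun L => (α_ _ _ _).hom ≫ _ ◁ dComp _ T T' ≫ epsι F n T' L) (by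
    intro L Z q θ f
    simp [lift_lift_associator_hom_assoc, lift_dComp_assoc, epsι_rel])

lemma lift_epsι_epsAct {Z : V} {n T T' : ℕ} (L : {L : List ℕ // L.length = n})
    (y : Z ⟶ listProd F.obj L.1 ⊗ dHom A L.1.sum T) (f : Z ⟶ dHom A T T') :
    lift (y ≫ epsι F n T L) f ≫ epsAct F n T T' =
      lift (y ≫ fst _ _) (lift (y ≫ snd _ _) f ≫ dComp _ _ _) ≫ epsι F n T' L := by
  obtain ⟨p, θ, rfl⟩ : ∃ p θ, y = lift p θ := ⟨y ≫ fst _ _, y ≫ snd _ _, by simp⟩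
  rw [epsAct, lift_epsι_epsDesc]
  simp [lift_lift_associator_hom_assoc]

/-- The functor `ε(n)`: the left Kan extension of the `n`-fold external product of `F` along the
ordinal sum. -/
def eps (n : ℕ) : Copresheaf A where
  obj := epsObj F n
  act := epsAct F n
  act_id T := (eps_gen n T).ext fun Z x hx => by
    obtain ⟨L, y, rfl⟩ := hx
    have e : (y ≫ epsι F n T L) ≫ (ρ_ _).inv ≫ _ ◁ dId A T =
        lift (y ≫ epsι F n T L) (toUnit _ ≫ dId A T) := by ext <;> simp
    rw [Category.assoc, reassoc_of% e, lift_epsι_epsAct, lift_dComp_dId]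
    simp
  act_comp T T' T'' := by
    refine (((eps_gen n T).prod (.top _)).prod (.top _)).ext fun Z x hx => ?_
    obtain ⟨⟨⟨L, y, hy⟩, -⟩, -⟩ := hx
    obtain ⟨f, g, rfl⟩ : ∃ f g, x = lift (lift (y ≫ epsι F n T L) f) g :=
      ⟨x ≫ fst _ _ ≫ snd _ _, x ≫ snd _ _, by ext <;> simp [← hy]⟩
    simp [lift_epsι_epsAct, lift_dComp_assoc, lift_lift_associator_hom_assoc]

/-! ### Elements of `ε(n)` -/

variable {F} {Z Z' : V} {n n' T T' s s' m : ℕ}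

/-- The sum of the indices of a list of elements. -/
abbrev total {X : ℕ → V} (l : List (Elt Z X)) : ℕ := (l.map Sigma.fst).sum

/-- The class `[e₁, …, eₙ; θ]` for a list of elements. -/
def eMk (l : List (Elt Z F.obj)) (hl : l.length = n) (hs : total l = s) (θ : Z ⟶ dHom A s T) :
    Z ⟶ epsObj F n T :=
  lift (listMk l) (θ ≫ dCast A hs.symm rfl) ≫ epsι F n T ⟨l.map Sigma.fst, by simpa using hl⟩

lemma eMk_congr {l l' : List (Elt Z F.obj)} (e : l = l') (hl : l.length = n) (hs : total l = s)
    {θ θ' : Z ⟶ dHom A s T} (e' : θ = θ') : eMk l hl hs θ = eMk l' (by rw [← e, hl])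
      (by rw [← e, hs]) θ' := by
  subst e e'; rfl

lemma lift_listMk_epsι {L : List ℕ} (hL : L.length = n) (l : List (Elt Z F.obj))
    (e : l.map Sigma.fst = L) (θ : Z ⟶ dHom A L.sum T) :
    lift (listMk l ≫ eqToHom (by rw [e])) θ ≫ epsι F n T ⟨L, hL⟩ =
      eMk l (by rw [← hL, ← e, List.length_map]) (by rw [← e]) θ := by
  subst e; simp [eMk]

lemma listElts_length {ι : Type} {X : ι → V} (L : List ι) (p : Z ⟶ listProd X L) :
    (listElts L p).length = L.length := by
  rw [← List.length_map (f := Sigma.fst), map_fst_listElts]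

lemma comp_epsι (L : {L : List ℕ // L.length = n})
    (y : Z ⟶ listProd F.obj L.1 ⊗ dHom A L.1.sum T) : y ≫ epsι F n T L =
      eMk (listElts L.1 (y ≫ fst _ _)) ((listElts_length _ _).trans L.2)
        (by rw [total, map_fst_listElts]) (y ≫ snd _ _) := by
  rw [← lift_listMk_epsι L.2 _ (map_fst_listElts _ _), listMk_listElts]
  simp

lemma lift_epsι (L : {L : List ℕ // L.length = n}) (p : Z ⟶ listProd F.obj L.1)
    (θ : Z ⟶ dHom A L.1.sum T) : lift p θ ≫ epsι F n T L =
      eMk (listElts L.1 p) ((listElts_length _ _).trans L.2)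
        (by rw [total, map_fst_listElts]) θ := by
  rw [comp_epsι]
  exact eMk_congr (by rw [lift_fst]) _ _ (lift_snd _ _)

lemma comp_eMk (h : Z' ⟶ Z) (l : List (Elt Z F.obj)) (hl : l.length = n) (hs : total l = s)
    (θ : Z ⟶ dHom A s T) : h ≫ eMk l hl hs θ =
      eMk (l.map (pull h)) (by simpa using hl) ((congrArg List.sum (map_fst_pull h l)).trans hs) (h ≫ θ) := by
  subst hs
  rw [← lift_listMk_epsι (by simpa using hl) _ (map_fst_pull h l), ← comp_listMk]
  simp [eMk, comp_lift_assoc]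

lemma lift_eMk_epsAct (l : List (Elt Z F.obj)) (hl : l.length = n) (hs : total l = s)
    (θ : Z ⟶ dHom A s T) (f : Z ⟶ dHom A T T') :
    lift (eMk l hl hs θ) f ≫ epsAct F n T T' = eMk l hl hs (lift θ f ≫ dComp _ _ _) := by
  subst hs
  refine (lift_epsι_epsAct F ⟨l.map Sigma.fst, by simpa using hl⟩
    (lift (listMk l) (θ ≫ dCast A rfl rfl)) f).trans ?_
  simp [eMk]

lemma eMk_gen (n T : ℕ) : Gen (epsObj F n T) (fun Z x => ∃ (l : List (Elt Z F.obj)) (s : ℕ)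
    (hl : l.length = n) (hs : total l = s) (θ : Z ⟶ dHom A s T), x = eMk l hl hs θ) where
  stable h x := by rintro ⟨l, s, hl, hs, θ, rfl⟩; exact ⟨_, _, _, _, _, comp_eMk h l hl hs θ⟩
  ext' f g h := (eps_gen n T).ext' f g fun Z x hx w => by
    obtain ⟨L, y, rfl⟩ := hx
    exact h Z _ ⟨_, _, _, _, _, comp_epsι L y⟩ w

/-- The first component of a pair. -/
def srcElt (x : Elt Z (pairObj F)) : Elt Z F.obj := ⟨x.1.1, x.2 ≫ fst _ _⟩

/-- The result of the action of the second component of a pair on the first. -/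
def actElt (x : Elt Z (pairObj F)) : Elt Z F.obj := ⟨x.1.2, x.2 ≫ F.act _ _⟩

/-- The ordinal sum of the second components of a list of pairs. -/
def sumElt : (l : List (Elt Z (pairObj F))) →
    (Z ⟶ dHom A (total (l.map srcElt)) (total (l.map actElt)))
  | [] => toUnit _ ≫ dId A 0
  | x :: l => lift (x.2 ≫ snd _ _) (sumElt l) ≫ dSum _ _ _ _

/-- `sumElt` with prescribed source and target. -/
def sumElt' (l : List (Elt Z (pairObj F))) (hs : total (l.map srcElt) = s)
    (hs' : total (l.map actElt) = s') : Z ⟶ dHom A s s' := sumElt l ≫ dCast A hs hs'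

lemma sumElt'_cons (x : Elt Z (pairObj F)) (l : List (Elt Z (pairObj F)))
    (hs : total (l.map srcElt) = s) (hs' : total (l.map actElt) = s')
    (h : total ((x :: l).map srcElt) = x.1.1 + s) (h' : total ((x :: l).map actElt) = x.1.2 + s') :
    sumElt' (x :: l) h h' = lift (x.2 ≫ snd _ _) (sumElt' l hs hs') ≫ dSum _ _ _ _ := by
  subst hs hs'
  simp only [sumElt', dCast_rfl, Category.comp_id]
  exact Category.comp_id _

lemma sumElt'_dCast (l : List (Elt Z (pairObj F))) {t t' : ℕ} (hs : total (l.map srcElt) = s)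
    (hs' : total (l.map actElt) = s') (e : s = t) (e' : s' = t') :
    sumElt' l hs hs' ≫ dCast A e e' = sumElt' l (hs.trans e) (hs'.trans e') := by
  simp [sumElt']

lemma total_append {X : ℕ → V} (l l' : List (Elt Z X)) : total (l ++ l') = total l + total l' := by
  simp [total]

instance {m m' n n' : ℕ} (hm : m = m') (hn : n = n') : IsIso (dCast A hm hn) := by
  subst hm hn; rw [dCast_rfl]; infer_instance

lemma dSum_dId_left (u : Z ⟶ 𝟙_ V) (f : Z ⟶ dHom A s s') :
    lift (u ≫ dId A 0) f ≫ dSum 0 0 s s' =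
      f ≫ dCast A (Nat.zero_add _).symm (Nat.zero_add _).symm := by
  have : lift (toUnit _ ≫ dId A 0) (𝟙 (dHom A s s')) ≫ dSum 0 0 s s' =
      dCast A (Nat.zero_add _).symm (Nat.zero_add _).symm :=
    (dHom_gen A s s').ext fun Z x hx => by
      obtain ⟨l, hm, hn, rfl⟩ := hx
      rw [comp_lift_assoc, Category.comp_id, ← Category.assoc, comp_dId, lift_dIn_dSum, dIn_dCast]
      exact dIn_congr rfl _ _
  rw [← this, comp_lift_assoc, Category.comp_id, ← Category.assoc, toUnit_unique u (f ≫ toUnit _)]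

lemma dSum_dId_right (u : Z ⟶ 𝟙_ V) (f : Z ⟶ dHom A s s') :
    lift f (u ≫ dId A 0) ≫ dSum s s' 0 0 = f := by
  have : lift (𝟙 (dHom A s s')) (toUnit _ ≫ dId A 0) ≫ dSum s s' 0 0 = 𝟙 _ :=
    (dHom_gen A s s').ext fun Z x hx => by
      obtain ⟨l, hm, hn, rfl⟩ := hx
      rw [comp_lift_assoc, Category.comp_id, ← Category.assoc, comp_dId, lift_dIn_dSum]
      exact dIn_congr (List.append_nil l) _ _
  have h : f ≫ lift (𝟙 (dHom A s s')) (toUnit _ ≫ dId A 0) ≫ dSum s s' 0 0 = f ≫ 𝟙 _ :=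
    congrArg (fun t => f ≫ t) this
  rw [comp_lift_assoc, Category.comp_id, ← Category.assoc, toUnit_unique (f ≫ toUnit _) u] at h
  exact h

lemma lift_sumElt'_dSum (l l' : List (Elt Z (pairObj F))) {t t' : ℕ}
    (hs : total (l.map srcElt) = s) (hs' : total (l.map actElt) = s')
    (ht : total (l'.map srcElt) = t) (ht' : total (l'.map actElt) = t') :
    lift (sumElt' l hs hs') (sumElt' l' ht ht') ≫ dSum _ _ _ _ =
      sumElt' (l ++ l') (by rw [List.map_append, total_append, hs, ht])
        (by rw [List.map_append, total_append, hs', ht']) := by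
  induction l generalizing s s' with
  | nil =>
    subst hs hs' ht ht'
    have : sumElt' ([] : List (Elt Z (pairObj F))) rfl rfl = toUnit Z ≫ dId A 0 :=
      Category.comp_id _
    refine (congrArg (fun t => lift t (sumElt' l' rfl rfl) ≫ dSum 0 0 _ _) this).trans ?_
    refine (dSum_dId_left _ _).trans ?_
    exact sumElt'_dCast _ _ _ _ _
  | cons x l ih =>
    obtain ⟨p, hp⟩ : ∃ p, total (l.map srcElt) = p := ⟨_, rfl⟩
    obtain ⟨p', hp'⟩ : ∃ p', total (l.map actElt) = p' := ⟨_, rfl⟩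
    obtain rfl : x.1.1 + p = s := by rw [← hs, ← hp]; rfl
    obtain rfl : x.1.2 + p' = s' := by rw [← hs', ← hp']; rfl
    have e₁ : total ((l ++ l').map srcElt) = p + t := by rw [List.map_append, total_append, hp, ht]
    have e₂ : total ((l ++ l').map actElt) = p' + t' := by
      rw [List.map_append, total_append, hp', ht']
    rw [sumElt'_cons x l hp hp', ← cancel_mono (dCast A (Nat.add_assoc _ _ _) (Nat.add_assoc _ _ _)),
      Category.assoc, dSum_assoc, ih hp hp', sumElt'_dCast]
    exact (sumElt'_cons x (l ++ l') e₁ e₂ _ _).symm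

lemma lift_fst_tensorHom {X Y X' Y' : V} (q : Z ⟶ X ⊗ Y) (f : X ⟶ X') (g : Y ⟶ Y') :
    (q ≫ (f ⊗ₘ g)) ≫ fst _ _ = (q ≫ fst _ _) ≫ f := by simp

lemma lift_snd_tensorHom {X Y X' Y' : V} (q : Z ⟶ X ⊗ Y) (f : X ⟶ X') (g : Y ⟶ Y') :
    (q ≫ (f ⊗ₘ g)) ≫ snd _ _ = (q ≫ snd _ _) ≫ g := by simp

lemma listElts_pairAct (L : List (ℕ × ℕ)) (q : Z ⟶ listProd (pairObj F) L) :
    listElts _ (q ≫ pairAct F L) = (listElts L q).map actElt := by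
  induction L with
  | nil => rfl
  | cons a L ih =>
    refine congrArg₂ List.cons ?_ ?_
    · exact Sigma.ext rfl (heq_of_eq (lift_fst_tensorHom q (F.act a.1 a.2) (pairAct F L)))
    · exact (congrArg _ (lift_snd_tensorHom q (F.act a.1 a.2) (pairAct F L))).trans (ih _)

lemma listElts_pairSrc (L : List (ℕ × ℕ)) (q : Z ⟶ listProd (pairObj F) L) :
    listElts _ (q ≫ pairSrc F L) = (listElts L q).map srcElt := by
  induction L with
  | nil => rfl
  | cons a L ih =>
    refine congrArg₂ List.cons ?_ ?_
    · exact Sigma.ext rfl (heq_of_eq (lift_fst_tensorHom q (fst _ _) (pairSrc F L)))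
    · exact (congrArg _ (lift_snd_tensorHom q (fst _ _) (pairSrc F L))).trans (ih _)

lemma comp_pairSum (L : List (ℕ × ℕ)) (q : Z ⟶ listProd (pairObj F) L) :
    q ≫ pairSum F L = sumElt' (listElts L q)
      (by rw [← listElts_pairSrc, total, map_fst_listElts])
      (by rw [← listElts_pairAct, total, map_fst_listElts]) := by
  induction L with
  | nil =>
    refine Eq.trans ?_ (Category.comp_id _).symm
    exact congrArg (fun t => t ≫ dId A 0) (toUnit_unique q (toUnit Z))
  | cons a L ih =>
    have h₁ := listElts_pairSrc L (q ≫ snd _ _)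
    have h₂ := listElts_pairAct L (q ≫ snd _ _)
    have h := sumElt'_cons (⟨a, q ≫ fst _ _⟩ : Elt Z (pairObj F)) (listElts L (q ≫ snd _ _))
      (s := (L.map Prod.fst).sum) (s' := (L.map Prod.snd).sum)
      (by rw [← h₁, total, map_fst_listElts]) (by rw [← h₂, total, map_fst_listElts])
      (by rw [List.map_cons, ← h₁, total, List.map_cons, map_fst_listElts]; rfl)
      (by rw [List.map_cons, ← h₂, total, List.map_cons, map_fst_listElts]; rfl)
    refine Eq.trans ?_ h.symm
    rw [← ih]
    have e : q ≫ (snd _ _ ⊗ₘ pairSum F L) = lift ((q ≫ fst _ _) ≫ snd _ _)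
        ((q ≫ snd _ _) ≫ pairSum F L) :=
      CartesianMonoidalCategory.hom_ext _ _
        ((lift_fst_tensorHom q (snd _ _) (pairSum F L)).trans (lift_fst _ _).symm)
        ((lift_snd_tensorHom q (snd _ _) (pairSum F L)).trans (lift_snd _ _).symm)
    rw [← e]
    exact (Category.assoc _ _ _).symm

lemma eMk_rel (l : List (Elt Z (pairObj F))) (hl : l.length = n)
    (hs : total (l.map srcElt) = s) (hs' : total (l.map actElt) = s') (θ : Z ⟶ dHom A s' T) :
    eMk (l.map actElt) (by simpa using hl) hs' θ =
      eMk (l.map srcElt) (by simpa using hl) hs (lift (sumElt' l hs hs') θ ≫ dComp _ _ _) := by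
  obtain ⟨L, q, rfl⟩ : ∃ L q, l = listElts L q := ⟨_, _, (listElts_listMk l).symm⟩
  obtain rfl : (L.map Prod.fst).sum = s := by
    rw [← hs, ← listElts_pairSrc, total, map_fst_listElts]
  obtain rfl : (L.map Prod.snd).sum = s' := by
    rw [← hs', ← listElts_pairAct, total, map_fst_listElts]
  have h := epsι_rel F ⟨L, (listElts_length L q).symm.trans hl⟩ q θ
  refine (eMk_congr (listElts_pairAct L q).symm _ _ rfl).trans
    (((lift_epsι ⟨L.map Prod.snd, by simpa [listElts_length] using hl⟩ (q ≫ pairAct F L) θ).symm.trans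
      (h.trans (lift_epsι ⟨L.map Prod.fst, by simpa [listElts_length] using hl⟩
        (q ≫ pairSrc F L) _))).trans ?_)
  exact eMk_congr (listElts_pairSrc L q) _ _ (by rw [comp_pairSum])

end Epsilon

section Multiplication

variable {V : Type v} [Category.{u} V] [CartesianMonoidalCategory V] [MonoidalClosed V]
  [HasColimits V] {A : OperadData V} [A.IsOperad] {F : Copresheaf A}
  {Z Z' : V} {n n' T T' s s' : ℕ}

/-! ### The multiplication `ε(n)(T) × ε(n')(T') ⟶ ε(n + n')(T ⊔ T')` -/

/-- An element as a pair with an identity as second component. -/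
def idElt (x : Elt Z F.obj) : Elt Z (pairObj F) := ⟨(x.1, x.1), lift x.2 (toUnit _ ≫ dId A _)⟩

lemma srcElt_idElt (x : Elt Z F.obj) : srcElt (idElt x) = x :=
  Sigma.ext rfl (heq_of_eq (lift_fst _ _))

lemma actElt_idElt (x : Elt Z F.obj) : actElt (idElt x) = x := by
  refine Sigma.ext rfl (heq_of_eq ?_)
  have h := congrArg (fun t => x.2 ≫ t) (F.act_id x.1)
  have e : x.2 ≫ (ρ_ _).inv ≫ _ ◁ dId A x.1 = lift x.2 (toUnit _ ≫ dId A _) := by ext <;> simp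
  rw [reassoc_of% e, Category.comp_id] at h
  exact h

lemma map_srcElt_idElt (l : List (Elt Z F.obj)) : (l.map idElt).map srcElt = l := by
  induction l with
  | nil => rfl
  | cons x l ih => rw [List.map_cons, List.map_cons, ih, srcElt_idElt]

lemma map_actElt_idElt (l : List (Elt Z F.obj)) : (l.map idElt).map actElt = l := by
  induction l with
  | nil => rfl
  | cons x l ih => rw [List.map_cons, List.map_cons, ih, actElt_idElt]

lemma sumElt'_idElt (l : List (Elt Z F.obj)) (hs : total ((l.map idElt).map srcElt) = s)
    (hs' : total ((l.map idElt).map actElt) = s) :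
    sumElt' (l.map idElt) hs hs' = toUnit Z ≫ dId A s := by
  induction l generalizing s with
  | nil => subst hs; exact Category.comp_id _
  | cons x l ih =>
    obtain rfl : x.1 + total l = s := by rw [← hs, map_srcElt_idElt]; rfl
    refine (sumElt'_cons (idElt x) (l.map idElt) (s := total l) (s' := total l)
      (by rw [map_srcElt_idElt]) (by rw [map_actElt_idElt]) hs hs').trans ?_
    rw [ih]
    refine Eq.trans ?_ (dSum_dId (A := A) (toUnit Z) x.1 (total l))
    exact congrArg (fun t => lift t _ ≫ dSum _ _ _ _) (lift_snd _ _)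

lemma eMk_mul_rel (l l' : List (Elt Z (pairObj F))) (hl : l.length = n) (hl' : l'.length = n')
    {t t' : ℕ} (hs : total (l.map srcElt) = s) (hs' : total (l.map actElt) = s')
    (ht : total (l'.map srcElt) = t) (ht' : total (l'.map actElt) = t')
    (θ : Z ⟶ dHom A s' T) (θ' : Z ⟶ dHom A t' T') :
    eMk (n := n + n') (s := s' + t') (l.map actElt ++ l'.map actElt) (by simp [hl, hl'])
      (by rw [total_append, hs', ht']) (lift θ θ' ≫ dSum _ _ _ _) =
    eMk (n := n + n') (s := s + t) (l.map srcElt ++ l'.map srcElt) (by simp [hl, hl'])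
      (by rw [total_append, hs, ht])
      (lift (lift (sumElt' l hs hs') θ ≫ dComp _ _ _)
        (lift (sumElt' l' ht ht') θ' ≫ dComp _ _ _) ≫ dSum _ _ _ _) := by
  refine (eMk_congr List.map_append.symm _ _ rfl).trans ?_
  refine (eMk_rel (l ++ l') (by simp [hl, hl']) (s := s + t)
    (by rw [List.map_append, total_append, hs, ht])
    (by rw [List.map_append, total_append, hs', ht']) _).trans ?_
  refine eMk_congr List.map_append _ _ ?_
  rw [← dSum_dComp, lift_sumElt'_dSum]

lemma eMk_mul_rel_left (l : List (Elt Z (pairObj F))) (l' : List (Elt Z F.obj)) (hl : l.length = n)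
    (hl' : l'.length = n') {t : ℕ} (hs : total (l.map srcElt) = s) (hs' : total (l.map actElt) = s')
    (ht : total l' = t) (θ : Z ⟶ dHom A s' T) (θ' : Z ⟶ dHom A t T') :
    eMk (n := n + n') (s := s' + t) (l.map actElt ++ l') (by simp [hl, hl'])
      (by rw [total_append, hs', ht]) (lift θ θ' ≫ dSum _ _ _ _) =
    eMk (n := n + n') (s := s + t) (l.map srcElt ++ l') (by simp [hl, hl'])
      (by rw [total_append, hs, ht])
      (lift (lift (sumElt' l hs hs') θ ≫ dComp _ _ _) θ' ≫ dSum _ _ _ _) := by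
  refine (eMk_congr (by rw [map_actElt_idElt]) _ _ rfl).trans ((eMk_mul_rel l (l'.map idElt) hl
    (by simpa using hl') hs hs' (by rw [map_srcElt_idElt, ht]) (by rw [map_actElt_idElt, ht])
    θ θ').trans (eMk_congr (by rw [map_srcElt_idElt]) _ _ ?_))
  rw [sumElt'_idElt, lift_dId_dComp]

lemma eMk_mul_rel_right (l : List (Elt Z F.obj)) (l' : List (Elt Z (pairObj F))) (hl : l.length = n)
    (hl' : l'.length = n') {t t' : ℕ} (hs : total l = s)
    (ht : total (l'.map srcElt) = t) (ht' : total (l'.map actElt) = t')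
    (θ : Z ⟶ dHom A s T) (θ' : Z ⟶ dHom A t' T') :
    eMk (n := n + n') (s := s + t') (l ++ l'.map actElt) (by simp [hl, hl'])
      (by rw [total_append, hs, ht']) (lift θ θ' ≫ dSum _ _ _ _) =
    eMk (n := n + n') (s := s + t) (l ++ l'.map srcElt) (by simp [hl, hl'])
      (by rw [total_append, hs, ht])
      (lift θ (lift (sumElt' l' ht ht') θ' ≫ dComp _ _ _) ≫ dSum _ _ _ _) := by
  refine (eMk_congr (by rw [map_actElt_idElt]) _ _ rfl).trans ((eMk_mul_rel (l.map idElt) l'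
    (by simpa using hl) hl' (by rw [map_srcElt_idElt, hs]) (by rw [map_actElt_idElt, hs]) ht ht'
    θ θ').trans (eMk_congr (by rw [map_srcElt_idElt]) _ _ ?_))
  rw [sumElt'_idElt, lift_dId_dComp]

lemma Gen.lift_ext {X W Y₁ Y₂ : V} {S : ∀ ⦃Z : V⦄, (Z ⟶ X) → Prop} (hX : Gen X S)
    (k₁ : X ⊗ Y₁ ⟶ W) (k₂ : X ⊗ Y₂ ⟶ W) (a : Z ⟶ Y₁) (b : Z ⟶ Y₂)
    (h : ∀ (Z' : V) (r : Z' ⟶ Z) (x : Z' ⟶ X), S x →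
      lift x (r ≫ a) ≫ k₁ = lift x (r ≫ b) ≫ k₂) (x : Z ⟶ X) :
    lift x a ≫ k₁ = lift x b ≫ k₂ := by
  have : X ◁ a ≫ k₁ = X ◁ b ≫ k₂ := hX.ext' _ _ fun Z' x hx r => by
    rw [lift_whiskerLeft_assoc, lift_whiskerLeft_assoc, h Z' r x hx]
  simpa using congrArg (fun t => lift x (𝟙 Z) ≫ t) this

lemma lift_swap {X Y : V} (x : Z ⟶ X) (y : Z ⟶ Y) : lift x y ≫ swap X Y = lift y x := by
  ext <;> simp [swap]

variable (F) in
/-- The multiplication on representatives: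
`([e; θ], [e'; θ']) ↦ [e, e'; θ ⊔ θ']`. -/
def epsMulAux (L : {L : List ℕ // L.length = n}) (L' : {L : List ℕ // L.length = n'}) (T T' : ℕ) :
    (listProd F.obj L'.1 ⊗ dHom A L'.1.sum T') ⊗ (listProd F.obj L.1 ⊗ dHom A L.1.sum T) ⟶
      epsObj F (n + n') (T + T') :=
  eMk (listElts L.1 (snd _ _ ≫ fst _ _) ++ listElts L'.1 (fst _ _ ≫ fst _ _))
    (by rw [List.length_append, listElts_length, listElts_length, L.2, L'.2])
    (by rw [total_append, total, total, map_fst_listElts, map_fst_listElts])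
    (lift (snd _ _ ≫ snd _ _) (fst _ _ ≫ snd _ _) ≫ dSum L.1.sum T L'.1.sum T')

lemma lift_epsMulAux (L : {L : List ℕ // L.length = n}) (L' : {L : List ℕ // L.length = n'})
    (p : Z ⟶ listProd F.obj L.1) (θ : Z ⟶ dHom A L.1.sum T)
    (p' : Z ⟶ listProd F.obj L'.1) (θ' : Z ⟶ dHom A L'.1.sum T') :
    lift (lift p' θ') (lift p θ) ≫ epsMulAux F L L' T T' =
      eMk (listElts L.1 p ++ listElts L'.1 p')
        (by rw [List.length_append, listElts_length, listElts_length, L.2, L'.2])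
        (by rw [total_append, total, total, map_fst_listElts, map_fst_listElts])
        (lift θ θ' ≫ dSum L.1.sum T L'.1.sum T') := by
  rw [epsMulAux, comp_eMk]
  refine eMk_congr ?_ _ _ ?_
  · rw [List.map_append, pull_listElts, pull_listElts]
    simp
  · simp [comp_lift_assoc]

variable (F) in
/-- The multiplication with a representative on the left. -/
def epsMulLeft (L : {L : List ℕ // L.length = n}) (n' T T' : ℕ) :
    epsObj F n' T' ⊗ (listProd F.obj L.1 ⊗ dHom A L.1.sum T) ⟶ epsObj F (n + n') (T + T') :=
  epsDesc F (fun L' => epsMulAux F L L' T T') (by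
    intro L' Z q θ' y
    obtain ⟨p, θ, rfl⟩ : ∃ p θ, y = lift p θ := ⟨y ≫ fst _ _, y ≫ snd _ _, by simp⟩
    refine (lift_epsMulAux L ⟨L'.1.map Prod.snd, by simpa using L'.2⟩ p θ _ _).trans
      (Eq.trans ?_ (lift_epsMulAux L ⟨L'.1.map Prod.fst, by simpa using L'.2⟩ p θ _ _).symm)
    refine (eMk_congr (by rw [listElts_pairAct]) _ _ rfl).trans ((eMk_mul_rel_right
      (listElts L.1 p) (listElts L'.1 q) ((listElts_length _ _).trans L.2)
      ((listElts_length _ _).trans L'.2) (by rw [total, map_fst_listElts])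
      (by rw [← listElts_pairSrc, total, map_fst_listElts])
      (by rw [← listElts_pairAct, total, map_fst_listElts]) θ θ').trans (eMk_congr
        (by rw [listElts_pairSrc]) _ _ (by rw [comp_pairSum]))))

lemma lift_eMk_epsMulLeft (L : {L : List ℕ // L.length = n}) (l' : List (Elt Z F.obj))
    (hl' : l'.length = n') (hs' : total l' = s') (θ' : Z ⟶ dHom A s' T')
    (p : Z ⟶ listProd F.obj L.1) (θ : Z ⟶ dHom A L.1.sum T) :
    lift (eMk l' hl' hs' θ') (lift p θ) ≫ epsMulLeft F L n' T T' =
      eMk (listElts L.1 p ++ l')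
        (by rw [List.length_append, listElts_length, L.2, hl'])
        (by rw [total_append, total, map_fst_listElts, hs']) (lift θ θ' ≫ dSum _ _ _ _) := by
  obtain ⟨L', p', rfl⟩ : ∃ L p, l' = listElts L p := ⟨_, _, (listElts_listMk l').symm⟩
  obtain rfl : L'.sum = s' := by rw [← hs', total, map_fst_listElts]
  have hL' : L'.length = n' := (listElts_length L' p').symm.trans hl'
  have e : eMk (listElts L' p') hl' hs' θ' = lift p' θ' ≫ epsι F n' T' ⟨L', hL'⟩ :=
    (lift_epsι ⟨L', hL'⟩ p' θ').symm
  rw [e, epsMulLeft]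
  exact (lift_epsι_epsDesc F _ _ ⟨L', hL'⟩ (lift p' θ') (lift p θ)).trans
    (lift_epsMulAux L ⟨L', hL'⟩ p θ p' θ')

variable (F) in
/-- The multiplication `ε(n)(T) × ε(n')(T') ⟶ ε(n + n')(T ⊔ T')`,
`([e; θ], [e'; θ']) ↦ [e, e'; θ ⊔ θ']`. -/
def epsMul (n n' T T' : ℕ) : epsObj F n T ⊗ epsObj F n' T' ⟶ epsObj F (n + n') (T + T') :=
  epsDesc F (fun L => swap _ _ ≫ epsMulLeft F L n' T T') (by
    intro L Z q θ w
    rw [← Category.assoc, ← Category.assoc, lift_swap, lift_swap]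
    refine (eMk_gen n' T').lift_ext _ _ _ _ (fun Z' r x hx => ?_) w
    obtain ⟨l', s', hl', hs', θ', rfl⟩ := hx
    rw [comp_lift, comp_lift]
    refine (lift_eMk_epsMulLeft ⟨L.1.map Prod.snd, by simpa using L.2⟩ l' hl' hs' θ' _ _).trans
      (Eq.trans ?_ (lift_eMk_epsMulLeft ⟨L.1.map Prod.fst, by simpa using L.2⟩ l' hl' hs' θ'
        _ _).symm)
    refine (eMk_congr (by rw [← Category.assoc, listElts_pairAct]) _ _ rfl).trans
      ((eMk_mul_rel_left (listElts L.1 (r ≫ q)) l' ((listElts_length _ _).trans L.2) hl'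
      (by rw [← listElts_pairSrc, total, map_fst_listElts])
      (by rw [← listElts_pairAct, total, map_fst_listElts]) hs' (r ≫ θ) θ').trans (eMk_congr
        (by rw [← Category.assoc, listElts_pairSrc]) _ _ ?_))
    rw [← comp_pairSum, comp_lift_assoc, Category.assoc])

lemma lift_eMk_epsMul (l : List (Elt Z F.obj)) (hl : l.length = n) (hs : total l = s)
    (θ : Z ⟶ dHom A s T) (l' : List (Elt Z F.obj)) (hl' : l'.length = n') (hs' : total l' = s')
    (θ' : Z ⟶ dHom A s' T') : lift (eMk l hl hs θ) (eMk l' hl' hs' θ') ≫ epsMul F n n' T T' =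
      eMk (l ++ l') (by rw [List.length_append, hl, hl']) (by rw [total_append, hs, hs'])
        (lift θ θ' ≫ dSum _ _ _ _) := by
  obtain ⟨L, p, rfl⟩ : ∃ L p, l = listElts L p := ⟨_, _, (listElts_listMk l).symm⟩
  obtain rfl : L.sum = s := by rw [← hs, total, map_fst_listElts]
  have hL : L.length = n := (listElts_length L p).symm.trans hl
  have e : eMk (listElts L p) hl hs θ = lift p θ ≫ epsι F n T ⟨L, hL⟩ :=
    (lift_epsι ⟨L, hL⟩ p θ).symm
  rw [e, epsMul]
  refine (lift_epsι_epsDesc F _ _ ⟨L, hL⟩ (lift p θ) _).trans ?_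
  rw [← Category.assoc, lift_swap]
  exact lift_eMk_epsMulLeft ⟨L, hL⟩ l' hl' hs' θ' p θ

lemma epsMul_epsAct (a : Z ⟶ epsObj F n s) (b : Z ⟶ epsObj F n' s') (f : Z ⟶ dHom A s T)
    (g : Z ⟶ dHom A s' T') :
    lift (lift a f ≫ epsAct F n s T) (lift b g ≫ epsAct F n' s' T') ≫ epsMul F n n' T T' =
      lift (lift a b ≫ epsMul F n n' s s') (lift f g ≫ dSum s T s' T') ≫ epsAct F _ _ _ := by
  have : (epsAct F n s T ⊗ₘ epsAct F n' s' T') ≫ epsMul F n n' T T' =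
      lift ((fst _ _ ⊗ₘ fst _ _) ≫ epsMul F n n' s s') ((snd _ _ ⊗ₘ snd _ _) ≫ dSum s T s' T') ≫
        epsAct F _ _ _ := by
    refine (((eMk_gen n s).prod (.top _)).prod ((eMk_gen n' s').prod (.top _))).ext
      fun Z x hx => ?_
    obtain ⟨⟨⟨l, t, hl, hs, θ, h⟩, -⟩, ⟨⟨l', t', hl', hs', θ', h'⟩, -⟩⟩ := hx
    obtain ⟨f, g, rfl⟩ : ∃ f g, x = lift (lift (eMk l hl hs θ) f) (lift (eMk l' hl' hs' θ') g) :=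
      ⟨x ≫ fst _ _ ≫ snd _ _, x ≫ snd _ _ ≫ snd _ _, by
        rw [← h, ← h']; ext <;> simp⟩
    rw [lift_map_assoc, lift_eMk_epsAct, lift_eMk_epsAct, lift_eMk_epsMul, comp_lift_assoc,
      lift_map_assoc, lift_map_assoc, lift_fst, lift_fst, lift_snd, lift_snd, lift_eMk_epsMul,
      lift_eMk_epsAct, dSum_dComp]
  simpa [comp_lift_assoc] using congrArg (fun t => lift (lift a f) (lift b g) ≫ t) this

end Multiplication

section Extended

variable {V : Type v} [Category.{u} V] [CartesianMonoidalCategory V] [MonoidalClosed V]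
  [HasColimits V] [HasLimits V] {A : OperadData V} [A.IsOperad] (F : Copresheaf A)
  {Z : V} {n T T' : ℕ}

/-! ### The extended operad -/

/-- The object of natural transformations `F ⟶ ε(n)`. -/
def extObj (n : ℕ) : V := natObj F (eps F n)

/-- The evaluation of natural transformations `F ⟶ ε(n)`. -/
def extEv (n T : ℕ) : F.obj T ⊗ extObj F n ⟶ epsObj F n T := natEv F (eps F n) T

lemma lift_act_extEv (e : Z ⟶ F.obj T) (f : Z ⟶ dHom A T T') (g : Z ⟶ extObj F n) :
    lift (lift e f ≫ F.act T T') g ≫ extEv F n T' =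
      lift (lift e g ≫ extEv F n T) f ≫ epsAct F n T T' := by
  have h : lift (lift e f) g ≫ F.act T T' ▷ _ ≫ extEv F n T' = lift (lift e f) g ≫
      lift (lift (fst _ _ ≫ fst _ _) (snd _ _) ≫ extEv F n T) (fst _ _ ≫ snd _ _) ≫
        epsAct F n T T' :=
    congrArg (fun t => lift (lift e f) g ≫ t) (natEv_isNatural F (eps F n) T T').symm
  simpa [comp_lift_assoc] using h

variable {F} in
lemma lift_epsAct_epsAct {T'' : ℕ} (x : Z ⟶ epsObj F n T) (f : Z ⟶ dHom A T T')
    (g : Z ⟶ dHom A T' T'') : lift (lift x f ≫ epsAct F n T T') g ≫ epsAct F n T' T'' =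
      lift x (lift f g ≫ dComp T T' T'') ≫ epsAct F n T T'' := by
  have h : lift (lift x f) g ≫ epsAct F n T T' ▷ _ ≫ epsAct F n T' T'' = lift (lift x f) g ≫
      (α_ _ _ _).hom ≫ _ ◁ dComp T T' T'' ≫ epsAct F n T T'' :=
    congrArg (fun t => lift (lift x f) g ≫ t) ((eps F n).act_comp T T' T'')
  simpa [lift_lift_associator_hom_assoc] using h

/-- The map sending `e₁, …, eₙ` and `g₁, …, gₙ` to `g₁(e₁), …, gₙ(eₙ)`, multiplied together. -/
def extZip : (L ks : List ℕ) → L.length = ks.length →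
    (listProd F.obj L ⊗ listProd (extObj F) ks ⟶ epsObj F ks.sum L.sum)
  | [], [], _ => toUnit _ ≫ eMk (s := 0) [] rfl rfl (dId A 0)
  | m :: L, k :: ks, h =>
    lift (lift (fst _ _ ≫ fst _ _) (snd _ _ ≫ fst _ _) ≫ extEv F k m)
      (lift (fst _ _ ≫ snd _ _) (snd _ _ ≫ snd _ _) ≫ extZip L ks (Nat.succ.inj h)) ≫
      epsMul F k ks.sum m L.sum

lemma lift_extZip_cons {m k : ℕ} {L ks : List ℕ} (h : L.length = ks.length)
    (h' : (m :: L).length = (k :: ks).length) (p : Z ⟶ F.obj m ⊗ listProd F.obj L)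
    (g : Z ⟶ extObj F k ⊗ listProd (extObj F) ks) :
    lift p g ≫ extZip F (m :: L) (k :: ks) h' =
      lift (lift (p ≫ fst _ _) (g ≫ fst _ _) ≫ extEv F k m)
        (lift (p ≫ snd _ _) (g ≫ snd _ _) ≫ extZip F L ks h) ≫ epsMul F k ks.sum m L.sum := by
  have : lift p g ≫ lift (lift (fst _ _ ≫ fst _ _) (snd _ _ ≫ fst _ _) ≫ extEv F k m)
      (lift (fst _ _ ≫ snd _ _) (snd _ _ ≫ snd _ _) ≫ extZip F L ks h) ≫
      epsMul F k ks.sum m L.sum = lift (lift (p ≫ fst _ _) (g ≫ fst _ _) ≫ extEv F k m)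
        (lift (p ≫ snd _ _) (g ≫ snd _ _) ≫ extZip F L ks h) ≫ epsMul F k ks.sum m L.sum := by
    simp [comp_lift_assoc]
  exact this

lemma comp_extZip_nil (h : ([] : List ℕ).length = ([] : List ℕ).length) (p : Z ⟶ 𝟙_ V ⊗ 𝟙_ V) :
    p ≫ extZip F [] [] h = eMk (s := 0) [] rfl rfl (toUnit Z ≫ dId A 0) := by
  refine (Category.assoc _ _ _).symm.trans ((comp_eMk (s := 0) _ _ _ _ _).trans ?_)
  exact eMk_congr rfl _ _ (congrArg (fun t => t ≫ dId A 0) (toUnit_unique _ _))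

lemma lift_pairAct_extZip (L : List (ℕ × ℕ)) (ks : List ℕ) (h : L.length = ks.length)
    (q : Z ⟶ listProd (pairObj F) L) (g : Z ⟶ listProd (extObj F) ks) :
    lift (q ≫ pairAct F L) g ≫ extZip F (L.map Prod.snd) ks (by simpa using h) =
      lift (lift (q ≫ pairSrc F L) g ≫ extZip F (L.map Prod.fst) ks (by simpa using h))
        (q ≫ pairSum F L) ≫ epsAct F _ _ _ := by
  induction L generalizing ks with
  | nil =>
    cases ks with
    | nil =>
      refine (comp_extZip_nil F rfl _).trans (Eq.trans ?_ (congrArg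
        (fun t => lift t (q ≫ pairSum F []) ≫ epsAct F _ _ _) (comp_extZip_nil F rfl _)).symm)
      refine Eq.trans ?_ (lift_eMk_epsAct (s := 0) [] rfl rfl _ _).symm
      exact eMk_congr rfl _ _ (Eq.trans (congrArg (fun t => t ≫ dId A 0) (toUnit_unique _ _))
        (lift_dId_dComp (toUnit Z) _).symm)
    | cons k ks => simp at h
  | cons a L ih =>
    cases ks with
    | nil => simp at h
    | cons k ks =>
      have hl : L.length = ks.length := Nat.succ.inj h
      refine (lift_extZip_cons F (by simpa using hl) (by simpa using h) _ _).trans ?_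
      refine Eq.trans ?_ (congrArg (fun t => lift t (q ≫ pairSum F (a :: L)) ≫ epsAct F _ _ _)
        (lift_extZip_cons F (L := L.map Prod.fst) (by simpa using hl) (by simpa using h) _ _)).symm
      have e : q ≫ pairSum F (a :: L) = lift ((q ≫ fst _ _) ≫ snd _ _)
        ((q ≫ snd _ _) ≫ pairSum F L) ≫ dSum _ _ _ _ := by
        have e : q ≫ (snd _ _ ⊗ₘ pairSum F L) = lift ((q ≫ fst _ _) ≫ snd _ _)
            ((q ≫ snd _ _) ≫ pairSum F L) :=
          CartesianMonoidalCategory.hom_ext _ _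
            ((lift_fst_tensorHom q (snd _ _) (pairSum F L)).trans (lift_fst _ _).symm)
            ((lift_snd_tensorHom q (snd _ _) (pairSum F L)).trans (lift_snd _ _).symm)
        rw [← e]
        exact (Category.assoc _ _ _).symm
      refine Eq.trans ?_ (congrArg (fun t => lift _ t ≫ epsAct F _ _ _) e).symm
      refine Eq.trans ?_ (epsMul_epsAct _ _ _ _)
      refine congrArg₂ (fun s t => lift s t ≫ epsMul F _ _ _ _) ?_ ?_
      · refine Eq.trans ?_ (lift_act_extEv F _ _ _)
        refine congrArg (fun t => lift t _ ≫ extEv F _ _) ?_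
        refine (lift_fst_tensorHom q (F.act a.1 a.2) (pairAct F L)).trans ?_
        refine congrArg (fun t => t ≫ F.act a.1 a.2) ?_
        exact CartesianMonoidalCategory.hom_ext _ _
          ((lift_fst_tensorHom q (fst _ _) (pairSrc F L)).symm.trans (lift_fst _ _).symm)
          (lift_snd _ _).symm
      · refine (congrArg (fun t => lift t _ ≫ extZip F _ _ _)
          (lift_snd_tensorHom q (F.act a.1 a.2) (pairAct F L))).trans ?_
        refine (ih ks hl (q ≫ snd _ _) (g ≫ snd _ _)).trans ?_
        refine congrArg (fun t => lift (lift t _ ≫ extZip F _ _ _) _ ≫ epsAct F _ _ _) ?_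
        exact (lift_snd_tensorHom q (fst _ _) (pairSrc F L)).symm

/-- The map sending `[e₁, …, eₙ; θ]` and `g₁, …, gₙ` to the product of `g₁(e₁), …, gₙ(eₙ)`, acted
upon by `θ`: the left Kan extension along the ordinal sum of the external product of the
transformations `gᵢ : F ⟶ ε(kᵢ)`, as a map `ε(n) ⟶ ε(k₁ + ⋯ + kₙ)`. -/
def extMap (ks : List ℕ) (T : ℕ) :
    epsObj F ks.length T ⊗ listProd (extObj F) ks ⟶ epsObj F ks.sum T :=
  epsDesc F (fun L => lift (lift (fst _ _ ≫ fst _ _) (snd _ _) ≫ extZip F L.1 ks L.2)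
    (fst _ _ ≫ snd _ _) ≫ epsAct F _ _ _) (by
    intro L Z q θ g
    simp only [comp_lift_assoc, lift_fst, lift_snd, lift_fst_assoc]
    rw [lift_pairAct_extZip F L.1 ks L.2, lift_epsAct_epsAct])

lemma lift_epsι_extMap (ks : List ℕ) (L : {L : List ℕ // L.length = ks.length})
    (y : Z ⟶ listProd F.obj L.1 ⊗ dHom A L.1.sum T) (g : Z ⟶ listProd (extObj F) ks) :
    lift (y ≫ epsι F _ T L) g ≫ extMap F ks T =
      lift (lift (y ≫ fst _ _) g ≫ extZip F L.1 ks L.2) (y ≫ snd _ _) ≫ epsAct F _ _ _ := by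
  rw [extMap, lift_epsι_epsDesc, comp_lift_assoc, comp_lift_assoc]
  simp

lemma lift_epsAct_extMap (ks : List ℕ) (x : Z ⟶ epsObj F ks.length T) (f : Z ⟶ dHom A T T')
    (g : Z ⟶ listProd (extObj F) ks) : lift (lift x f ≫ epsAct F _ _ _) g ≫ extMap F ks T' =
      lift (lift x g ≫ extMap F ks T) f ≫ epsAct F _ _ _ := by
  have : epsAct F ks.length T T' ▷ _ ≫ extMap F ks T' =
      lift (lift (fst _ _ ≫ fst _ _) (snd _ _) ≫ extMap F ks T) (fst _ _ ≫ snd _ _) ≫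
        epsAct F _ _ _ := by
    refine (((eps_gen ks.length T).prod (.top _)).prod (.top _)).ext fun Z x hx => ?_
    obtain ⟨⟨⟨L, y, h⟩, -⟩, -⟩ := hx
    obtain ⟨f, g, rfl⟩ : ∃ f g, x = lift (lift (y ≫ epsι F _ T L) f) g :=
      ⟨x ≫ fst _ _ ≫ snd _ _, x ≫ snd _ _, by ext <;> simp [← h]⟩
    rw [lift_whiskerRight_assoc, lift_epsι_epsAct, lift_epsι_extMap, comp_lift_assoc,
      comp_lift_assoc]
    simp only [lift_fst, lift_snd, lift_fst_assoc]
    rw [lift_epsι_extMap, lift_epsAct_epsAct]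
  have h := congrArg (fun t => lift (lift x f) g ≫ t) this
  simpa [comp_lift_assoc] using h

lemma lift_comp_act (ks : List ℕ) (e : Z ⟶ F.obj T) (f : Z ⟶ dHom A T T')
    (g : Z ⟶ extObj F ks.length ⊗ listProd (extObj F) ks) :
    lift (lift e g ≫ lift (lift (fst _ _) (snd _ _ ≫ fst _ _) ≫
      extEv F ks.length T) (snd _ _ ≫ snd _ _) ≫ extMap F ks T) f ≫ epsAct F _ _ _ =
    lift (lift e f ≫ F.act T T') g ≫ lift (lift (fst _ _) (snd _ _ ≫ fst _ _) ≫
      extEv F ks.length T') (snd _ _ ≫ snd _ _) ≫ extMap F ks T' := by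
  simp only [comp_lift_assoc, lift_fst, lift_snd_assoc]
  rw [lift_act_extEv, lift_epsAct_extMap]

/-- The composition of the extended operad:
`f(g₁, …, gₙ)` is the composite of `f : F ⟶ ε(n)` with the map `ε(n) ⟶ ε(k₁ + ⋯ + kₙ)` induced by
the `gᵢ`. -/
def extComp (ks : List ℕ) :
    extObj F ks.length ⊗ listProd (extObj F) ks ⟶ extObj F ks.sum :=
  natLift (F := F) (G := eps F ks.sum) (fun T => lift (lift (fst _ _) (snd _ _ ≫ fst _ _) ≫
    extEv F ks.length T) (snd _ _ ≫ snd _ _) ≫ extMap F ks T) (fun T T' => by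
    refine Eq.trans (lift_comp_act F ks (fst _ _ ≫ fst _ _) (fst _ _ ≫ snd _ _) (snd _ _)) ?_
    refine congrArg (fun t => t ≫ _) ?_
    ext <;> simp)

/-- The unit of the extended operad: the identification of `F` with `ε(1)`, `e ↦ [e; id]`. -/
def extOne : 𝟙_ V ⟶ extObj F 1 :=
  natLift (F := F) (G := eps F 1) (fun T => eMk (s := T) [⟨T, fst _ _⟩] rfl rfl
    (toUnit _ ≫ dId A T)) (fun T T' => by
    refine (congrArg (fun t => lift t _ ≫ epsAct F 1 T T') (comp_eMk _ _ _ _ _)).trans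
      ((lift_eMk_epsAct (s := T) _ rfl rfl _ _).trans ?_)
    refine Eq.trans ?_ (comp_eMk _ _ _ _ _).symm
    have h := eMk_rel (F := F) (n := 1) (s := T) (s' := T') [⟨(T, T'), fst _ (𝟙_ V)⟩] rfl rfl rfl
      (toUnit _ ≫ dId A T')
    refine Eq.trans ?_ (h.symm.trans ?_)
    · refine eMk_congr ?_ _ _ ?_
      · refine congrArg (fun t => [t]) (Sigma.ext rfl (heq_of_eq ?_))
        exact lift_fst _ _
      · rw [← Category.assoc, lift_dId_dComp, lift_dComp_dId]
        refine Eq.trans ?_ (sumElt'_cons (F := F) ⟨(T, T'), fst _ (𝟙_ V)⟩ [] rfl rfl rfl rfl).symm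
        refine (dSum_dId_right (toUnit _) _).symm.trans ?_
        exact congrArg (fun t => lift _ t ≫ dSum T T' 0 0) (Category.comp_id _).symm
    · refine eMk_congr ?_ _ _ ?_
      · refine congrArg (fun t => [t]) (Sigma.ext rfl (heq_of_eq ?_))
        exact (whiskerRight_fst _ _).symm
      · exact congrArg (fun t => t ≫ dId A T') (toUnit_unique _ _) |>.trans (Category.assoc _ _ _))

end Extended

/-- The extended operad of an operad. -/
def extendedOperad {V : Type v} [Category.{u} V] [CartesianMonoidalCategory V] [MonoidalClosed V]
    [HasColimits V] [HasLimits V] (A : OperadData V) [A.IsOperad] (Δ : SimplexCategory ⥤ V) :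
    OperadData V where
  obj := extObj (tildeE A Δ)
  one := extOne (tildeE A Δ)
  comp := extComp (tildeE A Δ)

section EnrichedTarget

variable {V : Type v} [Category.{u} V] [CartesianMonoidalCategory V]
  {E : Type w} [Category.{u} E] [EnrichedOrdinaryCategory V E]

/-! ### Tensors, cotensors and weighted limits -/

/-- Composition of generalized elements of the objects of morphisms of an enriched category. -/
def ecomp {Z : V} {X Y W : E} (f : Z ⟶ (X ⟶[V] Y)) (g : Z ⟶ (Y ⟶[V] W)) : Z ⟶ (X ⟶[V] W) :=
  lift f g ≫ eComp V X Y W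

variable {Z Z' : V} {X Y W T : E}

lemma comp_ecomp (h : Z' ⟶ Z) (f : Z ⟶ (X ⟶[V] Y)) (g : Z ⟶ (Y ⟶[V] W)) :
    h ≫ ecomp f g = ecomp (h ≫ f) (h ≫ g) := by
  simp [ecomp, comp_lift_assoc]

lemma ecomp_assoc (f : Z ⟶ (X ⟶[V] Y)) (g : Z ⟶ (Y ⟶[V] W)) (h : Z ⟶ (W ⟶[V] T)) :
    ecomp (ecomp f g) h = ecomp f (ecomp g h) := by
  have : lift f (lift g h) ≫ (α_ _ _ _).inv ≫ eComp V X Y W ▷ _ ≫ eComp V X W T =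
      lift f (lift g h) ≫ _ ◁ eComp V Y W T ≫ eComp V X Y T :=
    congrArg (fun t => lift f (lift g h) ≫ t) (e_assoc V X Y W T)
  rwa [lift_lift_associator_inv_assoc, lift_whiskerRight_assoc, lift_whiskerLeft_assoc] at this

lemma comp_eHomWhiskerRight (f : X ⟶ Y) (g : Z ⟶ (Y ⟶[V] W)) (u : Z ⟶ 𝟙_ V) :
    g ≫ eHomWhiskerRight V f W = ecomp (u ≫ eHomEquiv V f) g := by
  have e : g ≫ (λ_ _).inv ≫ eHomEquiv V f ▷ _ = lift (u ≫ eHomEquiv V f) g := by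
    ext <;> simp [toUnit_unique u (g ≫ toUnit _)]
  rw [eHomWhiskerRight, reassoc_of% e]
  rfl

lemma comp_eHomWhiskerLeft (f : Z ⟶ (X ⟶[V] Y)) (g : Y ⟶ W) (u : Z ⟶ 𝟙_ V) :
    f ≫ eHomWhiskerLeft V X g = ecomp f (u ≫ eHomEquiv V g) := by
  have e : f ≫ (ρ_ _).inv ≫ _ ◁ eHomEquiv V g = lift f (u ≫ eHomEquiv V g) := by
    ext <;> simp [toUnit_unique u (f ≫ toUnit _)]
  rw [eHomWhiskerLeft, reassoc_of% e]
  rfl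

/-- `P`, with the evaluation `ev`, is a cotensor (power) `F ^ K`. -/
def IsCotensor (K : V) (F P : E) (ev : K ⟶ (P ⟶[V] F)) : Prop :=
  ∀ (Z : V) (G : E) (h : K ⊗ Z ⟶ (G ⟶[V] F)), ∃! k : Z ⟶ (G ⟶[V] P),
    ecomp (snd _ _ ≫ k) (fst _ _ ≫ ev) = h

/-- `P`, with the coevaluation `co`, is a tensor (copower) `F ⊗ K`. -/
def IsTensor (K : V) (F P : E) (co : K ⟶ (F ⟶[V] P)) : Prop :=
  ∀ (Z : V) (G : E) (h : K ⊗ Z ⟶ (F ⟶[V] G)), ∃! k : Z ⟶ (P ⟶[V] G),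
    ecomp (fst _ _ ≫ co) (snd _ _ ≫ k) = h

variable (V E) in
/-- An enriched category is tensored and cotensored. -/
class TensoredCotensored : Prop where
  exists_tensor (K : V) (F : E) : ∃ (P : E) (co : K ⟶ (F ⟶[V] P)), IsTensor K F P co
  exists_cotensor (K : V) (F : E) : ∃ (P : E) (ev : K ⟶ (P ⟶[V] F)), IsCotensor K F P ev

lemma IsCotensor.existsUnique {K : V} {F P : E} {ev : K ⟶ (P ⟶[V] F)} (hP : IsCotensor K F P ev)
    {G : E} (h : K ⟶ (G ⟶[V] F)) : ∃! k : G ⟶ P, ev ≫ eHomWhiskerRight V k F = h := by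
  obtain ⟨k, hk, hu⟩ := hP (𝟙_ V) G (fst _ _ ≫ h)
  have key (l : G ⟶ P) : ecomp (snd K (𝟙_ V) ≫ eHomEquiv V l) (fst _ _ ≫ ev) =
      fst _ _ ≫ ev ≫ eHomWhiskerRight V l F := by
    rw [← Category.assoc, comp_eHomWhiskerRight _ _ (snd _ _)]
  refine ⟨(eHomEquiv V).symm k, ?_, fun l hl => ?_⟩
  · have := key ((eHomEquiv V).symm k)
    rw [Equiv.apply_symm_apply, hk] at this
    have h' := congrArg (fun t => lift (𝟙 K) (toUnit K) ≫ t) this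
    simpa using h'.symm
  · rw [Equiv.eq_symm_apply]
    apply hu
    rw [← hl]
    exact key l

lemma IsTensor.existsUnique {K : V} {F P : E} {co : K ⟶ (F ⟶[V] P)} (hP : IsTensor K F P co)
    {G : E} (h : K ⟶ (F ⟶[V] G)) : ∃! k : P ⟶ G, co ≫ eHomWhiskerLeft V F k = h := by
  obtain ⟨k, hk, hu⟩ := hP (𝟙_ V) G (fst _ _ ≫ h)
  have key (l : P ⟶ G) : ecomp (fst K (𝟙_ V) ≫ co) (snd _ _ ≫ eHomEquiv V l) =
      fst _ _ ≫ co ≫ eHomWhiskerLeft V F l := by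
    rw [← Category.assoc, comp_eHomWhiskerLeft _ _ (snd _ _)]
  refine ⟨(eHomEquiv V).symm k, ?_, fun l hl => ?_⟩
  · have := key ((eHomEquiv V).symm k)
    rw [Equiv.apply_symm_apply, hk] at this
    have h' := congrArg (fun t => lift (𝟙 K) (toUnit K) ≫ t) this
    simpa using h'.symm
  · rw [Equiv.eq_symm_apply]
    apply hu
    rw [← hl]
    exact key l

variable [MonoidalClosed V] [HasColimits V] {A : OperadData V}

variable (A E) in
/-- The data of an enriched functor from the category of operators of `A` to `E`. -/
structure Diagram where
  /-- The value at the ordered set with `n` elements. -/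
  obj : ℕ → E
  /-- The action of morphisms. -/
  map (m n : ℕ) : dHom A m n ⟶ (obj m ⟶[V] obj n)

/-- A family of maps `W(n) ⟶ map(X, R(n))` with parameters in `Z` is natural. -/
def IsCone (W : Copresheaf A) (R : Diagram E A) {X : E} {Z : V}
    (k : ∀ n, W.obj n ⊗ Z ⟶ (X ⟶[V] R.obj n)) : Prop :=
  ∀ m n, ecomp (lift (fst _ _ ≫ fst _ _) (snd _ _) ≫ k m) (fst _ _ ≫ snd _ _ ≫ R.map m n) =
    W.act m n ▷ Z ≫ k n

/-- The end `[W, R] = ∫ₙ [W(n), R(n)]` in `E`: an object that represents natural families of maps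
`W(n) ⟶ map(X, R(n))`. -/
structure WeightedLimit (W : Copresheaf A) (R : Diagram E A) where
  /-- The object `[W, R]`. -/
  pt : E
  /-- The universal family. -/
  π (n : ℕ) : W.obj n ⟶ (pt ⟶[V] R.obj n)
  π_act (m n : ℕ) : ecomp (fst _ _ ≫ π m) (snd _ _ ≫ R.map m n) = W.act m n ≫ π n
  existsUnique {X : E} {Z : V} (k : ∀ n, W.obj n ⊗ Z ⟶ (X ⟶[V] R.obj n)) : IsCone W R k →
    ∃! l : Z ⟶ (X ⟶[V] pt), ∀ n, ecomp (snd _ _ ≫ l) (fst _ _ ≫ π n) = k n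

namespace WeightedLimit

variable {W : Copresheaf A} {R : Diagram E A} [HasLimits E]

lemma exists_ordinary [TensoredCotensored V E] (W : Copresheaf A) (R : Diagram E A) :
    ∃ (L : E) (π : ∀ n, W.obj n ⟶ (L ⟶[V] R.obj n)),
      (∀ m n, ecomp (fst _ _ ≫ π m) (snd _ _ ≫ R.map m n) = W.act m n ≫ π n) ∧
      ∀ (X : E) (k : ∀ n, W.obj n ⟶ (X ⟶[V] R.obj n)),
        (∀ m n, ecomp (fst _ _ ≫ k m) (snd _ _ ≫ R.map m n) = W.act m n ≫ k n) →
        ∃! l : X ⟶ L, ∀ n, π n ≫ eHomWhiskerRight V l _ = k n := by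
  choose C ev hC using fun n => TensoredCotensored.exists_cotensor (W.obj n) (R.obj n)
  choose C' ev' hC' using fun a : ℕ × ℕ =>
    TensoredCotensored.exists_cotensor (W.obj a.1 ⊗ dHom A a.1 a.2) (R.obj a.2)
  choose f hf hfu using fun a : ℕ × ℕ =>
    (hC' a).existsUnique (ecomp (fst _ _ ≫ ev a.1) (snd _ _ ≫ R.map a.1 a.2))
  choose g hg hgu using fun a : ℕ × ℕ => (hC' a).existsUnique (W.act a.1 a.2 ≫ ev a.2)
  dsimp only at hf hg
  have hpre {X Y : E} (l : X ⟶ Y) (m n : ℕ) (k : W.obj m ⟶ (Y ⟶[V] R.obj m)) :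
      ecomp (fst _ (dHom A m n) ≫ k ≫ eHomWhiskerRight V l _) (snd _ _ ≫ R.map m n) =
      ecomp (fst _ _ ≫ k) (snd _ _ ≫ R.map m n) ≫ eHomWhiskerRight V l _ := by
    rw [← Category.assoc, comp_eHomWhiskerRight _ _ (toUnit _),
      comp_eHomWhiskerRight _ _ (toUnit _), ecomp_assoc]
  let L := equalizer (Pi.lift fun a : ℕ × ℕ => Pi.π C a.1 ≫ f a)
    (Pi.lift fun a : ℕ × ℕ => Pi.π C a.2 ≫ g a)
  let p (n : ℕ) : L ⟶ C n := equalizer.ι _ _ ≫ Pi.π C n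
  have hp (a : ℕ × ℕ) : p a.1 ≫ f a = p a.2 ≫ g a := by
    have h := congrArg (fun t => t ≫ Pi.π _ a) (equalizer.condition
      (Pi.lift fun a : ℕ × ℕ => Pi.π C a.1 ≫ f a) (Pi.lift fun a : ℕ × ℕ => Pi.π C a.2 ≫ g a))
    simp only [Category.assoc, Pi.lift_π] at h
    exact (Category.assoc _ _ _).trans (h.trans (Category.assoc _ _ _).symm)
  refine ⟨L, fun n => ev n ≫ eHomWhiskerRight V (p n) _, fun m n => ?_, fun X k hk => ?_⟩
  · rw [hpre, ← hf (m, n), Category.assoc, ← eHomWhiskerRight_comp, hp (m, n),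
      eHomWhiskerRight_comp, ← Category.assoc, hg (m, n), Category.assoc]
  · choose q hq hqu using fun n => (hC n).existsUnique (k n)
    dsimp only at hq
    have hq' (a : ℕ × ℕ) : q a.1 ≫ f a = q a.2 ≫ g a := by
      refine ((hC' a).existsUnique (W.act a.1 a.2 ≫ k a.2)).unique ?_ ?_
      · rw [eHomWhiskerRight_comp, ← Category.assoc, hf, ← hpre, hq, hk]
      · rw [eHomWhiskerRight_comp, ← Category.assoc, hg, Category.assoc, hq]
    have e : Pi.lift q ≫ (Pi.lift fun a : ℕ × ℕ => Pi.π C a.1 ≫ f a) =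
        Pi.lift q ≫ (Pi.lift fun a : ℕ × ℕ => Pi.π C a.2 ≫ g a) := by
      refine Pi.hom_ext _ _ fun a => ?_
      simp only [Category.assoc, Pi.lift_π, Pi.lift_π_assoc]
      exact hq' a
    refine ⟨equalizer.lift (Pi.lift q) e, fun n => ?_, fun l hl => ?_⟩
    · have : equalizer.lift (Pi.lift q) e ≫ p n = q n :=
        (equalizer.lift_ι_assoc _ _ _).trans (Pi.lift_π _ _)
      rw [Category.assoc, ← eHomWhiskerRight_comp, this, hq]
    · refine equalizer.hom_ext (Pi.hom_ext _ _ fun n => ?_)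
      rw [equalizer.lift_ι, Pi.lift_π, Category.assoc]
      refine hqu n _ ?_
      rw [← hl, Category.assoc, ← eHomWhiskerRight_comp]

lemma nonempty [TensoredCotensored V E] (W : Copresheaf A) (R : Diagram E A) :
    Nonempty (WeightedLimit W R) := by
  obtain ⟨L, π, hπ, hL⟩ := exists_ordinary W R
  refine ⟨L, π, hπ, fun {X Z} k hk => ?_⟩
  obtain ⟨t, co, ht⟩ := TensoredCotensored.exists_tensor (V := V) Z X
  choose k' hk' hku' using fun n => ht (W.obj n) (R.obj n) (swap _ _ ≫ k n)
  dsimp only at hk'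
  have h₁ {Y : V} (n : ℕ) (z : Y ⟶ Z) (x : Y ⟶ W.obj n) :
      ecomp (z ≫ co) (x ≫ k' n) = lift x z ≫ k n := by
    have := congrArg (fun t => lift z x ≫ t) (hk' n)
    rwa [comp_ecomp, lift_fst_assoc, lift_snd_assoc, ← Category.assoc, lift_swap] at this
  have h₂ (m n : ℕ) : ecomp (fst _ _ ≫ k' m) (snd _ _ ≫ R.map m n) = W.act m n ≫ k' n := by
    refine (ht _ _ (lift (snd _ _ ≫ W.act m n) (fst _ _) ≫ k n)).unique ?_ ?_
    · have h := congrArg (fun t => lift (snd Z (W.obj m ⊗ dHom A m n)) (fst _ _) ≫ t) (hk m n)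
      rw [lift_whiskerRight_assoc] at h
      rw [← h, comp_ecomp, comp_ecomp, ← ecomp_assoc, ← Category.assoc, h₁]
      simp [comp_lift_assoc]
    · rw [← Category.assoc, h₁]
  obtain ⟨l₀, hl₀, hlu₀⟩ := hL t k' h₂
  have h₃ {Y : V} (n : ℕ) (m : t ⟶ L) (z : Y ⟶ Z) (x : Y ⟶ W.obj n) :
      ecomp (z ≫ co ≫ eHomWhiskerLeft V X m) (x ≫ π n) =
        ecomp (z ≫ co) (x ≫ π n ≫ eHomWhiskerRight V m _) := by
    rw [← Category.assoc, comp_eHomWhiskerLeft _ _ (toUnit _), ecomp_assoc, ← Category.assoc x,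
      comp_eHomWhiskerRight _ _ (toUnit _)]
  refine ⟨co ≫ eHomWhiskerLeft V X l₀, fun n => ?_, fun l hl => ?_⟩
  · rw [h₃, hl₀, h₁]
    simp
  · obtain ⟨m, hm, -⟩ := ht.existsUnique l
    have : m = l₀ := hlu₀ m fun n => hku' n _ (by
      dsimp only
      rw [← h₃, hm, ← hl n, comp_ecomp]
      simp [swap])
    rw [← hm, this]

end WeightedLimit

end EnrichedTarget

section Monoidal

variable (V : Type v) [Category.{u} V] [CartesianMonoidalCategory V]
  (E : Type w) [Category.{u} E] [MonoidalCategory E] [EnrichedOrdinaryCategory V E]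

/-! ### Enriched monoidal categories and endomorphism operads -/

/-- A monoidal category enriched over `V` whose tensor product is an enriched functor and whose
associativity and unit isomorphisms are enriched natural transformations. -/
class EnrichedMonoidal where
  /-- The action of the tensor product on objects of morphisms. -/
  eTensor (X Y X' Y' : E) : (X ⟶[V] Y) ⊗ (X' ⟶[V] Y') ⟶ ((X ⊗ X' : E) ⟶[V] (Y ⊗ Y' : E))
  eTensor_eHomEquiv {X Y X' Y' : E} (f : X ⟶ Y) (g : X' ⟶ Y') :
    lift (eHomEquiv V f) (eHomEquiv V g) ≫ eTensor X Y X' Y' = eHomEquiv V (f ⊗ₘ g)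
  eTensor_eComp (X Y W X' Y' W' : E) :
    (eComp V X Y W ⊗ₘ eComp V X' Y' W') ≫ eTensor X W X' W' =
      lift ((fst _ _ ⊗ₘ fst _ _) ≫ eTensor X Y X' Y') ((snd _ _ ⊗ₘ snd _ _) ≫ eTensor Y W Y' W') ≫
        eComp V (X ⊗ X') (Y ⊗ Y') (W ⊗ W')
  eTensor_associator (X Y X' Y' X'' Y'' : E) :
    eTensor X Y X' Y' ▷ _ ≫ eTensor (X ⊗ X') (Y ⊗ Y') X'' Y'' ≫
        eHomWhiskerLeft V _ (α_ Y Y' Y'').hom =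
      (α_ _ _ _).hom ≫ _ ◁ eTensor X' Y' X'' Y'' ≫ eTensor X Y (X' ⊗ X'') (Y' ⊗ Y'') ≫
        eHomWhiskerRight V (α_ X X' X'').hom _
  eTensor_leftUnitor (X Y : E) :
    lift (toUnit _ ≫ eId V (𝟙_ E)) (𝟙 (X ⟶[V] Y)) ≫ eTensor (𝟙_ E) (𝟙_ E) X Y ≫
      eHomWhiskerLeft V _ (λ_ Y).hom = eHomWhiskerRight V (λ_ X).hom Y
  eTensor_rightUnitor (X Y : E) :
    lift (𝟙 (X ⟶[V] Y)) (toUnit _ ≫ eId V (𝟙_ E)) ≫ eTensor X Y (𝟙_ E) (𝟙_ E) ≫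
      eHomWhiskerLeft V _ (ρ_ Y).hom = eHomWhiskerRight V (ρ_ X).hom Y

variable {E}

/-- The tensor powers `K ⊗ (K ⊗ ⋯)`. -/
def tpow (K : E) : ℕ → E
  | 0 => 𝟙_ E
  | n + 1 => K ⊗ tpow K n

/-- The isomorphism between the tensor power of exponent `a + b` and the tensor product of the
tensor powers of exponents `a` and `b`. -/
def tpowAdd (K : E) : (a b : ℕ) → (tpow K (a + b) ≅ tpow K a ⊗ tpow K b)
  | 0, b => eqToIso (congrArg (tpow K) (Nat.zero_add b)) ≪≫ (λ_ (tpow K b)).symm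
  | a + 1, b => eqToIso (congrArg (tpow K) (Nat.succ_add a b)) ≪≫
      whiskerLeftIso K (tpowAdd K a b) ≪≫ (α_ K (tpow K a) (tpow K b)).symm

variable [EnrichedMonoidal V E]

/-- The tensor product of operations:
`map(K^k₁, K) × ⋯ × map(K^kₙ, K) ⟶ map(K^(k₁ + ⋯ + kₙ), K^n)`. -/
def tensorOps (K : E) : (ks : List ℕ) → (listProd (fun n => (tpow K n ⟶[V] K)) ks ⟶
    (tpow K ks.sum ⟶[V] tpow K ks.length))
  | [] => eId V (𝟙_ E)
  | k :: ks => _ ◁ tensorOps K ks ≫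
      EnrichedMonoidal.eTensor (tpow K k) K (tpow K ks.sum) (tpow K ks.length) ≫
      eHomWhiskerRight V (tpowAdd K k ks.sum).hom _

/-- The endomorphism operad of an object: `map(K^n, K)` in arity `n`. -/
def endOperad (K : E) : OperadData V where
  obj n := (tpow K n ⟶[V] K)
  one := eHomEquiv V (ρ_ K).hom
  comp ks := lift (snd _ _ ≫ tensorOps V K ks) (fst _ _) ≫ eComp V _ _ _

variable {V} [HasColimits V] {A : OperadData V} {K : E}

/-- The functor `R_K` (the cobar construction) associated with an algebra `K` over an operad: it
sends the ordered set with `n` elements to `K^n`, and it sends the component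
`A(k₁) × ⋯ × A(kₙ)` of the morphism object to `map(K^(k₁ + ⋯ + kₙ), K^n)` by the action of `A`
on `K` and the tensor product. -/
def cobar (σ : OperadHom A (endOperad V K)) : Diagram E A where
  obj := tpow K
  map m n := Sigma.desc fun φ : MonoMap m n => listMap σ.map φ.1 ≫ tensorOps V K φ.1 ≫
    eqToHom (by rw [φ.2.1, φ.2.2])

end Monoidal

section Completion

variable {V : Type v} [Category.{u} V] [CartesianMonoidalCategory V] [MonoidalClosed V]
  [HasLimits V] [HasColimits V] {E : Type w} [Category.{u} E] [MonoidalCategory E]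
  [EnrichedOrdinaryCategory V E] [EnrichedMonoidal V E] [TensoredCotensored V E] [HasLimits E]
  {A : OperadData V} [A.IsOperad] {K : E} (Δ : SimplexCategory ⥤ V)
  (σ : OperadHom A (endOperad V K))

/-! ### The completion and the action of the extended operad -/

/-- The end `[W, R_K]`. -/
def wlim (W : Copresheaf A) : WeightedLimit W (cobar σ) :=
  (WeightedLimit.nonempty W (cobar σ)).some

/-- The completion of an algebra over an operad: `K̂ = [ẼD, R_K]`. -/
def completion : E := (wlim σ (tildeE A Δ)).pt

/-- The object `R⁽ⁿ⁾ = [ε(n), R_K]`. -/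
def rPow (n : ℕ) : E := (wlim σ (eps (tildeE A Δ) n)).pt

/-- The projections of the completion. -/
def completionπ (T : ℕ) : (tildeE A Δ).obj T ⟶ (completion Δ σ ⟶[V] tpow K T) :=
  (wlim σ (tildeE A Δ)).π T

/-- The projections of `R⁽ⁿ⁾`. -/
def rPowπ (n T : ℕ) : epsObj (tildeE A Δ) n T ⟶ (rPow Δ σ n ⟶[V] tpow K T) :=
  (wlim σ (eps (tildeE A Δ) n)).π T

lemma isCone_precomp (n : ℕ) : IsCone (tildeE A Δ) (cobar σ)
    (fun T => extEv (tildeE A Δ) n T ≫ rPowπ Δ σ n T) := fun T T' => by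
  have h₁ := congrArg (fun t => t ≫ rPowπ Δ σ n T') (lift_act_extEv (tildeE A Δ) (n := n)
    (T := T) (T' := T') (fst _ _ ≫ fst _ _) (fst _ _ ≫ snd _ _) (snd _ (extObj _ n)))
  have h₂ : ecomp (fst _ _ ≫ rPowπ Δ σ n T) (snd _ _ ≫ (cobar σ).map T T') =
      epsAct (tildeE A Δ) n T T' ≫ rPowπ Δ σ n T' := (wlim σ (eps (tildeE A Δ) n)).π_act T T'
  have h₃ : lift (lift (fst _ _ ≫ fst _ _) (fst _ _ ≫ snd _ _) ≫ (tildeE A Δ).act T T')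
      (snd _ (extObj _ n)) = (tildeE A Δ).act T T' ▷ extObj (tildeE A Δ) n := by
    ext <;> simp
  refine Eq.trans ?_ (Eq.trans h₁.symm ?_)
  · refine Eq.trans ?_ (Eq.trans (congrArg (fun t => lift (lift (fst _ _ ≫ fst _ _) (snd _ _) ≫
      extEv (tildeE A Δ) n T) (fst _ _ ≫ snd _ _) ≫ t) h₂) (Category.assoc _ _ _).symm)
    refine Eq.trans ?_ (comp_ecomp _ _ _).symm
    refine congrArg₂ ecomp ?_ ?_
    · exact (Category.assoc _ _ _).symm.trans (lift_fst_assoc _ _ _).symm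
    · exact (Category.assoc _ _ _).symm.trans (lift_snd_assoc _ _ _).symm
  · rw [h₃]
    exact Category.assoc _ _ _

/-- The map `f ↦ f^*` from the extended operad `map(ẼD, ε(n))` to `map(R⁽ⁿ⁾, K̂)`. -/
def precomp (n : ℕ) : (extendedOperad A Δ).obj n ⟶ (rPow Δ σ n ⟶[V] completion Δ σ) :=
  ((wlim σ (tildeE A Δ)).existsUnique _ (isCone_precomp Δ σ n)).choose

/-- The tensor product of projections of the completion:
`ẼD(T₁) × ⋯ × ẼD(Tₙ) ⟶ map(K̂^n, K^(T₁ + ⋯ + Tₙ))`. -/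
def tensorπ : (L : List ℕ) → (listProd (tildeE A Δ).obj L ⟶
    (tpow (completion Δ σ) L.length ⟶[V] tpow K L.sum))
  | [] => eId V (𝟙_ E)
  | T :: L => (completionπ Δ σ T ⊗ₘ tensorπ L) ≫
      EnrichedMonoidal.eTensor (completion Δ σ) (tpow K T) (tpow (completion Δ σ) L.length)
        (tpow K L.sum) ≫ eHomWhiskerLeft V _ (tpowAdd K T L.sum).inv

/-- The canonical maps `βₙ : K̂^n ⟶ R⁽ⁿ⁾`: the component of `βₙ` at a class `[e₁, …, eₙ; id]` is
the tensor product of the projections `eᵢ : K̂ ⟶ K^Tᵢ`. As all elements of `ε(n)` arise from these by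
the action of the category of operators, this determines `βₙ`. -/
def IsBeta (β : ∀ n, tpow (completion Δ σ) n ⟶ rPow Δ σ n) : Prop :=
  ∀ L : List ℕ, lift (𝟙 _) (toUnit _ ≫ dId A L.sum) ≫
    epsι (tildeE A Δ) L.length L.sum ⟨L, rfl⟩ ≫ rPowπ Δ σ L.length L.sum ≫
      eHomWhiskerRight V (β L.length) _ = tensorπ Δ σ L

end Completion

section Spaces

/-- The objects of a full subcategory of the category of topological spaces include all
CW-complexes, in particular the standard simplices. -/
class HasCWComplexes (P : ObjectProperty TopCat.{u}) : Prop where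
  of_cwComplex (X : TopCat.{u}) : Nonempty (TopCat.CWComplex X) → P X
  of_simplex (n : SimplexCategory) : P (SimplexCategory.toTop.{u}.obj n)

/-- The standard simplices as objects of a full subcategory of the category of topological
spaces. -/
def simplices (P : ObjectProperty TopCat.{u}) [HasCWComplexes P] :
    SimplexCategory ⥤ P.FullSubcategory :=
  P.lift SimplexCategory.toTop.{u} HasCWComplexes.of_simplex

/-- An `A_∞`-operad: all its spaces are contractible CW-complexes. -/
def OperadData.IsAInfinity {P : ObjectProperty TopCat.{u}}
    [CartesianMonoidalCategory P.FullSubcategory] (A : OperadData P.FullSubcategory) : Prop :=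
  ∀ n, ContractibleSpace (A.obj n).obj ∧ Nonempty (TopCat.CWComplex (A.obj n).obj)

end Spaces

end OperadCompletion

end

open OperadCompletion

/-!
Maps `Z ⟶ map(X, Y)`, for varying `Z`, are treated as morphisms `X ⟶ Y` with parameters in `Z`:
they are composed by `ecomp` and tensored by `etens`, and constant families are given by `econst`.
In this calculus the coherence isomorphisms of the tensor product are natural, so computations look
as in an ordinary monoidal category. The isomorphisms `K^(a + b) ≅ K^a ⊗ K^b` are coherent, and so
the tensor product of a concatenation of lists of maps is the tensor product of the two tensor
products (`opTens_append`, `elTens_append`).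

The cobar construction `R` is a functor that takes ordinal sums to tensor products
(`ecomp_cobarMap`, `dId_cobarMap`, `dSum_cobarMap`). Let `F` be a functor on the category of
operators and `F(T) ⟶ map(P, K^T)` a natural family of projections; for `F = ẼD` and `P = K̂` these
are the projections of the end. For elements `e₁, …, eₙ` and a morphism `θ` the composite of
`π_e₁ ⊗ ⋯ ⊗ π_eₙ` and `R(θ)` depends only on the class `[e₁, …, eₙ; θ]`, because the tensor product
of the projections is natural in all arguments (`elTens_actElt`). This gives the canonical family
`epsBeta : ε(n)(T) ⟶ map(P^n, K^T)`. It is natural in `T`, and it takes the concatenation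
`ε(n) × ε(n') ⟶ ε(n + n')` to the tensor product.

A natural family is the same as a map `βₙ : K̂^n ⟶ R⁽ⁿ⁾` into the end, and by naturality the family
is determined by its values at the classes `[e₁, …, eₙ; id]`. Hence `βₙ` exists and is unique
(`existsUnique_isBeta`).

The map `K̂^n ⟶ K̂` by which `f : ẼD ⟶ ε(n)` acts is characterized by its components: the one at `e`
is the component of the canonical family at `f(e)` (`isAction_completionAct`). The transformation
`ε(n) ⟶ ε(k₁ + ⋯ + kₙ)` induced by `g₁, …, gₙ` replaces `eᵢ` by `gᵢ(eᵢ)` and concatenates, so it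
corresponds under the canonical families to precomposition with the tensor product of the actions of
the `gᵢ` (`extMap_epsBeta`). Comparing components, compositions go to compositions
(`extComp_action`); the unit is `e ↦ [e; id]`, whose component is `π_e` (`extOne_action`).
-/

noncomputable section

namespace OperadCompletion

section StageCalculus

variable {V : Type v} [Category.{u} V] [CartesianMonoidalCategory V]
  {E : Type w} [Category.{u} E] [EnrichedOrdinaryCategory V E]
  {Z Z' : V} {X Y W T : E}

/-! ### Generalized elements of the objects of morphisms -/

/-- A morphism of `E` as a constant element at stage `Z` of the object of morphisms. -/
def econst (Z : V) (f : X ⟶ Y) : Z ⟶ (X ⟶[V] Y) := toUnit Z ≫ eHomEquiv V f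

@[simp] lemma comp_econst (h : Z' ⟶ Z) (f : X ⟶ Y) : h ≫ econst Z f = econst Z' f := by
  rw [econst, ← Category.assoc, toUnit_unique (h ≫ toUnit Z) (toUnit Z')]
  rfl

lemma comp_eHomWhiskerRight_eq (f : X ⟶ Y) (g : Z ⟶ (Y ⟶[V] W)) :
    g ≫ eHomWhiskerRight V f W = ecomp (econst Z f) g :=
  comp_eHomWhiskerRight f g (toUnit Z)

lemma comp_eHomWhiskerLeft_eq (f : Z ⟶ (X ⟶[V] Y)) (g : Y ⟶ W) :
    f ≫ eHomWhiskerLeft V X g = ecomp f (econst Z g) :=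
  comp_eHomWhiskerLeft f g (toUnit Z)

@[simp] lemma ecomp_econst_econst (f : X ⟶ Y) (g : Y ⟶ W) :
    ecomp (econst Z f) (econst Z g) = econst Z (f ≫ g) := by
  have e : lift (toUnit Z ≫ eHomEquiv V f) (toUnit Z ≫ eHomEquiv V g) =
      toUnit Z ≫ (λ_ (𝟙_ V)).inv ≫ (eHomEquiv V f ⊗ₘ eHomEquiv V g) := by
    ext <;> simp
  rw [econst, econst, econst, ecomp, e, eHomEquiv_comp]
  simp only [Category.assoc]

@[simp] lemma econst_id_ecomp (f : Z ⟶ (X ⟶[V] Y)) : ecomp (econst Z (𝟙 X)) f = f := by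
  rw [← comp_eHomWhiskerRight_eq, eHomWhiskerRight_id, Category.comp_id]

@[simp] lemma ecomp_econst_id (f : Z ⟶ (X ⟶[V] Y)) : ecomp f (econst Z (𝟙 Y)) = f := by
  rw [← comp_eHomWhiskerLeft_eq, eHomWhiskerLeft_id, Category.comp_id]

@[simp] lemma econst_ecomp_ecomp (f : X ⟶ Y) (g : Y ⟶ W) (h : Z ⟶ (W ⟶[V] T)) :
    ecomp (econst Z f) (ecomp (econst Z g) h) = ecomp (econst Z (f ≫ g)) h := by
  rw [← ecomp_assoc, ecomp_econst_econst]

variable [MonoidalCategory E] [EnrichedMonoidal V E] {X' Y' W' X'' Y'' : E}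

/-- The tensor product of generalized elements of the objects of morphisms. -/
def etens (f : Z ⟶ (X ⟶[V] Y)) (g : Z ⟶ (X' ⟶[V] Y')) :
    Z ⟶ ((X ⊗ X' : E) ⟶[V] (Y ⊗ Y' : E)) :=
  lift f g ≫ EnrichedMonoidal.eTensor X Y X' Y'

lemma comp_etens (h : Z' ⟶ Z) (f : Z ⟶ (X ⟶[V] Y)) (g : Z ⟶ (X' ⟶[V] Y')) :
    h ≫ etens f g = etens (h ≫ f) (h ≫ g) := by
  simp [etens, comp_lift_assoc]

lemma etens_econst_econst (f : X ⟶ Y) (g : X' ⟶ Y') :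
    etens (econst Z f) (econst Z g) = econst Z (f ⊗ₘ g) := by
  rw [etens, econst, econst, econst, ← EnrichedMonoidal.eTensor_eHomEquiv, comp_lift_assoc]

lemma etens_ecomp_ecomp (f : Z ⟶ (X ⟶[V] Y)) (g : Z ⟶ (Y ⟶[V] W)) (f' : Z ⟶ (X' ⟶[V] Y'))
    (g' : Z ⟶ (Y' ⟶[V] W')) :
    etens (ecomp f g) (ecomp f' g') = ecomp (etens f f') (etens g g') := by
  have h := congrArg (fun t => lift (lift f g) (lift f' g') ≫ t)
    (EnrichedMonoidal.eTensor_eComp (V := V) X Y W X' Y' W')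
  simpa [etens, ecomp, comp_lift_assoc] using h

lemma etens_associator (f : Z ⟶ (X ⟶[V] Y)) (f' : Z ⟶ (X' ⟶[V] Y')) (f'' : Z ⟶ (X'' ⟶[V] Y'')) :
    ecomp (etens (etens f f') f'') (econst Z (α_ Y Y' Y'').hom) =
      ecomp (econst Z (α_ X X' X'').hom) (etens f (etens f' f'')) := by
  have h := congrArg (fun t => lift (lift f f') f'' ≫ t)
    (EnrichedMonoidal.eTensor_associator (V := V) X Y X' Y' X'' Y'')
  rw [← comp_eHomWhiskerRight_eq, ← comp_eHomWhiskerLeft_eq]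
  simpa [etens, lift_lift_associator_hom_assoc] using h

lemma etens_leftUnitor (f : Z ⟶ (X ⟶[V] Y)) :
    ecomp (etens (econst Z (𝟙 (𝟙_ E))) f) (econst Z (λ_ Y).hom) =
      ecomp (econst Z (λ_ X).hom) f := by
  have h := congrArg (fun t => f ≫ t) (EnrichedMonoidal.eTensor_leftUnitor (V := V) X Y)
  rw [← comp_eHomWhiskerRight_eq, ← comp_eHomWhiskerLeft_eq, ← h, etens, econst, eHomEquiv_id,
    comp_lift_assoc, ← Category.assoc f, toUnit_unique (f ≫ toUnit _) (toUnit Z)]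
  simp

lemma etens_rightUnitor (f : Z ⟶ (X ⟶[V] Y)) :
    ecomp (etens f (econst Z (𝟙 (𝟙_ E)))) (econst Z (ρ_ Y).hom) =
      ecomp (econst Z (ρ_ X).hom) f := by
  have h := congrArg (fun t => f ≫ t) (EnrichedMonoidal.eTensor_rightUnitor (V := V) X Y)
  rw [← comp_eHomWhiskerRight_eq, ← comp_eHomWhiskerLeft_eq, ← h, etens, econst, eHomEquiv_id,
    comp_lift_assoc, ← Category.assoc f, toUnit_unique (f ≫ toUnit _) (toUnit Z)]
  simp

lemma econst_tensorHom_ecomp_etens (a : X ⟶ Y) (b : X' ⟶ Y') (f : Z ⟶ (Y ⟶[V] W))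
    (g : Z ⟶ (Y' ⟶[V] W')) : ecomp (econst Z (a ⊗ₘ b)) (etens f g) =
      etens (ecomp (econst Z a) f) (ecomp (econst Z b) g) := by
  rw [etens_ecomp_ecomp, etens_econst_econst]

lemma etens_ecomp_econst_tensorHom (f : Z ⟶ (X ⟶[V] Y)) (g : Z ⟶ (X' ⟶[V] Y')) (a : Y ⟶ W)
    (b : Y' ⟶ W') : ecomp (etens f g) (econst Z (a ⊗ₘ b)) =
      etens (ecomp f (econst Z a)) (ecomp g (econst Z b)) := by
  rw [etens_ecomp_ecomp, etens_econst_econst]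

lemma econst_whiskerRight_ecomp_etens (a : X ⟶ Y) (f : Z ⟶ (Y ⟶[V] W)) (g : Z ⟶ (X' ⟶[V] W')) :
    ecomp (econst Z (a ▷ X')) (etens f g) = etens (ecomp (econst Z a) f) g := by
  rw [← tensorHom_id, econst_tensorHom_ecomp_etens, econst_id_ecomp]

lemma econst_whiskerLeft_ecomp_etens (b : X' ⟶ Y') (f : Z ⟶ (X ⟶[V] W)) (g : Z ⟶ (Y' ⟶[V] W')) :
    ecomp (econst Z (X ◁ b)) (etens f g) = etens f (ecomp (econst Z b) g) := by
  rw [← id_tensorHom, econst_tensorHom_ecomp_etens, econst_id_ecomp]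

lemma etens_ecomp_econst_whiskerRight (f : Z ⟶ (X ⟶[V] Y)) (g : Z ⟶ (X' ⟶[V] Y')) (a : Y ⟶ W) :
    ecomp (etens f g) (econst Z (a ▷ Y')) = etens (ecomp f (econst Z a)) g := by
  rw [← tensorHom_id, etens_ecomp_econst_tensorHom, ecomp_econst_id]

lemma etens_ecomp_econst_whiskerLeft (f : Z ⟶ (X ⟶[V] Y)) (g : Z ⟶ (X' ⟶[V] Y')) (b : Y' ⟶ W) :
    ecomp (etens f g) (econst Z (Y ◁ b)) = etens f (ecomp g (econst Z b)) := by
  rw [← id_tensorHom, etens_ecomp_econst_tensorHom, ecomp_econst_id]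

lemma etens_associator_inv (f : Z ⟶ (X ⟶[V] Y)) (f' : Z ⟶ (X' ⟶[V] Y'))
    (f'' : Z ⟶ (X'' ⟶[V] Y'')) : ecomp (etens f (etens f' f'')) (econst Z (α_ Y Y' Y'').inv) =
      ecomp (econst Z (α_ X X' X'').inv) (etens (etens f f') f'') := by
  have h := congrArg (fun t => ecomp (econst Z (α_ X X' X'').inv)
    (ecomp t (econst Z (α_ Y Y' Y'').inv))) (etens_associator f f' f'')
  simpa [ecomp_assoc] using h.symm

lemma etens_leftUnitor_inv (f : Z ⟶ (X ⟶[V] Y)) :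
    ecomp (econst Z (λ_ X).inv) (etens (econst Z (𝟙 (𝟙_ E))) f) =
      ecomp f (econst Z (λ_ Y).inv) := by
  have h := congrArg (fun t => ecomp (econst Z (λ_ X).inv)
    (ecomp t (econst Z (λ_ Y).inv))) (etens_leftUnitor f)
  simpa [ecomp_assoc] using h

lemma etens_ecomp_econst_whiskerLeft_ecomp (f : Z ⟶ (X ⟶[V] Y)) (g : Z ⟶ (X' ⟶[V] Y'))
    (b : Y' ⟶ W) (k : Z ⟶ ((Y ⊗ W : E) ⟶[V] T)) :
    ecomp (etens f g) (ecomp (econst Z (Y ◁ b)) k) =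
      ecomp (etens f (ecomp g (econst Z b))) k := by
  rw [← ecomp_assoc, etens_ecomp_econst_whiskerLeft]

lemma etens_associator_inv_ecomp (f : Z ⟶ (X ⟶[V] Y)) (f' : Z ⟶ (X' ⟶[V] Y'))
    (f'' : Z ⟶ (X'' ⟶[V] Y'')) (k : Z ⟶ (((Y ⊗ Y') ⊗ Y'' : E) ⟶[V] T)) :
    ecomp (etens f (etens f' f'')) (ecomp (econst Z (α_ Y Y' Y'').inv) k) =
      ecomp (econst Z (α_ X X' X'').inv) (ecomp (etens (etens f f') f'') k) := by
  rw [← ecomp_assoc, etens_associator_inv, ecomp_assoc]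

end StageCalculus

section TensorPowers

variable {E : Type w} [Category.{u} E] [MonoidalCategory E] (K : E)

/-! ### Coherence of tensor powers -/

/-- Transport of tensor powers along equalities of exponents. -/
def tcast {m n : ℕ} (h : m = n) : tpow K m ⟶ tpow K n := eqToHom (congrArg (tpow K) h)

@[simp] lemma tcast_rfl {m : ℕ} (h : m = m) : tcast K h = 𝟙 _ := rfl

@[simp] lemma tcast_tcast {m n p : ℕ} (h : m = n) (h' : n = p) :
    tcast K h ≫ tcast K h' = tcast K (h.trans h') := by
  subst h h'; simp

@[simp] lemma tcast_tcast_assoc {m n p : ℕ} (h : m = n) (h' : n = p) {X : E} (t : tpow K p ⟶ X) :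
    tcast K h ≫ tcast K h' ≫ t = tcast K (h.trans h') ≫ t := by
  subst h h'; simp

/-- The tensor power of exponent zero is the unit. The two objects agree by definition; the
isomorphism keeps terms well-typed without unfolding `tpow`. -/
def tpowZero : tpow K 0 ≅ 𝟙_ E := Iso.refl _

/-- The recursion for tensor powers. As for `tpowZero`, the two objects agree by definition. -/
def tpowSucc (n : ℕ) : tpow K (n + 1) ≅ K ⊗ tpow K n := Iso.refl _

lemma tcast_tpowSucc {m n : ℕ} (h : m = n) (h' : m + 1 = n + 1) :
    tcast K h' ≫ (tpowSucc K n).hom = (tpowSucc K m).hom ≫ K ◁ tcast K h := by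
  subst h; simp

lemma tcast_tpowAdd {a a' b b' : ℕ} (h : a = a') (h' : b = b') (h'' : a + b = a' + b') :
    tcast K h'' ≫ (tpowAdd K a' b').hom = (tpowAdd K a b).hom ≫ (tcast K h ⊗ₘ tcast K h') := by
  subst h h'; simp

lemma tpowAdd_zero_left (b : ℕ) : (tpowAdd K 0 b).hom =
    tcast K (Nat.zero_add b) ≫ (λ_ (tpow K b)).inv ≫ (tpowZero K).inv ▷ tpow K b := by
  have : (λ_ (tpow K b)).inv ≫ 𝟙 (𝟙_ E) ▷ tpow K b = (λ_ (tpow K b)).inv := by simp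
  exact (congrArg (fun t => tcast K (Nat.zero_add b) ≫ t) this).symm

lemma tpowAdd_succ (a b : ℕ) : (tpowAdd K (a + 1) b).hom =
    tcast K (Nat.add_right_comm a 1 b) ≫ (tpowSucc K (a + b)).hom ≫ K ◁ (tpowAdd K a b).hom ≫
      (α_ K (tpow K a) (tpow K b)).inv ≫ (tpowSucc K a).inv ▷ tpow K b := by
  have : 𝟙 _ ≫ K ◁ (tpowAdd K a b).hom ≫ (α_ K (tpow K a) (tpow K b)).inv ≫
      𝟙 (K ⊗ tpow K a) ▷ tpow K b =
      K ◁ (tpowAdd K a b).hom ≫ (α_ K (tpow K a) (tpow K b)).inv := by simp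
  exact (congrArg (fun t => tcast K (Nat.add_right_comm a 1 b) ≫ t) this).symm

lemma tpowAdd_zero_right (a : ℕ) :
    (tpowAdd K a 0).hom = (ρ_ (tpow K a)).inv ≫ tpow K a ◁ (tpowZero K).inv := by
  induction a with
  | zero =>
    rw [tpowAdd_zero_left, tcast_rfl, Category.id_comp, ← cancel_mono ((tpowZero K).hom ▷ _),
      ← cancel_mono (𝟙_ E ◁ (tpowZero K).hom)]
    simp only [Category.assoc, inv_hom_whiskerRight, Category.comp_id, whisker_exchange]
    rw [← leftUnitor_inv_naturality, ← rightUnitor_inv_naturality_assoc, unitors_inv_equal]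
    simp
  | succ a ih =>
    rw [tpowAdd_succ, ih, tcast_rfl, Category.id_comp, ← cancel_mono ((tpowSucc K a).hom ▷ _)]
    simp [whisker_exchange]

/-- The first tensor power is `K`. -/
def tpowOne : tpow K 1 ≅ K :=
  tpowSucc K 0 ≪≫ whiskerLeftIso K (tpowZero K) ≪≫ ρ_ K

lemma tpowAdd_one_left (n : ℕ) : (tpowAdd K 1 n).hom ≫ (tpowOne K).hom ▷ tpow K n =
    tcast K (Nat.add_comm 1 n) ≫ (tpowSucc K n).hom := by
  have h : (tpowAdd K 1 n).hom = tcast K (by omega) ≫ (tpowSucc K (0 + n)).hom ≫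
      K ◁ (tpowAdd K 0 n).hom ≫ (α_ K (tpow K 0) (tpow K n)).inv ≫ (tpowSucc K 0).inv ▷ tpow K n :=
    tpowAdd_succ K 0 n
  have hs := tcast_tpowSucc K (Nat.zero_add n) (by omega)
  rw [h, tpowAdd_zero_left]
  simp only [MonoidalCategory.whiskerLeft_comp, Category.assoc, ← reassoc_of% hs, tpowOne,
    tcast_tcast_assoc]
  simp

/-- The splittings of tensor powers are associative. -/
lemma tpowAdd_assoc (a b c : ℕ) :
    (tpowAdd K (a + b) c).hom ≫ (tpowAdd K a b).hom ▷ tpow K c ≫ (α_ _ _ _).hom =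
      tcast K (Nat.add_assoc a b c) ≫ (tpowAdd K a (b + c)).hom ≫
        tpow K a ◁ (tpowAdd K b c).hom := by
  induction a with
  | zero =>
    -- Both sides reduce to the naturality of the left unitor with respect to `tpowAdd K b c`.
    have h := tcast_tpowAdd K (Nat.zero_add b) (rfl : c = c) (by rw [Nat.zero_add])
    rw [tcast_rfl, tensorHom_id] at h
    rw [tpowAdd_zero_left, tpowAdd_zero_left]
    simp only [comp_whiskerRight, Category.assoc]
    rw [← reassoc_of% h, ← whisker_exchange, ← leftUnitor_inv_naturality_assoc]
    simp
  | succ a ih =>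
    have h : tcast K _ ≫ (tpowAdd K (a + b + 1) c).hom = _ :=
      tcast_tpowAdd K (Nat.add_right_comm a 1 b) (rfl : c = c) (by omega)
    rw [tcast_rfl, tensorHom_id] at h
    have hs := tcast_tpowSucc K (Nat.add_assoc a b c) (by omega)
    -- The pentagon, in the form in which the induction hypothesis can be inserted.
    have h₁ : (K ◁ (tpowAdd K a b).hom) ▷ tpow K c ≫ (α_ K (tpow K a) (tpow K b)).inv ▷ _ =
        (α_ _ _ _).hom ≫ K ◁ ((tpowAdd K a b).hom ▷ tpow K c ≫ (α_ _ _ _).hom) ≫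
          (α_ _ _ _).inv ≫ (α_ _ _ _).inv := by
      simp
    rw [tpowAdd_succ, tpowAdd_succ K a (b + c)]
    simp only [comp_whiskerRight, Category.assoc]
    rw [← reassoc_of% h, reassoc_of% h₁, tpowAdd_succ K (a + b) c]
    simp only [Category.assoc, inv_hom_whiskerRight_assoc, Iso.inv_hom_id_assoc]
    rw [← MonoidalCategory.whiskerLeft_comp_assoc, ih]
    simp only [MonoidalCategory.whiskerLeft_comp, Category.assoc, ← reassoc_of% hs,
      tcast_tcast_assoc, ← whisker_exchange]
    simp

end TensorPowers

section TensorsOfOperations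

variable {V : Type v} [Category.{u} V] [CartesianMonoidalCategory V]
  {E : Type w} [Category.{u} E] [MonoidalCategory E] [EnrichedOrdinaryCategory V E]
  [EnrichedMonoidal V E] [MonoidalClosed V] [HasColimits V] {K : E} {O : ℕ → V}
  (ρ : ∀ n, O n ⟶ (tpow K n ⟶[V] K))
  {Z Z' : V} {m n m' n' k s p : ℕ}

/-! ### Tensor products of operations -/

/-- The operation of arity `m` on `K` given by an element of the family `O`, whose index has to
equal `m`. -/
def opVal (x : Elt Z O) (h : x.1 = m) : Z ⟶ (tpow K m ⟶[V] K) :=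
  ecomp (econst Z (tcast K h.symm)) (x.2 ≫ ρ x.1)

@[simp] lemma opVal_rfl (x : Elt Z O) : opVal ρ x rfl = x.2 ≫ ρ x.1 := by
  rw [opVal, tcast_rfl, econst_id_ecomp]

/-- The tensor product `K^(k₁ + ⋯ + kₙ) ⟶ K^n` of a list of operations on `K`, with the exponents in
the form `total l` and `l.length`; `opTens` is the version for exponents equal to these. -/
def opTensAux : (l : List (Elt Z O)) → (Z ⟶ (tpow K (total l) ⟶[V] tpow K l.length))
  | [] => econst Z (𝟙 (tpow K 0))
  | x :: l => ecomp (econst Z (tpowAdd K x.1 (total l)).hom)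
      (ecomp (etens (x.2 ≫ ρ x.1) (opTensAux l)) (econst Z (tpowSucc K l.length).inv))

/-- The tensor product of a list of operations on `K`, with source and target transported to given
exponents. -/
def opTens (l : List (Elt Z O)) (hs : total l = m) (hl : l.length = n) :
    Z ⟶ (tpow K m ⟶[V] tpow K n) :=
  ecomp (econst Z (tcast K hs.symm)) (ecomp (opTensAux ρ l) (econst Z (tcast K hl)))

lemma opTens_congr {l l' : List (Elt Z O)} (e : l = l') (hs : total l = m) (hl : l.length = n) :
    opTens ρ l hs hl = opTens ρ l' (by rw [← e, hs]) (by rw [← e, hl]) := by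
  subst e; rfl

lemma opTens_tcast (l : List (Elt Z O)) (hs : total l = m) (hl : l.length = n) (e : m = m')
    (e' : n = n') : opTens ρ l (hs.trans e) (hl.trans e') =
      ecomp (econst Z (tcast K e.symm)) (ecomp (opTens ρ l hs hl) (econst Z (tcast K e'))) := by
  subst e e'; simp

lemma opTens_eqToHom (l : List (Elt Z O)) (hs : total l = m) (hl : l.length = n) (e : m = m')
    (e' : n = n') : opTens ρ l hs hl ≫ eqToHom (by rw [e, e']) =
      opTens ρ l (hs.trans e) (hl.trans e') := by
  subst e e'; simp

lemma opTens_rfl (l : List (Elt Z O)) : opTens ρ l rfl rfl = opTensAux ρ l :=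
  (econst_id_ecomp _).trans (ecomp_econst_id _)

lemma opTens_nil (hs : total ([] : List (Elt Z O)) = 0) (hl : ([] : List (Elt Z O)).length = 0) :
    opTens ρ [] hs hl = econst Z (𝟙 (tpow K 0)) :=
  opTens_rfl ρ []

lemma opTens_cons (x : Elt Z O) (l : List (Elt Z O)) (hk : x.1 = k) (hs : total l = s)
    (hl : l.length = p) (hs' : total (x :: l) = k + s) (hl' : (x :: l).length = p + 1) :
    opTens ρ (x :: l) hs' hl' = ecomp (econst Z (tpowAdd K k s).hom)
      (ecomp (etens (opVal ρ x hk) (opTens ρ l hs hl)) (econst Z (tpowSucc K p).inv)) := by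
  subst hk hs hl
  rw [opVal_rfl, opTens_rfl]
  exact opTens_rfl ρ (x :: l)

/-- The tensor product of a concatenation is the tensor product of the tensor products. -/
lemma opTens_append (l l' : List (Elt Z O)) (hs : total l = m) (hl : l.length = n)
    (hs' : total l' = m') (hl' : l'.length = n') (h : total (l ++ l') = m + m')
    (h' : (l ++ l').length = n + n') :
    ecomp (opTens ρ (l ++ l') h h') (econst Z (tpowAdd K n n').hom) =
      ecomp (econst Z (tpowAdd K m m').hom) (etens (opTens ρ l hs hl) (opTens ρ l' hs' hl')) := by
  induction l generalizing m n with
  | nil =>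
    obtain rfl : 0 = m := hs
    obtain rfl : 0 = n := hl
    refine (congrArg (fun t => ecomp t _) (opTens_tcast ρ l' hs' hl' (Nat.zero_add m').symm
      (Nat.zero_add n').symm)).trans (Eq.trans ?_ (congrArg (fun t => ecomp _ (etens t _))
        (opTens_nil ρ rfl rfl)).symm)
    rw [tpowAdd_zero_left, tpowAdd_zero_left]
    have e : (econst Z (𝟙 (tpow K 0)) : Z ⟶ (tpow K 0 ⟶[V] tpow K 0)) =
        ecomp (econst Z (tpowZero K).hom) (ecomp (econst Z (𝟙 (𝟙_ E)))
          (econst Z (tpowZero K).inv)) := by simp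
    rw [e, ← econst_whiskerRight_ecomp_etens, ← etens_ecomp_econst_whiskerRight]
    simp only [ecomp_assoc, ecomp_econst_econst, econst_ecomp_ecomp, Category.assoc,
      inv_hom_whiskerRight, Category.comp_id, tcast_tcast_assoc,
      tcast_rfl, Category.id_comp]
    rw [← ecomp_econst_econst (λ_ _).inv, ← ecomp_assoc (opTens ρ l' hs' hl'),
      ← etens_leftUnitor_inv, ecomp_assoc, econst_ecomp_ecomp]
  | cons x l ih =>
    obtain ⟨k, hk⟩ : ∃ k, x.1 = k := ⟨_, rfl⟩
    obtain ⟨s, hs₁⟩ : ∃ s, total l = s := ⟨_, rfl⟩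
    obtain ⟨p, hl₁⟩ : ∃ p, l.length = p := ⟨_, rfl⟩
    obtain rfl : k + s = m := by rw [← hs, ← hk, ← hs₁]; rfl
    obtain rfl : p + 1 = n := by rw [← hl, ← hl₁]; rfl
    have hs₂ : total (l ++ l') = s + m' := by rw [total_append, hs₁, hs']
    have hl₂ : (l ++ l').length = p + n' := by rw [List.length_append, hl₁, hl']
    have e := opTens_tcast ρ (x :: (l ++ l')) (m := k + (s + m')) (n := p + n' + 1)
      (by rw [← hk, ← hs₂]; rfl) (by rw [← hl₂]; rfl) (Nat.add_assoc k s m').symm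
      (Nat.add_right_comm p n' 1)
    rw [opTens_cons ρ x (l ++ l') hk hs₂ hl₂] at e
    refine (congrArg (fun t => ecomp t _) e).trans ?_
    rw [opTens_cons ρ x l hk hs₁ hl₁, tpowAdd_succ]
    have ih' := ih hs₁ hl₁ hs₂ hl₂
    -- After the first operation is split off, the coherence of `K^(k + s + m')` remains.
    have h := tpowAdd_assoc K k s m'
    simp only [← Category.assoc] at h
    rw [← Iso.eq_comp_inv] at h
    simp only [ecomp_assoc, ecomp_econst_econst, Category.assoc, tcast_tcast_assoc,
      tcast_rfl, Category.id_comp, Iso.inv_hom_id_assoc]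
    simp only [← ecomp_econst_econst, etens_ecomp_econst_whiskerLeft_ecomp, ih',
      ← econst_whiskerLeft_ecomp_etens, ecomp_assoc, etens_associator_inv_ecomp,
      etens_ecomp_econst_whiskerRight]
    simp only [← econst_whiskerRight_ecomp_etens, h, econst_ecomp_ecomp, Category.assoc]

lemma comp_tensorHom_whiskerLeft_comp (X Y : V) {X' Y' W T : V} (q : Z ⟶ X ⊗ Y) (f : X ⟶ X')
    (g : Y ⟶ Y') (h : Y' ⟶ W) (t : X' ⊗ W ⟶ T) : q ≫ (f ⊗ₘ g) ≫ X' ◁ h ≫ t =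
      lift ((q ≫ fst _ _) ≫ f) ((q ≫ snd _ _) ≫ g ≫ h) ≫ t := by
  have e : q ≫ (f ⊗ₘ g) ≫ X' ◁ h = lift ((q ≫ fst _ _) ≫ f) ((q ≫ snd _ _) ≫ g ≫ h) := by
    ext <;> simp
  rw [← e]
  simp only [Category.assoc]

/-- The tensor product of operations that defines the endomorphism operad, on elements. -/
lemma comp_listMap_tensorOps (L : List ℕ) (q : Z ⟶ listProd O L) :
    q ≫ listMap ρ L ≫ tensorOps V K L =
      opTens ρ (listElts L q) (by rw [total, map_fst_listElts]) (listElts_length L q) := by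
  induction L with
  | nil =>
    refine Eq.trans ?_ (opTens_nil ρ rfl rfl).symm
    rw [econst, eHomEquiv_id]
    refine Eq.trans (congrArg (fun t => q ≫ t) (Category.id_comp _)) ?_
    exact congrArg (fun t => t ≫ eId V (𝟙_ E)) (toUnit_unique _ _)
  | cons k L ih =>
    refine Eq.trans ?_ (opTens_cons ρ (⟨k, q ≫ fst _ _⟩ : Elt Z O) (listElts L (q ≫ snd _ _))
      (k := k) (s := L.sum) rfl (by rw [total, map_fst_listElts]) (listElts_length L _) _ _).symm
    rw [← ih, opVal_rfl]
    refine (comp_tensorHom_whiskerLeft_comp (O k) (listProd O L) q (ρ k) (listMap ρ L)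
      (tensorOps V K L) (EnrichedMonoidal.eTensor (tpow K k) K (tpow K L.sum) (tpow K L.length) ≫
        eHomWhiskerRight V (tpowAdd K k L.sum).hom _)).trans ?_
    rw [← Category.assoc, comp_eHomWhiskerRight_eq]
    exact congrArg (ecomp _) (ecomp_econst_id _).symm

end TensorsOfOperations

section Cobar

open OperadData

variable {V : Type v} [Category.{u} V] [CartesianMonoidalCategory V]
  {E : Type w} [Category.{u} E] [MonoidalCategory E] [EnrichedOrdinaryCategory V E]
  [EnrichedMonoidal V E] [MonoidalClosed V] [HasColimits V] {A : OperadData V} {K : E}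
  (σ : OperadHom A (endOperad V K)) {Z Z' : V} {m n m' n' k s p : ℕ}

/-! ### Functoriality and monoidality of the cobar construction -/

/-- The action of the operations of arity `n` on an algebra `K`: the map `σ.map n`, with the values
of the endomorphism operad spelled out in its type. -/
def OperadHom.op (n : ℕ) : A.obj n ⟶ (tpow K n ⟶[V] K) := σ.map n

lemma lift_endOperad_comp (ks : List ℕ) (f : Z ⟶ (tpow K ks.length ⟶[V] K))
    (g : Z ⟶ listProd (fun n => (tpow K n ⟶[V] K)) ks) :
    lift f g ≫ (endOperad V K).comp ks = ecomp (g ≫ tensorOps V K ks) f := by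
  have : lift f g ≫ lift (snd _ _ ≫ tensorOps V K ks) (fst _ _) ≫ eComp V _ _ _ =
      ecomp (g ≫ tensorOps V K ks) f := by
    simp [ecomp, comp_lift_assoc]
  exact this

lemma endOperad_one : (endOperad V K).one = econst (𝟙_ V) (tpowOne K).hom := by
  have h : (tpowOne K).hom = (ρ_ K).hom :=
    (by simp : 𝟙 (K ⊗ 𝟙_ E) ≫ K ◁ 𝟙 (𝟙_ E) ≫ (ρ_ K).hom = (ρ_ K).hom)
  refine (congrArg (eHomEquiv V) h).symm.trans ?_
  rw [econst, toUnit_unique (toUnit (𝟙_ V)) (𝟙 _), Category.id_comp]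

/-- The action on `K` respects composition, on elements. -/
lemma comp_op (ks : List ℕ) (f : Z ⟶ A.obj ks.length) (g : Z ⟶ listProd A.obj ks) :
    (lift f g ≫ A.comp ks) ≫ σ.op ks.sum =
      ecomp (opTens σ.op (listElts ks g) (by rw [total, map_fst_listElts]) (listElts_length ks g))
        (f ≫ σ.op ks.length) := by
  rw [← comp_listMap_tensorOps, Category.assoc]
  refine (congrArg (fun t => lift f g ≫ t) (σ.map_comp ks)).trans ?_
  rw [lift_map_assoc]
  refine (lift_endOperad_comp ks _ _).trans ?_
  exact congrArg (fun t => ecomp t _) (Category.assoc _ _ _)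

lemma opVal_congr {O : ℕ → V} (ρ : ∀ n, O n ⟶ (tpow K n ⟶[V] K)) {x y : Elt Z O} (e : x = y)
    (h : x.1 = m) : opVal ρ x h = opVal ρ y (by rw [← e, h]) := by
  subst e; rfl

/-- The action on `K` turns composites of operations into composites of maps. -/
lemma opVal_gamma (f : A.Op Z) (gs : List (A.Op Z)) (h : f.1 = k) (hs : arity gs = m)
    (hl : gs.length = k) (h' : (gamma f gs).1 = m) :
    opVal σ.op (gamma f gs) h' = ecomp (opTens σ.op gs hs hl) (opVal σ.op f h) := by
  obtain ⟨k', f⟩ := f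
  obtain rfl : k' = k := h
  obtain rfl : arity gs = m := hs
  have h₀ : k' = (gs.map Sigma.fst).length := by rw [List.length_map, hl]
  subst h₀
  have e : gamma ⟨_, f⟩ gs = ⟨arity gs, lift f (listMk gs) ≫ A.comp (gs.map Sigma.fst)⟩ := by
    rw [gamma, dif_pos hl.symm]
    simp
  rw [opVal_congr _ e, opVal_rfl, opVal_rfl]
  refine (comp_op σ _ f (listMk gs)).trans ?_
  rw [opTens_congr _ (listElts_listMk gs)]

/-- The tensor products of operations respect composition in the category of operators. -/
lemma opTens_blocks (b a : List (A.Op Z)) (hm : arity a = m) (hn : a.length = n)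
    (hn' : arity b = n) (hp : b.length = p) (h : arity (blocks b a) = m)
    (h' : (blocks b a).length = p) : opTens σ.op (blocks b a) h h' =
      ecomp (opTens σ.op a hm hn) (opTens σ.op b hn' hp) := by
  induction b generalizing a m n p with
  | nil =>
    obtain rfl : 0 = n := hn'
    obtain rfl : a = [] := List.eq_nil_of_length_eq_zero hn
    obtain rfl : 0 = m := hm
    obtain rfl : 0 = p := hp
    refine (opTens_nil _ _ _).trans (Eq.trans ?_
      (congrArg₂ ecomp (opTens_nil _ _ _) (opTens_nil _ _ _)).symm)
    simp
  | cons x b ih =>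
    obtain ⟨k, hk⟩ : ∃ k, x.1 = k := ⟨_, rfl⟩
    obtain ⟨s, hs⟩ : ∃ s, arity b = s := ⟨_, rfl⟩
    obtain ⟨q, hq⟩ : ∃ q, b.length = q := ⟨_, rfl⟩
    obtain rfl : k + s = n := by rw [← hn', ← hk, ← hs]; rfl
    obtain rfl : q + 1 = p := by rw [← hp, ← hq]; rfl
    -- The first block consists of the first `k` operations, where `k` is the arity of `x`.
    obtain ⟨a₁, a₂, rfl, ha⟩ : ∃ a₁ a₂, a = a₁ ++ a₂ ∧ a₁.length = k :=
      ⟨a.take k, a.drop k, by simp, by simp; omega⟩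
    obtain ⟨m₁, hm₁⟩ : ∃ m₁, arity a₁ = m₁ := ⟨_, rfl⟩
    obtain ⟨m₂, hm₂⟩ : ∃ m₂, arity a₂ = m₂ := ⟨_, rfl⟩
    obtain rfl : m₁ + m₂ = m := by rw [← hm, ← hm₁, ← hm₂, arity_append]
    have ha₂ : a₂.length = s := by rw [List.length_append] at hn; omega
    have e : blocks (x :: b) (a₁ ++ a₂) = gamma x a₁ :: blocks b a₂ := by
      rw [blocks, hk, ← ha, List.take_left, List.drop_left]
    have hg : (gamma x a₁).1 = m₁ := by rw [gamma_fst (hk.trans ha.symm), hm₁]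
    have hb : arity (blocks b a₂) = m₂ := by rw [arity_blocks b a₂ (hs.trans ha₂.symm), hm₂]
    have hb' : (blocks b a₂).length = q := by rw [length_blocks, hq]
    rw [opTens_congr _ e, opTens_cons _ _ _ hg hb hb', opVal_gamma σ x a₁ hk hm₁ ha hg,
      ih a₂ hm₂ ha₂ hs hq hb hb', opTens_cons _ x b hk hs hq, etens_ecomp_ecomp, ecomp_assoc,
      ← ecomp_assoc (opTens _ _ _ _), opTens_append _ a₁ a₂ hm₁ ha hm₂ ha₂, ecomp_assoc]

/-- The value of the cobar construction on morphisms, with its values on objects spelled out in the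
type. -/
def cobarMap (m n : ℕ) : dHom A m n ⟶ (tpow K m ⟶[V] tpow K n) := (cobar σ).map m n

lemma dIn_cobarMap (l : List (A.Op Z)) (hm : arity l = m) (hn : l.length = n) :
    dIn l hm hn ≫ cobarMap σ m n = opTens σ.op l hm hn := by
  subst hm hn
  have h : dι ⟨l.map Sigma.fst, rfl, List.length_map _⟩ ≫ cobarMap σ (arity l) l.length =
      listMap σ.op _ ≫ tensorOps V K _ ≫ eqToHom (by simp) := Sigma.ι_desc _ _
  rw [dIn, Category.assoc, h, ← Category.assoc (listMap _ _), ← Category.assoc,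
    comp_listMap_tensorOps, opTens_congr _ (listElts_listMk l)]
  exact opTens_eqToHom _ _ _ _ rfl (List.length_map _)

variable [A.IsOperad]

/-- The cobar construction respects composition. -/
lemma ecomp_cobarMap (f : Z ⟶ dHom A m n) (g : Z ⟶ dHom A n p) :
    ecomp (f ≫ cobarMap σ m n) (g ≫ cobarMap σ n p) =
      (lift f g ≫ dComp m n p) ≫ cobarMap σ m p := by
  have : (cobarMap σ m n ⊗ₘ cobarMap σ n p) ≫ eComp V _ _ _ = dComp m n p ≫ cobarMap σ m p :=
    dGen₂ fun Z a b h₁ h₂ h₃ h₄ => by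
      rw [← Category.assoc (lift _ _) (dComp m n p), lift_dIn_dComp, dIn_cobarMap,
        opTens_blocks σ b a h₁ h₂ h₃ h₄, lift_map_assoc, dIn_cobarMap, dIn_cobarMap]
      rfl
  have h := congrArg (fun t => lift f g ≫ t) this
  rw [lift_map_assoc] at h
  rw [Category.assoc]
  exact h

lemma opVal_unit (h : (unit A Z).1 = 1) :
    opVal σ.op (unit A Z) h = econst Z (tpowOne K).hom := by
  refine (opVal_rfl σ.op (unit A Z)).trans ?_
  refine (Category.assoc _ _ _).trans
    ((congrArg (fun t => toUnit Z ≫ t) (σ.map_one.trans endOperad_one)).trans ?_)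
  exact comp_econst _ _

lemma opTens_replicate_unit (n : ℕ) (h : arity (List.replicate n (unit A Z)) = n)
    (h' : (List.replicate n (unit A Z)).length = n) :
    opTens σ.op (List.replicate n (unit A Z)) h h' = econst Z (𝟙 (tpow K n)) := by
  induction n with
  | zero => exact opTens_nil _ _ _
  | succ n ih =>
    have h₁ := arity_replicate (A := A) (Z := Z) n
    have h₂ : (List.replicate n (unit A Z)).length = n := List.length_replicate
    have hu : (unit A Z).1 = 1 := rfl
    have h₃ : total (unit A Z :: List.replicate n (unit A Z)) = 1 + n := congrArg (1 + ·) h₁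
    have h₄ : (unit A Z :: List.replicate n (unit A Z)).length = n + 1 := congrArg (· + 1) h₂
    have e₁ := opTens_cons σ.op (unit A Z) _ hu h₁ h₂ h₃ h₄
    have e₂ := opTens_tcast σ.op _ h₃ h₄ (Nat.add_comm 1 n) rfl
    rw [opVal_unit, ih] at e₁
    refine e₂.trans ((congrArg (fun t => ecomp _ (ecomp t _)) e₁).trans ?_)
    rw [tcast_rfl, etens_econst_econst, tensorHom_id, ecomp_econst_id, ecomp_econst_econst,
      ecomp_econst_econst, ecomp_econst_econst, ← Category.assoc (tpowAdd K 1 n).hom,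
      tpowAdd_one_left]
    simp

/-- The cobar construction respects identities. -/
lemma dId_cobarMap (n : ℕ) (u : Z ⟶ 𝟙_ V) :
    (u ≫ dId A n) ≫ cobarMap σ n n = econst Z (𝟙 (tpow K n)) := by
  rw [comp_dId, dIn_cobarMap, opTens_replicate_unit]

/-- The cobar construction takes ordinal sums to tensor products. -/
lemma dSum_cobarMap (f : Z ⟶ dHom A m n) (g : Z ⟶ dHom A m' n') :
    ecomp ((lift f g ≫ dSum m n m' n') ≫ cobarMap σ (m + m') (n + n'))
        (econst Z (tpowAdd K n n').hom) =
      ecomp (econst Z (tpowAdd K m m').hom)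
        (etens (f ≫ cobarMap σ m n) (g ≫ cobarMap σ m' n')) := by
  have : dSum m n m' n' ≫ ecomp (cobarMap σ (m + m') (n + n')) (econst _ (tpowAdd K n n').hom) =
      ecomp (econst _ (tpowAdd K m m').hom) (etens (fst _ _ ≫ cobarMap σ m n)
        (snd _ _ ≫ cobarMap σ m' n')) :=
    dGen₂ fun Z a b h₁ h₂ h₃ h₄ => by
      rw [← Category.assoc, lift_dIn_dSum, comp_ecomp, comp_ecomp, comp_etens, lift_fst_assoc,
        lift_snd_assoc, dIn_cobarMap, dIn_cobarMap, dIn_cobarMap, comp_econst, comp_econst,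
        opTens_append]
  have h := congrArg (fun t => lift f g ≫ t) this
  simpa only [← Category.assoc (lift f g), comp_ecomp, comp_etens, lift_fst, lift_snd,
    comp_econst] using h

lemma dSum_cobarMap_eq (f : Z ⟶ dHom A m n) (g : Z ⟶ dHom A m' n') :
    (lift f g ≫ dSum m n m' n') ≫ cobarMap σ (m + m') (n + n') =
      ecomp (econst Z (tpowAdd K m m').hom) (ecomp (etens (f ≫ cobarMap σ m n)
        (g ≫ cobarMap σ m' n')) (econst Z (tpowAdd K n n').inv)) := by
  rw [← ecomp_assoc, ← dSum_cobarMap, ecomp_assoc]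
  simp

end Cobar

section TensorsOfProjections

variable {V : Type v} [Category.{u} V] [CartesianMonoidalCategory V]
  {E : Type w} [Category.{u} E] [MonoidalCategory E] [EnrichedOrdinaryCategory V E]
  [EnrichedMonoidal V E] [MonoidalClosed V] [HasColimits V] {K P : E} {O : ℕ → V}
  (π : ∀ n, O n ⟶ (P ⟶[V] tpow K n)) {Z Z' : V} {m n m' n' k s s' p : ℕ}

/-! ### Tensor products of projections -/

/-- The tensor product `P^n ⟶ K^(T₁ + ⋯ + Tₙ)` of a list of maps `P ⟶ K^Tᵢ`. -/
def elTensAux : (l : List (Elt Z O)) → (Z ⟶ (tpow P l.length ⟶[V] tpow K (total l)))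
  | [] => econst Z ((tpowZero P).hom ≫ (tpowZero K).inv)
  | x :: l => ecomp (econst Z (tpowSucc P l.length).hom)
      (ecomp (etens (x.2 ≫ π x.1) (elTensAux l)) (econst Z (tpowAdd K x.1 (total l)).inv))

/-- The tensor product of a list of maps `P ⟶ K^Tᵢ`, with source and target transported to given
exponents. -/
def elTens (l : List (Elt Z O)) (hl : l.length = n) (hs : total l = s) :
    Z ⟶ (tpow P n ⟶[V] tpow K s) :=
  ecomp (econst Z (tcast P hl.symm)) (ecomp (elTensAux π l) (econst Z (tcast K hs)))

lemma elTens_congr {l l' : List (Elt Z O)} (e : l = l') (hl : l.length = n) (hs : total l = s) :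
    elTens π l hl hs = elTens π l' (by rw [← e, hl]) (by rw [← e, hs]) := by
  subst e; rfl

lemma elTens_tcast (l : List (Elt Z O)) (hl : l.length = n) (hs : total l = s) (e : n = n')
    (e' : s = s') : elTens π l (hl.trans e) (hs.trans e') =
      ecomp (econst Z (tcast P e.symm)) (ecomp (elTens π l hl hs) (econst Z (tcast K e'))) := by
  subst e e'; simp

lemma elTens_rfl (l : List (Elt Z O)) : elTens π l rfl rfl = elTensAux π l :=
  (econst_id_ecomp _).trans (ecomp_econst_id _)

lemma elTens_nil (hl : ([] : List (Elt Z O)).length = 0) (hs : total ([] : List (Elt Z O)) = 0) :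
    elTens π [] hl hs = econst Z ((tpowZero P).hom ≫ (tpowZero K).inv) :=
  elTens_rfl π []

lemma elTens_cons (x : Elt Z O) (l : List (Elt Z O)) (hl : l.length = p) (hs : total l = s)
    (hl' : (x :: l).length = p + 1) (hs' : total (x :: l) = x.1 + s) :
    elTens π (x :: l) hl' hs' = ecomp (econst Z (tpowSucc P p).hom)
      (ecomp (etens (x.2 ≫ π x.1) (elTens π l hl hs)) (econst Z (tpowAdd K x.1 s).inv)) := by
  subst hs hl
  rw [elTens_rfl]
  exact elTens_rfl π (x :: l)

lemma comp_elTensAux (h : Z' ⟶ Z) (l : List (Elt Z O)) : h ≫ elTensAux π l =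
    elTens π (l.map (pull h)) (List.length_map _) (congrArg List.sum (map_fst_pull h l)) := by
  induction l with
  | nil => exact (comp_econst _ _).trans (elTens_nil π _ _).symm
  | cons x l ih =>
    refine Eq.trans ?_ (elTens_cons π (pull h x) (l.map (pull h)) (List.length_map _)
      (congrArg List.sum (map_fst_pull h l)) _ _).symm
    rw [elTensAux]
    refine (comp_ecomp _ _ _).trans (congrArg₂ ecomp (comp_econst _ _) ((comp_ecomp _ _ _).trans
      (congrArg₂ ecomp ((comp_etens _ _ _).trans (congrArg₂ etens ?_ ih)) (comp_econst _ _))))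
    exact (Category.assoc _ _ _).symm

lemma comp_elTens (h : Z' ⟶ Z) (l : List (Elt Z O)) (hl : l.length = n) (hs : total l = s) :
    h ≫ elTens π l hl hs = elTens π (l.map (pull h)) ((List.length_map _).trans hl)
      ((congrArg List.sum (map_fst_pull h l)).trans hs) := by
  rw [elTens, comp_ecomp, comp_ecomp, comp_elTensAux, comp_econst, comp_econst]
  exact (elTens_tcast π _ _ _ hl hs).symm

/-- The tensor product of a concatenation is the tensor product of the tensor products. -/
lemma elTens_append (l l' : List (Elt Z O)) (hl : l.length = n) (hs : total l = s)
    (hl' : l'.length = n') (hs' : total l' = s') (h : (l ++ l').length = n + n')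
    (h' : total (l ++ l') = s + s') :
    ecomp (elTens π (l ++ l') h h') (econst Z (tpowAdd K s s').hom) =
      ecomp (econst Z (tpowAdd P n n').hom) (etens (elTens π l hl hs) (elTens π l' hl' hs')) := by
  induction l generalizing n s with
  | nil =>
    obtain rfl : 0 = n := hl
    obtain rfl : 0 = s := hs
    refine (congrArg (fun t => ecomp t _) (elTens_tcast π l' hl' hs' (Nat.zero_add n').symm
      (Nat.zero_add s').symm)).trans (Eq.trans ?_ (congrArg (fun t => ecomp _ (etens t _))
        (elTens_nil π rfl rfl)).symm)
    have e : (econst Z ((tpowZero P).hom ≫ (tpowZero K).inv) : Z ⟶ (tpow P 0 ⟶[V] tpow K 0)) =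
        ecomp (econst Z (tpowZero P).hom) (ecomp (econst Z (𝟙 (𝟙_ E)))
          (econst Z (tpowZero K).inv)) := by simp
    rw [tpowAdd_zero_left, tpowAdd_zero_left, e, ← econst_whiskerRight_ecomp_etens,
      ← etens_ecomp_econst_whiskerRight]
    simp only [ecomp_assoc, ecomp_econst_econst, econst_ecomp_ecomp, Category.assoc,
      inv_hom_whiskerRight, Category.comp_id, tcast_tcast_assoc, tcast_rfl, Category.id_comp]
    rw [← ecomp_econst_econst (λ_ _).inv, ← ecomp_assoc (elTens π l' hl' hs'),
      ← etens_leftUnitor_inv, ecomp_assoc, econst_ecomp_ecomp]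
  | cons x l ih =>
    obtain ⟨t, hs₁⟩ : ∃ s, total l = s := ⟨_, rfl⟩
    obtain ⟨p, hl₁⟩ : ∃ p, l.length = p := ⟨_, rfl⟩
    obtain rfl : x.1 + t = s := by rw [← hs, ← hs₁]; rfl
    obtain rfl : p + 1 = n := by rw [← hl, ← hl₁]; rfl
    have hs₂ : total (l ++ l') = t + s' := by rw [total_append, hs₁, hs']
    have hl₂ : (l ++ l').length = p + n' := by rw [List.length_append, hl₁, hl']
    have e := elTens_tcast π (x :: (l ++ l')) (n := p + n' + 1) (s := x.1 + (t + s'))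
      (by rw [← hl₂]; rfl) (by rw [← hs₂]; rfl) (Nat.add_right_comm p n' 1)
      (Nat.add_assoc x.1 t s').symm
    rw [elTens_cons π x (l ++ l') hl₂ hs₂] at e
    refine (congrArg (fun t => ecomp t _) e).trans ?_
    rw [elTens_cons π x l hl₁ hs₁, tpowAdd_succ]
    have ih' := ih hl₁ hs₁ hl₂ hs₂
    have h : (tpowAdd K x.1 (t + s')).inv ≫ tcast K (Nat.add_assoc x.1 t s').symm ≫
        (tpowAdd K (x.1 + t) s').hom = tpow K x.1 ◁ (tpowAdd K t s').hom ≫ (α_ _ _ _).inv ≫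
          (tpowAdd K x.1 t).inv ▷ tpow K s' := by
      have h := tpowAdd_assoc K x.1 t s'
      simp only [← Category.assoc] at h
      rw [← Iso.eq_comp_inv] at h
      rw [Iso.inv_comp_eq, ← cancel_mono ((tpowAdd K x.1 t).hom ▷ tpow K s'), Category.assoc,
        Category.assoc, h]
      simp
    simp only [ecomp_assoc, ecomp_econst_econst, Category.assoc, h]
    simp only [← ecomp_econst_econst, etens_ecomp_econst_whiskerLeft_ecomp, ih',
      ← econst_whiskerLeft_ecomp_etens, ecomp_assoc, etens_associator_inv_ecomp,
      etens_ecomp_econst_whiskerRight]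
    simp only [← econst_whiskerRight_ecomp_etens, econst_ecomp_ecomp, inv_hom_whiskerRight,
      Category.comp_id]

end TensorsOfProjections

section Naturality

variable {V : Type v} [Category.{u} V] [CartesianMonoidalCategory V]
  {E : Type w} [Category.{u} E] [MonoidalCategory E] [EnrichedOrdinaryCategory V E]
  [EnrichedMonoidal V E] [MonoidalClosed V] [HasColimits V] {A : OperadData V} [A.IsOperad]
  {K P : E} (σ : OperadHom A (endOperad V K)) {F : Copresheaf A}
  (π : ∀ n, F.obj n ⟶ (P ⟶[V] tpow K n)) {Z Z' : V} {n n' s s' T T' : ℕ}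

/-! ### The canonical family on `ε(n)` -/

/-- Naturality of a family of maps `F(n) ⟶ map(P, K^n)` with respect to the category of operators.
It makes the elements of `F(n)` act as projections `P ⟶ K^n`. -/
structure IsProj : Prop where
  ecomp_map {Z : V} {m n : ℕ} (e : Z ⟶ F.obj m) (f : Z ⟶ dHom A m n) :
    ecomp (e ≫ π m) (f ≫ cobarMap σ m n) = (lift e f ≫ F.act m n) ≫ π n

variable {π}

/-- The tensor product of projections is natural in all its arguments: acting on each `eᵢ` by a
morphism `fᵢ` amounts to composing with the map given by the ordinal sum of the `fᵢ`. -/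
lemma elTens_actElt (hπ : IsProj σ π) (l : List (Elt Z (pairObj F))) (hl : l.length = n)
    (hs : total (l.map srcElt) = s) (hs' : total (l.map actElt) = s') :
    elTens π (l.map actElt) ((List.length_map _).trans hl) hs' =
      ecomp (elTens π (l.map srcElt) ((List.length_map _).trans hl) hs)
        (sumElt' l hs hs' ≫ cobarMap σ s s') := by
  induction l generalizing n s s' with
  | nil =>
    obtain rfl : 0 = n := hl
    obtain rfl : 0 = s := hs
    obtain rfl : 0 = s' := hs'
    have e : sumElt' ([] : List (Elt Z (pairObj F))) rfl rfl = toUnit Z ≫ dId A 0 :=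
      Category.comp_id _
    have e' : sumElt' ([] : List (Elt Z (pairObj F))) rfl rfl ≫ cobarMap σ 0 0 =
        econst Z (𝟙 (tpow K 0)) :=
      (congrArg (fun t => t ≫ cobarMap σ 0 0) e).trans (dId_cobarMap σ 0 _)
    exact ((congrArg (ecomp _) e').trans (ecomp_econst_id _)).symm
  | cons x l ih =>
    obtain ⟨⟨a, b⟩, q⟩ := x
    obtain ⟨p, hl₁⟩ : ∃ p, l.length = p := ⟨_, rfl⟩
    obtain ⟨t, ht⟩ : ∃ p, total (l.map srcElt) = p := ⟨_, rfl⟩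
    obtain ⟨t', ht'⟩ : ∃ p', total (l.map actElt) = p' := ⟨_, rfl⟩
    obtain rfl : p + 1 = n := by rw [← hl, ← hl₁]; rfl
    obtain rfl : a + t = s := by rw [← hs, ← ht]; rfl
    obtain rfl : b + t' = s' := by rw [← hs', ← ht']; rfl
    have hl₂ := (List.length_map actElt).trans hl₁
    have hl₃ := (List.length_map srcElt).trans hl₁
    have h₁ : elTens π (actElt ⟨(a, b), q⟩ :: l.map actElt) (by simp [hl₁]) hs' =
        ecomp (econst Z (tpowSucc P p).hom) (ecomp (etens ((q ≫ F.act a b) ≫ π b)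
          (elTens π (l.map actElt) hl₂ ht')) (econst Z (tpowAdd K b t').inv)) :=
      elTens_cons π _ _ hl₂ ht' _ _
    have h₂ : elTens π (srcElt ⟨(a, b), q⟩ :: l.map srcElt) (by simp [hl₁]) hs =
        ecomp (econst Z (tpowSucc P p).hom) (ecomp (etens ((q ≫ fst _ _) ≫ π a)
          (elTens π (l.map srcElt) hl₃ ht)) (econst Z (tpowAdd K a t).inv)) :=
      elTens_cons π _ _ hl₃ ht _ _
    have h₃ : sumElt' (⟨(a, b), q⟩ :: l) hs hs' =
        lift (q ≫ snd _ _) (sumElt' l ht ht') ≫ dSum a b t t' := sumElt'_cons _ l ht ht' _ _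
    have hx := hπ.ecomp_map (q ≫ fst _ _) (q ≫ snd _ _)
    have e : lift (q ≫ fst _ _) (q ≫ snd _ _) = q := by ext <;> simp
    rw [e] at hx
    refine h₁.trans (Eq.trans ?_ (congrArg₂ (fun t t' => ecomp t (t' ≫ _)) h₂ h₃).symm)
    rw [ih hl₁ ht ht', dSum_cobarMap_eq, ← hx, etens_ecomp_ecomp]
    simp only [ecomp_assoc, econst_ecomp_ecomp, Iso.inv_hom_id, econst_id_ecomp]

/-- The map `P^n ⟶ K^T` given by elements `e₁, …, eₙ` and a morphism `θ`: the composite of the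
tensor product of the projections `eᵢ` and the map given by `θ`. -/
def epsBetaAux (π : ∀ n, F.obj n ⟶ (P ⟶[V] tpow K n)) (L : List ℕ) (hL : L.length = n) (T : ℕ) :
    listProd F.obj L ⊗ dHom A L.sum T ⟶ (tpow P n ⟶[V] tpow K T) :=
  ecomp (elTens π (listElts L (fst _ _)) ((listElts_length _ _).trans hL)
    (by rw [total, map_fst_listElts])) (snd _ _ ≫ cobarMap σ L.sum T)

lemma lift_epsBetaAux (L : List ℕ) (hL : L.length = n) (p : Z ⟶ listProd F.obj L)
    (θ : Z ⟶ dHom A L.sum T) : lift p θ ≫ epsBetaAux σ π L hL T =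
      ecomp (elTens π (listElts L p) ((listElts_length _ _).trans hL)
        (by rw [total, map_fst_listElts])) (θ ≫ cobarMap σ L.sum T) := by
  rw [epsBetaAux, comp_ecomp, lift_snd_assoc, comp_elTens]
  refine congrArg (fun t => ecomp t _) (elTens_congr π ?_ _ _)
  rw [pull_listElts, lift_fst]

variable (π) in
/-- The family `ε(n)(T) ⟶ map(P^n, K^T)` whose value at `[e₁, …, eₙ; θ]` is the composite of the
tensor product of the projections `eᵢ` and the map given by `θ`. -/
def epsBeta (hπ : IsProj σ π) (n T : ℕ) : epsObj F n T ⟶ (tpow P n ⟶[V] tpow K T) :=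
  lift (𝟙 _) (toUnit _) ≫ epsDesc F (fun L => fst _ (𝟙_ V) ≫ epsBetaAux σ π L.1 L.2 T) (by
    intro L Z q θ w
    rw [lift_fst_assoc, lift_fst_assoc, lift_epsBetaAux, lift_epsBetaAux, ← ecomp_cobarMap,
      ← ecomp_assoc, comp_pairSum]
    refine congrArg (fun t => ecomp t _) ?_
    have h₁ := listElts_pairAct L.1 q
    have h₂ := listElts_pairSrc L.1 q
    rw [elTens_congr π h₁, elTens_congr π h₂]
    exact elTens_actElt σ hπ _ ((listElts_length L.1 q).trans L.2) _ _)

lemma eMk_epsBeta (hπ : IsProj σ π) (l : List (Elt Z F.obj)) (hl : l.length = n)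
    (hs : total l = s) (θ : Z ⟶ dHom A s T) : eMk l hl hs θ ≫ epsBeta σ π hπ n T =
      ecomp (elTens π l hl hs) (θ ≫ cobarMap σ s T) := by
  obtain ⟨L, p, rfl⟩ : ∃ L p, l = listElts L p := ⟨_, _, (listElts_listMk l).symm⟩
  obtain rfl : L.sum = s := by rw [← hs, total, map_fst_listElts]
  have hL : L.length = n := (listElts_length L p).symm.trans hl
  have e : eMk (listElts L p) hl hs θ = lift p θ ≫ epsι F n T ⟨L, hL⟩ :=
    (lift_epsι ⟨L, hL⟩ p θ).symm
  rw [e]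
  refine (comp_lift_assoc _ _ _ _).trans ?_
  rw [Category.comp_id]
  refine (lift_epsι_epsDesc F _ _ ⟨L, hL⟩ (lift p θ) _).trans ?_
  rw [lift_fst_assoc, lift_epsBetaAux]

/-- The canonical family is natural. -/
lemma epsAct_epsBeta (hπ : IsProj σ π) (x : Z ⟶ epsObj F n T) (f : Z ⟶ dHom A T T') :
    (lift x f ≫ epsAct F n T T') ≫ epsBeta σ π hπ n T' =
      ecomp (x ≫ epsBeta σ π hπ n T) (f ≫ cobarMap σ T T') := by
  have : epsAct F n T T' ≫ epsBeta σ π hπ n T' =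
      ecomp (fst _ _ ≫ epsBeta σ π hπ n T) (snd _ _ ≫ cobarMap σ T T') := by
    refine ((eMk_gen n T).prod (.top _)).ext fun Z x hx => ?_
    obtain ⟨⟨l, s, hl, hs, θ, h⟩, -⟩ := hx
    obtain ⟨f, rfl⟩ : ∃ f, x = lift (eMk l hl hs θ) f := ⟨x ≫ snd _ _, by ext <;> simp [← h]⟩
    rw [← Category.assoc, lift_eMk_epsAct, eMk_epsBeta, comp_ecomp, lift_fst_assoc,
      lift_snd_assoc, eMk_epsBeta, ecomp_assoc, ecomp_cobarMap]
  rw [Category.assoc, this, comp_ecomp, lift_fst_assoc, lift_snd_assoc]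

/-- The canonical family takes the concatenation `ε(n)(T) × ε(n')(T') ⟶ ε(n + n')(T + T')` to the
tensor product. -/
lemma epsMul_epsBeta (hπ : IsProj σ π) (x : Z ⟶ epsObj F n T) (y : Z ⟶ epsObj F n' T') :
    (lift x y ≫ epsMul F n n' T T') ≫ epsBeta σ π hπ (n + n') (T + T') =
      ecomp (econst Z (tpowAdd P n n').hom) (ecomp (etens (x ≫ epsBeta σ π hπ n T)
        (y ≫ epsBeta σ π hπ n' T')) (econst Z (tpowAdd K T T').inv)) := by
  have : epsMul F n n' T T' ≫ epsBeta σ π hπ (n + n') (T + T') =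
      ecomp (econst _ (tpowAdd P n n').hom) (ecomp (etens (fst _ _ ≫ epsBeta σ π hπ n T)
        (snd _ _ ≫ epsBeta σ π hπ n' T')) (econst _ (tpowAdd K T T').inv)) := by
    refine ((eMk_gen n T).prod (eMk_gen n' T')).ext fun Z x hx => ?_
    obtain ⟨⟨l, s, hl, hs, θ, h⟩, ⟨l', s', hl', hs', θ', h'⟩⟩ := hx
    obtain rfl : x = lift (eMk l hl hs θ) (eMk l' hl' hs' θ') := by
      rw [← h, ← h']; ext <;> simp
    rw [← Category.assoc, lift_eMk_epsMul, eMk_epsBeta, comp_ecomp, comp_ecomp, comp_etens,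
      lift_fst_assoc, lift_snd_assoc, eMk_epsBeta, eMk_epsBeta, comp_econst, comp_econst,
      dSum_cobarMap_eq, ← ecomp_assoc, elTens_append π l l' hl hs hl' hs', etens_ecomp_ecomp]
    simp only [ecomp_assoc]
  rw [Category.assoc, this, comp_ecomp, comp_ecomp, comp_etens, lift_fst_assoc, lift_snd_assoc,
    comp_econst, comp_econst]

end Naturality

section Limits

variable {V : Type v} [Category.{u} V] [CartesianMonoidalCategory V] [MonoidalClosed V]
  [HasColimits V] {E : Type w} [Category.{u} E] [EnrichedOrdinaryCategory V E] {A : OperadData V}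
  {W : Copresheaf A} {R : Diagram E A} (M : WeightedLimit W R) {X : E} {Z : V}

/-! ### Elements of weighted limits -/

/-- Naturality of the universal family, on elements. -/
lemma WeightedLimit.ecomp_π {m n : ℕ} (e : Z ⟶ W.obj m) (f : Z ⟶ dHom A m n) :
    ecomp (e ≫ M.π m) (f ≫ R.map m n) = (lift e f ≫ W.act m n) ≫ M.π n := by
  rw [Category.assoc, ← M.π_act, comp_ecomp, lift_fst_assoc, lift_snd_assoc]

/-- Maps to a weighted limit are equal if all their components are. -/
lemma WeightedLimit.hom_ext {l l' : Z ⟶ (X ⟶[V] M.pt)}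
    (h : ∀ (n : ℕ) (Z' : V) (r : Z' ⟶ Z) (e : Z' ⟶ W.obj n),
      ecomp (r ≫ l) (e ≫ M.π n) = ecomp (r ≫ l') (e ≫ M.π n)) : l = l' := by
  have hc : IsCone W R (fun n => ecomp (snd (W.obj n) Z ≫ l) (fst _ _ ≫ M.π n)) := fun m n => by
    simp only [comp_ecomp, lift_snd_assoc, lift_fst_assoc, whiskerRight_snd_assoc,
      whiskerRight_fst_assoc]
    rw [ecomp_assoc, ← Category.assoc (fst _ _) (snd _ _) (R.map m n), ecomp_π]
    simp
  exact (M.existsUnique _ hc).unique (fun n => rfl) (fun n => (h n _ _ _).symm)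

/-- A family of components `W(n) ⟶ map(X, R(n))` comes from a unique map to the weighted limit. -/
lemma WeightedLimit.existsUnique_hom (k : ∀ n, W.obj n ⟶ (X ⟶[V] R.obj n))
    (hk : ∀ {Z : V} {m n : ℕ} (e : Z ⟶ W.obj m) (f : Z ⟶ dHom A m n),
      ecomp (e ≫ k m) (f ≫ R.map m n) = (lift e f ≫ W.act m n) ≫ k n) :
    ∃! l : X ⟶ M.pt, ∀ n, M.π n ≫ eHomWhiskerRight V l _ = k n := by
  have key (l : X ⟶ M.pt) (n : ℕ) :
      ecomp (snd (W.obj n) (𝟙_ V) ≫ eHomEquiv V l) (fst _ _ ≫ M.π n) =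
        fst _ _ ≫ M.π n ≫ eHomWhiskerRight V l _ := by
    rw [← Category.assoc, comp_eHomWhiskerRight _ _ (snd _ _)]
  have hc : IsCone W R (fun n => fst (W.obj n) (𝟙_ V) ≫ k n) := fun m n => by
    rw [← Category.assoc (fst _ _) (snd _ _) (R.map m n), lift_fst_assoc, hk]
    simp [rightUnitor_hom]
  obtain ⟨l, hl, hu⟩ := M.existsUnique _ hc
  refine ⟨(eHomEquiv V).symm l, fun n => ?_, fun l' hl' => ?_⟩
  · have h := key ((eHomEquiv V).symm l) n
    rw [Equiv.apply_symm_apply, hl] at h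
    simpa using congrArg (fun t => lift (𝟙 _) (toUnit _) ≫ t) h.symm
  · rw [Equiv.eq_symm_apply]
    exact hu _ fun n => by rw [key, hl']

end Limits

section Action

variable {V : Type v} [Category.{u} V] [CartesianMonoidalCategory V]
  {E : Type w} [Category.{u} E] [MonoidalCategory E] [EnrichedOrdinaryCategory V E]
  [EnrichedMonoidal V E] [MonoidalClosed V] [HasColimits V] [HasLimits V] {A : OperadData V}
  [A.IsOperad] {K P : E} (σ : OperadHom A (endOperad V K)) {F : Copresheaf A}
  {π : ∀ n, F.obj n ⟶ (P ⟶[V] tpow K n)} {Z Z' : V} {n n' s s' T T' : ℕ}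
  (φ : ∀ n, extObj F n ⟶ (tpow P n ⟶[V] P))

/-! ### Compatibility with the operad structures -/

/-- The map `φ(g) : P^n ⟶ P` given by `g : F ⟶ ε(n)` has as component at `e` the component of the
canonical family at `g(e)`. -/
structure IsAction (hπ : IsProj σ π) : Prop where
  ecomp_proj {Z : V} {n T : ℕ} (g : Z ⟶ extObj F n) (e : Z ⟶ F.obj T) :
    ecomp (g ≫ φ n) (e ≫ π T) = (lift e g ≫ extEv F n T) ≫ epsBeta σ π hπ n T

variable {φ}

/-- The value of the canonical family at the concatenation of `g₁(e₁), …, gₙ(eₙ)` is the composite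
of the tensor product of the `φ(gᵢ)` and the tensor product of the projections `eᵢ`. -/
lemma extZip_epsBeta (hπ : IsProj σ π) (hφ : IsAction σ φ hπ) (L ks : List ℕ)
    (h : L.length = ks.length) (p : Z ⟶ listProd F.obj L) (g : Z ⟶ listProd (extObj F) ks) :
    (lift p g ≫ extZip F L ks h) ≫ epsBeta σ π hπ ks.sum L.sum =
      ecomp (opTens φ (listElts ks g) (by rw [total, map_fst_listElts]) (listElts_length ks g))
        (elTens π (listElts L p) ((listElts_length L p).trans h)
          (by rw [total, map_fst_listElts])) := by
  induction L generalizing ks with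
  | nil =>
    cases ks with
    | nil =>
      refine (congrArg (fun t => t ≫ epsBeta σ π hπ 0 0) (comp_extZip_nil F rfl _)).trans ?_
      refine (eMk_epsBeta (s := 0) σ hπ [] rfl rfl _).trans ?_
      refine (congrArg (ecomp _) (dId_cobarMap σ 0 _)).trans ((ecomp_econst_id _).trans ?_)
      exact ((congrArg (fun t => ecomp t _) (opTens_nil φ rfl rfl)).trans (econst_id_ecomp _)).symm
    | cons k ks => simp at h
  | cons m L ih =>
    cases ks with
    | nil => simp at h
    | cons k ks =>
      have hl : L.length = ks.length := Nat.succ.inj h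
      refine (congrArg (fun t => t ≫ epsBeta σ π hπ (k + ks.sum) (m + L.sum))
        (lift_extZip_cons F hl h p g)).trans ?_
      rw [epsMul_epsBeta, ← hφ.ecomp_proj, ih ks hl]
      have h₁ := opTens_cons φ ⟨k, g ≫ fst _ _⟩ (listElts ks (g ≫ snd _ _)) (k := k)
        (s := ks.sum) rfl (by rw [total, map_fst_listElts]) (listElts_length _ _)
        (by simp [total]) (by simp [listElts_length])
      have h₂ := elTens_cons π ⟨m, p ≫ fst _ _⟩ (listElts L (p ≫ snd _ _)) (s := L.sum)
        ((listElts_length _ _).trans hl) (by rw [total, map_fst_listElts])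
        (by simp [listElts_length, hl]) (by simp [total])
      refine Eq.trans ?_ (congrArg₂ ecomp h₁ h₂).symm
      rw [opVal_rfl φ (⟨k, g ≫ fst _ _⟩ : Elt Z (extObj F)), etens_ecomp_ecomp]
      simp only [ecomp_assoc, econst_ecomp_ecomp, Iso.inv_hom_id, econst_id_ecomp]
      rfl

/-- The canonical families turn the map `ε(n) ⟶ ε(k₁ + ⋯ + kₙ)` induced by `g₁, …, gₙ` into
precomposition with the tensor product of the `φ(gᵢ)`. -/
lemma extMap_epsBeta (hπ : IsProj σ π) (hφ : IsAction σ φ hπ) (ks : List ℕ)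
    (x : Z ⟶ epsObj F ks.length T) (g : Z ⟶ listProd (extObj F) ks) :
    (lift x g ≫ extMap F ks T) ≫ epsBeta σ π hπ ks.sum T =
      ecomp (g ≫ listMap φ ks ≫ tensorOps V P ks) (x ≫ epsBeta σ π hπ ks.length T) := by
  have : extMap F ks T ≫ epsBeta σ π hπ ks.sum T =
      ecomp (snd _ _ ≫ listMap φ ks ≫ tensorOps V P ks) (fst _ _ ≫ epsBeta σ π hπ ks.length T) := by
    refine ((eps_gen ks.length T).prod (.top _)).ext fun Z x hx => ?_
    obtain ⟨⟨L, y, h⟩, -⟩ := hx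
    obtain ⟨g, rfl⟩ : ∃ g, x = lift (y ≫ epsι F _ T L) g := ⟨x ≫ snd _ _, by ext <;> simp [← h]⟩
    obtain ⟨p, θ, rfl⟩ : ∃ p θ, y = lift p θ := ⟨y ≫ fst _ _, y ≫ snd _ _, by simp⟩
    rw [← Category.assoc, lift_epsι_extMap, epsAct_epsBeta, lift_fst, lift_snd,
      extZip_epsBeta σ hπ hφ, comp_ecomp, lift_fst_assoc, lift_snd_assoc, lift_epsι, eMk_epsBeta,
      comp_listMap_tensorOps, ecomp_assoc]
  rw [Category.assoc, this, comp_ecomp, lift_fst_assoc, lift_snd_assoc]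

/-- The action of a composite `f(g₁, …, gₙ)` has the same components as the composite of the
actions. -/
lemma extComp_action (hπ : IsProj σ π) (hφ : IsAction σ φ hπ) (ks : List ℕ)
    (f : Z ⟶ extObj F ks.length) (g : Z ⟶ listProd (extObj F) ks) (e : Z ⟶ F.obj T) :
    ecomp ((lift f g ≫ extComp F ks) ≫ φ ks.sum) (e ≫ π T) =
      ecomp (ecomp (g ≫ listMap φ ks ≫ tensorOps V P ks) (f ≫ φ ks.length)) (e ≫ π T) := by
  have h : lift e (lift f g ≫ extComp F ks) ≫ extEv F ks.sum T =
      lift (lift e f ≫ extEv F ks.length T) g ≫ extMap F ks T := by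
    have h : F.obj T ◁ extComp F ks ≫ extEv F ks.sum T =
        lift (lift (fst _ _) (snd _ _ ≫ fst _ _) ≫ extEv F ks.length T) (snd _ _ ≫ snd _ _) ≫
          extMap F ks T := natLift_natEv _ _ T
    have h' := congrArg (fun t => lift e (lift f g) ≫ t) h
    simpa [comp_lift_assoc] using h'
  rw [hφ.ecomp_proj, h, extMap_epsBeta σ hπ hφ, ecomp_assoc, hφ.ecomp_proj]

/-- The unit acts as the identity, up to the identification of `P` with its first tensor power. -/
lemma extOne_action (hπ : IsProj σ π) (hφ : IsAction σ φ hπ) (u : Z ⟶ 𝟙_ V) (e : Z ⟶ F.obj T) :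
    ecomp ((u ≫ extOne F) ≫ φ 1) (e ≫ π T) = ecomp (econst Z (tpowOne P).hom) (e ≫ π T) := by
  have h : lift e (u ≫ extOne F) ≫ extEv F 1 T =
      eMk (s := T) [⟨T, e⟩] rfl rfl (toUnit _ ≫ dId A T) := by
    have h : F.obj T ◁ extOne F ≫ extEv F 1 T =
        eMk (s := T) [⟨T, fst _ _⟩] rfl rfl (toUnit _ ≫ dId A T) := natLift_natEv _ _ T
    rw [← lift_whiskerLeft_assoc, h]
    refine (comp_eMk (s := T) _ _ _ _ _).trans (eMk_congr ?_ _ _ ?_)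
    · exact congrArg (fun t => [(⟨T, t⟩ : Elt Z F.obj)]) (lift_fst _ _)
    · rw [← Category.assoc, toUnit_unique (lift e u ≫ toUnit _) (toUnit Z)]
  -- The tensor product of a single projection is that projection.
  have e₁ : elTens π [(⟨T, e⟩ : Elt Z F.obj)] (n := 1) (s := T) rfl rfl =
      ecomp (econst Z (tpowSucc P 0).hom) (ecomp (etens (e ≫ π T)
        (econst Z ((tpowZero P).hom ≫ (tpowZero K).inv))) (econst Z (tpowAdd K T 0).inv)) :=
    (elTens_cons π (⟨T, e⟩ : Elt Z F.obj) [] (s := 0) rfl rfl rfl rfl).trans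
      (congrArg (fun t => ecomp _ (ecomp (etens _ t) _)) (elTens_nil π rfl rfl))
  have e₂ : (tpowAdd K T 0).inv = tpow K T ◁ (tpowZero K).hom ≫ (ρ_ _).hom := by
    rw [← cancel_epi (tpowAdd K T 0).hom, Iso.hom_inv_id, tpowAdd_zero_right]
    simp
  -- A constant at the unit object, in the form required by the right unitor.
  have e₃ : econst Z (tpowZero P).hom =
      ecomp (econst Z (tpowZero P).hom) (econst Z (𝟙 (𝟙_ E))) := by simp
  rw [hφ.ecomp_proj, h]
  refine (eMk_epsBeta (s := T) σ hπ _ rfl rfl _).trans ?_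
  refine (congrArg (ecomp _) (dId_cobarMap σ T _)).trans ((ecomp_econst_id _).trans (e₁.trans ?_))
  rw [e₂, ← ecomp_econst_econst (tpow K T ◁ _), etens_ecomp_econst_whiskerLeft_ecomp,
    ecomp_econst_econst, Category.assoc, Iso.inv_hom_id, Category.comp_id, e₃,
    ← econst_whiskerLeft_ecomp_etens, ecomp_assoc]
  refine (congrArg (fun t => ecomp _ (ecomp _ t)) (etens_rightUnitor (e ≫ π T))).trans ?_
  simp only [econst_ecomp_ecomp, tpowOne, Iso.trans_hom, whiskerLeftIso_hom]

end Action

section CompletionAction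

variable {V : Type v} [Category.{u} V] [CartesianMonoidalCategory V] [MonoidalClosed V]
  [HasLimits V] [HasColimits V] {E : Type w} [Category.{u} E] [MonoidalCategory E]
  [EnrichedOrdinaryCategory V E] [EnrichedMonoidal V E] [TensoredCotensored V E] [HasLimits E]
  {A : OperadData V} [A.IsOperad] {K : E} (Δ : SimplexCategory ⥤ V)
  (σ : OperadHom A (endOperad V K)) {Z : V}

/-! ### The action on the completion -/

lemma isProj_completionπ : IsProj σ (completionπ Δ σ) :=
  ⟨fun e f => (wlim σ (tildeE A Δ)).ecomp_π e f⟩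

/-- The tensor product of the projections of the completion, on elements. -/
lemma comp_tensorπ (L : List ℕ) (q : Z ⟶ listProd (tildeE A Δ).obj L) :
    q ≫ tensorπ Δ σ L = elTens (completionπ Δ σ) (listElts L q) (listElts_length L q)
      (by rw [total, map_fst_listElts]) := by
  induction L with
  | nil =>
    refine Eq.trans ?_ (elTens_nil _ rfl rfl).symm
    have e : econst Z ((tpowZero (completion Δ σ)).hom ≫ (tpowZero K).inv) =
        toUnit Z ≫ eId V (𝟙_ E) := by
      rw [← eHomEquiv_id]
      exact congrArg (econst Z) (Category.comp_id (𝟙 (𝟙_ E)))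
    refine Eq.trans ?_ e.symm
    exact congrArg (fun t => t ≫ eId V (𝟙_ E)) (toUnit_unique _ _)
  | cons T L ih =>
    have h := elTens_cons (completionπ Δ σ) (⟨T, q ≫ fst _ _⟩ : Elt Z (tildeE A Δ).obj)
      (listElts L (q ≫ snd _ _)) (p := L.length) (s := L.sum) (listElts_length L _)
      (by rw [total, map_fst_listElts]) (by simp [listElts_length])
      (by rw [total, List.map_cons, List.sum_cons, map_fst_listElts])
    refine Eq.trans ?_ h.symm
    rw [← ih]
    refine Eq.trans ?_ (econst_id_ecomp _).symm
    have e : q ≫ (completionπ Δ σ T ⊗ₘ tensorπ Δ σ L) =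
        lift ((q ≫ fst _ _) ≫ completionπ Δ σ T) ((q ≫ snd _ _) ≫ tensorπ Δ σ L) :=
      CartesianMonoidalCategory.hom_ext _ _
        ((lift_fst_tensorHom q _ _).trans (lift_fst _ _).symm)
        ((lift_snd_tensorHom q _ _).trans (lift_snd _ _).symm)
    rw [etens, ← e, ← comp_eHomWhiskerLeft_eq]
    have e' : tensorπ Δ σ (T :: L) = (completionπ Δ σ T ⊗ₘ tensorπ Δ σ L) ≫
        EnrichedMonoidal.eTensor (completion Δ σ) (tpow K T) (tpow (completion Δ σ) L.length)
          (tpow K L.sum) ≫ eHomWhiskerLeft V _ (tpowAdd K T L.sum).inv := rfl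
    refine (congrArg (fun t => q ≫ t) e').trans ((Category.assoc _ _ _).symm.trans ?_)
    exact (Category.assoc _ _ _).symm

/-- The canonical family on `ε(n)` determined by the projections of the completion. -/
abbrev betaFamily (n T : ℕ) :
    epsObj (tildeE A Δ) n T ⟶ (tpow (completion Δ σ) n ⟶[V] tpow K T) :=
  epsBeta σ (completionπ Δ σ) (isProj_completionπ Δ σ) n T

variable (β : ∀ n, tpow (completion Δ σ) n ⟶ rPow Δ σ n)

/-- The condition on the components of `βₙ` at the classes `[e₁, …, eₙ; id]` determines all
components: they form the canonical family. -/
lemma isBeta_iff : IsBeta Δ σ β ↔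
    ∀ n T, rPowπ Δ σ n T ≫ eHomWhiskerRight V (β n) _ = betaFamily Δ σ n T := by
  -- The value of the canonical family at `[e₁, …, eₙ; θ]`.
  have key {Z : V} {n T : ℕ} (L : {L : List ℕ // L.length = n})
      (p : Z ⟶ listProd (tildeE A Δ).obj L.1) (θ : Z ⟶ dHom A L.1.sum T) :
      (lift p θ ≫ epsι _ n T L) ≫ betaFamily Δ σ n T =
        ecomp (elTens (completionπ Δ σ) (listElts L.1 p) ((listElts_length L.1 p).trans L.2)
          (by rw [total, map_fst_listElts])) (θ ≫ cobarMap σ L.1.sum T) := by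
    rw [lift_epsι, eMk_epsBeta]
  refine ⟨fun hβ n T => (eps_gen n T).ext fun Z x hx => ?_, fun h L => ?_⟩
  · obtain ⟨⟨L, rfl⟩, y, rfl⟩ := hx
    obtain ⟨p, θ, rfl⟩ : ∃ p θ, y = lift p θ := ⟨y ≫ fst _ _, y ≫ snd _ _, by simp⟩
    -- The class `[e₁, …, eₙ; θ]` is the image of `[e₁, …, eₙ; id]` under `θ`.
    have e : lift p θ ≫ epsι (tildeE A Δ) L.length T ⟨L, rfl⟩ =
        lift (lift p (toUnit Z ≫ dId A L.sum) ≫ epsι (tildeE A Δ) L.length L.sum ⟨L, rfl⟩) θ ≫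
          epsAct (tildeE A Δ) L.length L.sum T := by
      refine Eq.trans ?_ (lift_epsι_epsAct _ _ _ _).symm
      rw [lift_fst, lift_snd, lift_dId_dComp]
    have h {x : Z ⟶ epsObj (tildeE A Δ) L.length L.sum} :
        (lift x θ ≫ epsAct (tildeE A Δ) L.length L.sum T) ≫ rPowπ Δ σ L.length T =
          ecomp (x ≫ rPowπ Δ σ L.length L.sum) (θ ≫ cobarMap σ L.sum T) :=
      ((wlim σ (eps (tildeE A Δ) L.length)).ecomp_π x θ).symm
    have h' : (lift p (toUnit Z ≫ dId A L.sum) ≫ epsι (tildeE A Δ) L.length L.sum ⟨L, rfl⟩) ≫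
        rPowπ Δ σ L.length L.sum ≫ eHomWhiskerRight V (β L.length) _ = p ≫ tensorπ Δ σ L := by
      rw [← hβ L, comp_lift_assoc, Category.comp_id, ← Category.assoc p, Category.assoc,
        toUnit_unique (p ≫ toUnit _) (toUnit Z)]
    rw [key, ← Category.assoc, comp_eHomWhiskerRight_eq, e, h, ← ecomp_assoc,
      ← comp_eHomWhiskerRight_eq, Category.assoc, h', comp_tensorπ]
  · rw [h, ← Category.assoc, key ⟨L, rfl⟩]
    refine (congrArg (ecomp _) (dId_cobarMap σ L.sum _)).trans ((ecomp_econst_id _).trans ?_)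
    exact (comp_tensorπ Δ σ L _).symm.trans (Category.id_comp _)

lemma existsUnique_isBeta : ∃! β : ∀ n, tpow (completion Δ σ) n ⟶ rPow Δ σ n, IsBeta Δ σ β := by
  have h (n : ℕ) := (wlim σ (eps (tildeE A Δ) n)).existsUnique_hom (betaFamily Δ σ n)
    (fun e f => (epsAct_epsBeta σ (isProj_completionπ Δ σ) e f).symm)
  choose β hβ hu using h
  refine ⟨β, (isBeta_iff Δ σ β).2 hβ, fun β' hβ' => funext fun n => hu n _ ?_⟩
  exact (isBeta_iff Δ σ β').1 hβ' n

variable {β}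

/-- The action of the extended operad on the completion: `f ↦ βₙ ≫ f^*`. -/
def completionAct (β : ∀ n, tpow (completion Δ σ) n ⟶ rPow Δ σ n) (n : ℕ) :
    extObj (tildeE A Δ) n ⟶ (tpow (completion Δ σ) n ⟶[V] completion Δ σ) :=
  precomp Δ σ n ≫ eHomWhiskerRight V (β n) (completion Δ σ)

/-- The component at `e` of the map `K̂^n ⟶ K̂` by which `f` acts is the component of the canonical
family at `f(e)`. -/
lemma isAction_completionAct (hβ : IsBeta Δ σ β) :
    IsAction σ (completionAct Δ σ β) (isProj_completionπ Δ σ) := by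
  refine ⟨fun {Z n T} g e => ?_⟩
  let q : extObj (tildeE A Δ) n ⟶ (rPow Δ σ n ⟶[V] completion Δ σ) := precomp Δ σ n
  have h : ecomp (snd _ _ ≫ q) (fst _ _ ≫ completionπ Δ σ T) =
      extEv (tildeE A Δ) n T ≫ rPowπ Δ σ n T :=
    ((wlim σ (tildeE A Δ)).existsUnique _ (isCone_precomp Δ σ n)).choose_spec.1 T
  have h₁ : ecomp (g ≫ q) (e ≫ completionπ Δ σ T) =
      (lift e g ≫ extEv (tildeE A Δ) n T) ≫ rPowπ Δ σ n T := by
    rw [Category.assoc, ← h, comp_ecomp, lift_snd_assoc, lift_fst_assoc]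
  have h₂ : g ≫ completionAct Δ σ β n = ecomp (econst Z (β n)) (g ≫ q) :=
    (Category.assoc g q _).symm.trans (comp_eHomWhiskerRight_eq _ _)
  rw [h₂, ecomp_assoc, h₁, ← comp_eHomWhiskerRight_eq, Category.assoc _ (rPowπ Δ σ n T),
    (isBeta_iff Δ σ β).1 hβ]

/-- The action of the extended operad on the completion is a morphism of operads. -/
def completionHom (hβ : IsBeta Δ σ β) :
    OperadHom (extendedOperad A Δ) (endOperad V (completion Δ σ)) where
  map := completionAct Δ σ β
  map_one := by
    have hφ := isAction_completionAct Δ σ hβ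
    rw [endOperad_one]
    refine (wlim σ (tildeE A Δ)).hom_ext fun n Z r e => ?_
    refine Eq.trans ?_ ((extOne_action σ _ hφ r e).trans ?_)
    · exact congrArg (fun t => ecomp t _) (Category.assoc _ _ _).symm
    · exact congrArg (fun t => ecomp t _) (comp_econst _ _).symm
  map_comp ks := by
    have hφ := isAction_completionAct Δ σ hβ
    refine (wlim σ (tildeE A Δ)).hom_ext fun n Z r e => ?_
    obtain ⟨f, g, rfl⟩ : ∃ (f : Z ⟶ extObj (tildeE A Δ) ks.length)
        (g : Z ⟶ listProd (extObj (tildeE A Δ)) ks), r = lift f g :=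
      ⟨r ≫ fst _ _, r ≫ snd _ _, CartesianMonoidalCategory.hom_ext _ _ (lift_fst _ _).symm
        (lift_snd _ _).symm⟩
    refine Eq.trans ?_ ((extComp_action σ _ hφ ks f g e).trans ?_)
    · exact congrArg (fun t => ecomp t _) (Category.assoc _ _ _).symm
    · refine congrArg (fun t => ecomp t _) (Eq.symm ?_)
      refine (lift_map_assoc _ _ _ _ _).trans ((lift_endOperad_comp _ _ _).trans ?_)
      exact congrArg (fun t => ecomp t _) (Category.assoc _ _ _)

end CompletionAction

end OperadCompletion

end

theorem mainTheorem6 (P : ObjectProperty TopCat.{u}) [HasCWComplexes P]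
    [CartesianMonoidalCategory P.FullSubcategory] [MonoidalClosed P.FullSubcategory]
    [HasLimits P.FullSubcategory] [HasColimits P.FullSubcategory]
    {E : Type w} [Category.{u} E] [MonoidalCategory E]
    [EnrichedOrdinaryCategory P.FullSubcategory E] [EnrichedMonoidal P.FullSubcategory E]
    [TensoredCotensored P.FullSubcategory E] [HasLimits E] [HasColimits E]
    (A : OperadData P.FullSubcategory) [A.IsOperad] (hA : A.IsAInfinity)
    (K : E) (σ : OperadHom A (endOperad P.FullSubcategory K)) :
    (∃! β : ∀ n, tpow (completion (simplices P) σ) n ⟶ rPow (simplices P) σ n,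
      IsBeta (simplices P) σ β) ∧
    ∀ β : ∀ n, tpow (completion (simplices P) σ) n ⟶ rPow (simplices P) σ n,
      IsBeta (simplices P) σ β →
      ∃ φ : OperadHom (extendedOperad A (simplices P))
          (endOperad P.FullSubcategory (completion (simplices P) σ)),
        ∀ n, φ.map n = precomp (simplices P) σ n ≫
          eHomWhiskerRight P.FullSubcategory (β n) (completion (simplices P) σ) :=
  ⟨existsUnique_isBeta _ σ, fun _ hβ => ⟨completionHom _ σ hβ, fun _ => rfl⟩⟩
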